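/- Let $N\ge 1$, and let $\Omega\subset\mathbb R^N$ be either a ball $\{|x|<R\}$ with $R>0$, or an annulus $\{R_0<|x|<R\}$ with $0<R_0<R$. Let $H_r$ be the set of radial functions in $H^2(\Omega)\cap H^1_0(\Omega)$, let $\beta>0$, and put $$J_\beta(v)=\int_\Omega\Big(\frac{|\Delta v|^2}{2}+\beta\,\frac{|\nabla v|^2}{2}+\frac{v^4}{4}-\frac{v^2}{2}\Big)\,dx ,\qquad v\in H_r,$$ with $J_\beta(v)=+\infty$ if $v\notin L^4(\Omega)$. Let $\lambda_1$ be the first Dirichlet eigenvalue of $-\Delta$ in $\Omega$ and assume that $\lambda_1^2+\beta\lambda_1<1$. Let $u\in H_r$ be a global radial minimizer, that is, $J_\beta(u)<\infty$ and $J_\beta(u)\le J_\beta(v)$ for all $v\in H_r$, and assume that $\|u\|_{L^\infty(\Omega)}\le 1$. Then $u$ agrees almost everywhere in $\Omega$ with $U(|x|)$ for a function $U$ that is continuously differentiable on $(0,R)$ if $\Omega$ is the ball, and on $(R_0,R)$ if $\Omega$ is the annulus, and $\partial_r u=U'(|x|)$ has the following properties. 1. If $\Omega$ is the ball, then $\partial_r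 u$ does not change sign: $U'\ge 0$ on $(0,R)$ or $U'\le 0$ on $(0,R)$. 2. If $\Omega$ is the annulus, then $\partial_r u$ changes sign exactly once: there are $\rho\in(R_0,R)$ and $\sigma\in\{1,-1\}$ such that $\sigma U'\ge 0$ on $(R_0,\rho)$, $\sigma U'\le 0$ on $(\rho,R)$, and $U'$ is not identically zero on either of these two intervals. In both cases $u$ does not change sign: $u\ge 0$ almost everywhere in $\Omega$ or $u\le 0$ almost everywhere in $\Omega$. -/

import Mathlib

open MeasureTheory Set Filter Topology
open scoped ENNReal ContDiff

noncomputable section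

/-- Test functions `C_c^∞(Ω)`. -/
def IsTestFunction {N : ℕ} (Ω : Set (EuclideanSpace ℝ (Fin N)))
    (φ : EuclideanSpace ℝ (Fin N) → ℝ) : Prop :=
  ContDiff ℝ ∞ φ ∧ HasCompactSupport φ ∧ tsupport φ ⊆ Ω

/-- The classical partial derivative `∂ᵢφ`. -/
def classicalPartial {N : ℕ} (i : Fin N) (φ : EuclideanSpace ℝ (Fin N) → ℝ)
    (x : EuclideanSpace ℝ (Fin N)) : ℝ :=
  fderiv ℝ φ x (EuclideanSpace.single i 1)

/-- `g` is a weak partial derivative `∂ᵢu` of `u` in `Ω`. -/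
def HasWeakPartial {N : ℕ} (Ω : Set (EuclideanSpace ℝ (Fin N))) (i : Fin N)
    (u g : EuclideanSpace ℝ (Fin N) → ℝ) : Prop :=
  LocallyIntegrableOn u Ω volume ∧ LocallyIntegrableOn g Ω volume ∧
    ∀ φ : EuclideanSpace ℝ (Fin N) → ℝ, IsTestFunction Ω φ →
      ∫ x in Ω, u x * classicalPartial i φ x = -∫ x in Ω, g x * φ x

open Classical in
/-- The weak partial derivative `∂ᵢu` in `Ω`. On an open set it is unique up to null sets, so the
choice of a representative is immaterial; the value is `0` if there is no weak derivative. -/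
def weakPartial {N : ℕ} (Ω : Set (EuclideanSpace ℝ (Fin N))) (i : Fin N)
    (u : EuclideanSpace ℝ (Fin N) → ℝ) : EuclideanSpace ℝ (Fin N) → ℝ :=
  if h : ∃ g, HasWeakPartial Ω i u g then h.choose else 0

/-- `u ∈ H¹(Ω) = W^{1,2}(Ω)`. -/
def MemH1 {N : ℕ} (Ω : Set (EuclideanSpace ℝ (Fin N)))
    (u : EuclideanSpace ℝ (Fin N) → ℝ) : Prop :=
  MemLp u 2 (volume.restrict Ω) ∧
    ∀ i, HasWeakPartial Ω i u (weakPartial Ω i u) ∧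
      MemLp (weakPartial Ω i u) 2 (volume.restrict Ω)

/-- `u ∈ H²(Ω) = W^{2,2}(Ω)`. -/
def MemH2 {N : ℕ} (Ω : Set (EuclideanSpace ℝ (Fin N)))
    (u : EuclideanSpace ℝ (Fin N) → ℝ) : Prop :=
  MemH1 Ω u ∧ ∀ i, MemH1 Ω (weakPartial Ω i u)

/-- `u ∈ H¹₀(Ω)`, the closure of `C_c^∞(Ω)` in `H¹(Ω)`. -/
def MemH1Zero {N : ℕ} (Ω : Set (EuclideanSpace ℝ (Fin N)))
    (u : EuclideanSpace ℝ (Fin N) → ℝ) : Prop :=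
  MemH1 Ω u ∧ ∃ φ : ℕ → EuclideanSpace ℝ (Fin N) → ℝ,
    (∀ n, IsTestFunction Ω (φ n)) ∧
    Tendsto (fun n => eLpNorm (fun x => φ n x - u x) 2 (volume.restrict Ω)) atTop (𝓝 0) ∧
    ∀ i, Tendsto (fun n => eLpNorm (fun x => classicalPartial i (φ n) x - weakPartial Ω i u x) 2
      (volume.restrict Ω)) atTop (𝓝 0)

/-- `u` is radial in `Ω` (as an almost everywhere defined function). -/
def IsRadialOn {N : ℕ} (Ω : Set (EuclideanSpace ℝ (Fin N)))
    (u : EuclideanSpace ℝ (Fin N) → ℝ) : Prop :=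
  ∃ U : ℝ → ℝ, ∀ᵐ x ∂(volume.restrict Ω), u x = U ‖x‖

/-- `u ∈ H_r`, the radial functions of `H = H²(Ω) ∩ H¹₀(Ω)`. -/
def MemHr {N : ℕ} (Ω : Set (EuclideanSpace ℝ (Fin N)))
    (u : EuclideanSpace ℝ (Fin N) → ℝ) : Prop :=
  MemH2 Ω u ∧ MemH1Zero Ω u ∧ IsRadialOn Ω u

/-- The weak Laplacian `Δu`. -/
def weakLaplacian {N : ℕ} (Ω : Set (EuclideanSpace ℝ (Fin N)))
    (u : EuclideanSpace ℝ (Fin N) → ℝ) (x : EuclideanSpace ℝ (Fin N)) : ℝ :=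
  ∑ i, weakPartial Ω i (weakPartial Ω i u) x

/-- The energy `J_β(u) = ∫_Ω (|Δu|²/2 + β|∇u|²/2 + u⁴/4 - u²/2) dx`. -/
def energy {N : ℕ} (β : ℝ) (Ω : Set (EuclideanSpace ℝ (Fin N)))
    (u : EuclideanSpace ℝ (Fin N) → ℝ) : ℝ :=
  ∫ x in Ω, ((weakLaplacian Ω u x) ^ 2 / 2 + β * (∑ i, (weakPartial Ω i u x) ^ 2) / 2
    + (u x) ^ 4 / 4 - (u x) ^ 2 / 2)

/-- `u ∈ H_r` and `J_β(u) ≤ J_β(v)` for all `v ∈ H_r`. A function of `H_r` that is not in `L⁴(Ω)`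
(possible only in high dimension) has energy `+∞`; this is what the `L⁴` conditions encode. -/
def IsGlobalRadialMinimizer {N : ℕ} (β : ℝ) (Ω : Set (EuclideanSpace ℝ (Fin N)))
    (u : EuclideanSpace ℝ (Fin N) → ℝ) : Prop :=
  MemHr Ω u ∧ MemLp u 4 (volume.restrict Ω) ∧
    ∀ v : EuclideanSpace ℝ (Fin N) → ℝ, MemHr Ω v → MemLp v 4 (volume.restrict Ω) →
      energy β Ω u ≤ energy β Ω v

/-- `μ` is an eigenvalue of `-Δ` in `Ω` with Dirichlet boundary conditions. -/
def IsDirichletEigenvalue {N : ℕ} (Ω : Set (EuclideanSpace ℝ (Fin N))) (μ : ℝ) : Prop :=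
  ∃ φ : EuclideanSpace ℝ (Fin N) → ℝ, MemH1Zero Ω φ ∧ ¬ (φ =ᵐ[volume.restrict Ω] 0) ∧
    ∀ ψ : EuclideanSpace ℝ (Fin N) → ℝ, MemH1Zero Ω ψ →
      ∫ x in Ω, ∑ i, weakPartial Ω i φ x * weakPartial Ω i ψ x = μ * ∫ x in Ω, φ x * ψ x

/-- `λ₁` is the first Dirichlet eigenvalue of `-Δ` in `Ω`. -/
def IsFirstDirichletEigenvalue {N : ℕ} (Ω : Set (EuclideanSpace ℝ (Fin N))) (lam : ℝ) : Prop :=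
  IsLeast {μ : ℝ | IsDirichletEigenvalue Ω μ} lam

/-- The open annulus `{x : R₀ < |x| < R}`. -/
def annulus (N : ℕ) (R₀ R : ℝ) : Set (EuclideanSpace ℝ (Fin N)) :=
  {x | R₀ < ‖x‖ ∧ ‖x‖ < R}

/-- `U` is the profile of class `C¹((a,b))` of the radial function `u`, so that `∂ᵣu` at `x` is
`deriv U ‖x‖`. It is uniquely determined on `(a,b)` if `Ω` is the set `a < |x| < b`, up to a
null set. -/
def IsC1Profile {N : ℕ} (Ω : Set (EuclideanSpace ℝ (Fin N))) (a b : ℝ)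
    (u : EuclideanSpace ℝ (Fin N) → ℝ) (U : ℝ → ℝ) : Prop :=
  ContDiffOn ℝ 1 U (Ioo a b) ∧ ∀ᵐ x ∂(volume.restrict Ω), u x = U ‖x‖

/-- `f` does not change sign on `(a,b)`. -/
def HasOneSignOn (f : ℝ → ℝ) (a b : ℝ) : Prop :=
  (∀ r ∈ Ioo a b, 0 ≤ f r) ∨ (∀ r ∈ Ioo a b, f r ≤ 0)

/-- `f` changes sign on `(a,b)`, at one place, from positive to negative. -/
def ChangesFromPosToNeg (f : ℝ → ℝ) (a b : ℝ) : Prop :=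
  ∃ ρ ∈ Ioo a b,
    (∀ r ∈ Ioo a ρ, 0 ≤ f r) ∧ (∀ r ∈ Ioo ρ b, f r ≤ 0) ∧
    (∃ r ∈ Ioo a ρ, 0 < f r) ∧ (∃ r ∈ Ioo ρ b, f r < 0)

/-- `f` changes sign exactly once on `(a,b)`. -/
def ChangesSignExactlyOnce (f : ℝ → ℝ) (a b : ℝ) : Prop :=
  ChangesFromPosToNeg f a b ∨ ChangesFromPosToNeg (fun r => -f r) a b

/-- `u` does not change sign in `Ω`. -/
def HasOneSignAE {N : ℕ} (Ω : Set (EuclideanSpace ℝ (Fin N)))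
    (u : EuclideanSpace ℝ (Fin N) → ℝ) : Prop :=
  (∀ᵐ x ∂(volume.restrict Ω), 0 ≤ u x) ∨ (∀ᵐ x ∂(volume.restrict Ω), u x ≤ 0)

end

/-! The energy is lowered by a rearrangement of the radial derivative. Let `V` be the profile of the
minimizer and `w = V'`, which is locally absolutely continuous with derivative `q`. Multiply `w` by
a factor `κ` with `|κ| ≤ 1` that is constant on each component of `{w ≠ 0}`. No jump arises, since
`κ` changes only where `w` vanishes, so `(κw)' = κq`. The radial function `v` with derivative `κw`
therefore has gradient `κ∇u` and Laplacian `κΔu`, and the quadratic terms of the energy do not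
increase. If moreover its profile `Y` satisfies `|V| ≤ Y ≤ 1`, the potential term does not increase
either, because `t⁴/4 - t²/2` decreases on `[0,1]`. Minimality then forces `|V| = Y`
(`eq_abs_of_minimizer`), so `|V|` inherits the monotonicity of `Y`.

The factor is built in `exists_monotone_rearrangement`. Let `M = sup |V|` and let `L(r)` be the
integral of `|w|` over `(r,R)`, so that `|V| ≤ L`. Going inwards from `R`, take `κ = ± sign w`, so
that `Y = L`, up to the component `(a,b)` of `{w ≠ 0}` on which `L` would reach `M`; traverse that
component with reduced slope `c ∈ [0,1]` so that `Y` climbs at most to `M`; take `κ = 0` further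
inwards. On `(a,b)` the function `V` is affine in `L`, and comparing the values at the two ends
gives `|V| ≤ Y`. In the ball, `M` need not be attained: if `L` stays below `M`, then `|V| = L`
already. In the annulus the construction is carried out on both sides of a maximum point of `|V|`,
which gives a `Y` that rises and then falls. A function whose modulus is monotone or unimodal in
this way cannot change sign.

In the annulus one also needs `u ≠ 0`, and here `λ₁² + βλ₁ < 1` enters. The eigenfunction of the
hypothesis is not known to be radial, so it is not used as a competitor. Suppose instead that all
radial energies are nonnegative. The second variation at zero bounds the radial solution operator
`T` of `-Δv = f` by `1/m` in `L²`, where `m > 0` and `m² + βm = 1` (`integral_radialGreen_sq_le`).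
For `0 < μ < m` a partial sum `F` of the Neumann series of `μT` is positive and satisfies `μTF ≤ F`.
Barta's inequality for the positive function `TF` shows that every Dirichlet eigenvalue is at least
`μ`, and a choice of `μ` between `λ₁` and `m` is a contradiction (`exists_energy_neg`).

The analytic groundwork translates between `H_r` and profiles: a function in `H_r` has a `C¹`
profile with boundary values (`exists_profile_of_memHr`), and a profile with suitable derivatives
gives a function in `H_r` (`memHr_of_profile`). -/

/-! ### Integration of radial functions over annuli. -/

/-- The area of the unit sphere in `ℝ^N`. -/
noncomputable def sphereArea (N : ℕ) : ℝ :=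
  N * (volume : Measure (EuclideanSpace ℝ (Fin N))).real (Metric.ball 0 1)

theorem sphereArea_pos {N : ℕ} (hN : 1 ≤ N) : 0 < sphereArea N := by
  unfold sphereArea
  have h1 : (0 : ℝ) < N := by exact_mod_cast hN
  have h2 : 0 < (volume : Measure (EuclideanSpace ℝ (Fin N))).real (Metric.ball 0 1) :=
    ENNReal.toReal_pos (Metric.measure_ball_pos _ _ one_pos).ne' measure_ball_lt_top.ne
  positivity

theorem nontrivial_euclideanSpace {N : ℕ} (hN : 1 ≤ N) :
    Nontrivial (EuclideanSpace ℝ (Fin N)) := by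
  have : Nonempty (Fin N) := ⟨⟨0, hN⟩⟩
  infer_instance

theorem isOpen_annulus (N : ℕ) (a b : ℝ) : IsOpen (annulus N a b) :=
  isOpen_Ioo.preimage continuous_norm

theorem measurableSet_annulus (N : ℕ) (a b : ℝ) : MeasurableSet (annulus N a b) :=
  (isOpen_annulus N a b).measurableSet

theorem annulus_subset_ball (N : ℕ) (a b : ℝ) : annulus N a b ⊆ Metric.ball 0 b := by
  intro x hx
  simpa using hx.2

theorem volume_annulus_lt_top (N : ℕ) (a b : ℝ) : volume (annulus N a b) < ⊤ :=
  (measure_mono (annulus_subset_ball N a b)).trans_lt measure_ball_lt_top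

instance isFiniteMeasure_restrict_annulus (N : ℕ) (a b : ℝ) :
    IsFiniteMeasure (volume.restrict (annulus N a b)) :=
  ⟨by simpa using volume_annulus_lt_top N a b⟩

/-- Allows the ball to be treated as the annulus with inner radius `0` in every statement that only
sees null sets. The assumption `1 ≤ N` makes the origin a null set. -/
theorem ball_ae_eq_annulus {N : ℕ} (hN : 1 ≤ N) (R : ℝ) :
    (Metric.ball (0 : EuclideanSpace ℝ (Fin N)) R) =ᵐ[volume] annulus N 0 R := by
  have := nontrivial_euclideanSpace hN
  have h : annulus N 0 R = Metric.ball (0 : EuclideanSpace ℝ (Fin N)) R \ {0} := by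
    ext x
    simp [annulus, and_comm]
  rw [h]
  exact (sdiff_null_ae_eq_self (measure_singleton _)).symm

theorem indicator_annulus (N : ℕ) (a b : ℝ) (f : ℝ → ℝ) :
    (annulus N a b).indicator (fun x => f ‖x‖) = fun x => (Ioo a b).indicator f ‖x‖ := by
  ext x
  by_cases hx : x ∈ annulus N a b
  · rw [indicator_of_mem hx, indicator_of_mem (show ‖x‖ ∈ Ioo a b from hx)]
  · rw [indicator_of_notMem hx, indicator_of_notMem (show ‖x‖ ∉ Ioo a b from hx)]

theorem integral_annulus_radial {N : ℕ} (hN : 1 ≤ N) {a b : ℝ} (ha : 0 ≤ a) (f : ℝ → ℝ) :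
    ∫ x in annulus N a b, f ‖x‖ = sphereArea N * ∫ r in Ioo a b, r ^ (N - 1) * f r := by
  have := nontrivial_euclideanSpace hN
  rw [← integral_indicator (measurableSet_annulus N a b), indicator_annulus,
    integral_fun_norm_addHaar volume ((Ioo a b).indicator f)]
  simp only [finrank_euclideanSpace, Fintype.card_fin, smul_eq_mul, nsmul_eq_mul]
  rw [sphereArea, mul_assoc]
  congr 2
  rw [← integral_indicator measurableSet_Ioo, ← integral_indicator measurableSet_Ioi]
  congr 1
  ext r
  by_cases hr : r ∈ Ioo a b
  · rw [indicator_of_mem hr, indicator_of_mem (show r ∈ Ioi (0 : ℝ) from ha.trans_lt hr.1),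
      indicator_of_mem hr]
  · rw [indicator_of_notMem hr]
    by_cases h0 : r ∈ Ioi (0 : ℝ)
    · rw [indicator_of_mem h0, indicator_of_notMem hr, mul_zero]
    · rw [indicator_of_notMem h0]

theorem integrableOn_annulus_radial {N : ℕ} (hN : 1 ≤ N) {a b : ℝ} (ha : 0 ≤ a) (f : ℝ → ℝ) :
    IntegrableOn (fun x => f ‖x‖) (annulus N a b) ↔
      IntegrableOn (fun r => r ^ (N - 1) * f r) (Ioo a b) := by
  have := nontrivial_euclideanSpace hN
  rw [← integrable_indicator_iff (measurableSet_annulus N a b), indicator_annulus,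
    integrable_fun_norm_addHaar volume (f := (Ioo a b).indicator f)]
  simp only [finrank_euclideanSpace, Fintype.card_fin, smul_eq_mul]
  rw [← integrable_indicator_iff measurableSet_Ioo, ← integrable_indicator_iff measurableSet_Ioi]
  apply iff_of_eq
  congr 1
  ext r
  by_cases hr : r ∈ Ioo a b
  · rw [indicator_of_mem hr, indicator_of_mem (show r ∈ Ioi (0 : ℝ) from ha.trans_lt hr.1),
      indicator_of_mem hr]
  · rw [indicator_of_notMem hr]
    by_cases h0 : r ∈ Ioi (0 : ℝ)
    · rw [indicator_of_mem h0, indicator_of_notMem hr, mul_zero]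
    · rw [indicator_of_notMem h0]

/-- In polar coordinates the indicator of a measurable null hull `T` of the exceptional radii
integrates to zero. -/
theorem ae_annulus_of_ae {N : ℕ} (hN : 1 ≤ N) {a b : ℝ} (ha : 0 ≤ a) {p : ℝ → Prop}
    (h : ∀ᵐ r, r ∈ Ioo a b → p r) : ∀ᵐ x ∂(volume.restrict (annulus N a b)), p ‖x‖ := by
  set S : Set ℝ := {r | ¬ (r ∈ Ioo a b → p r)} with hS
  have hS0 : volume S = 0 := h
  set T := toMeasurable volume S with hT
  have hT0 : volume T = 0 := by rw [hT, measure_toMeasurable, hS0]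
  have hTm : MeasurableSet T := measurableSet_toMeasurable _ _
  set f : ℝ → ℝ := T.indicator (fun _ => 1) with hf
  have hf0 : ∀ r, 0 ≤ f r := fun r => indicator_nonneg (fun _ _ => zero_le_one) r
  have hae : (fun r => r ^ (N - 1) * f r) =ᵐ[volume.restrict (Ioo a b)] 0 := by
    apply ae_restrict_of_ae
    have : ∀ᵐ r, r ∉ T := by simpa [ae_iff] using hT0
    filter_upwards [this] with r hr
    simp [hf, hr]
  have hint : IntegrableOn (fun x => f ‖x‖) (annulus N a b) := by
    rw [integrableOn_annulus_radial hN ha]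
    exact (integrable_zero _ _ _).congr hae.symm
  have hz : ∫ x in annulus N a b, f ‖x‖ = 0 := by
    rw [integral_annulus_radial hN ha, integral_congr_ae hae]
    simp
  rw [integral_eq_zero_iff_of_nonneg (fun x => hf0 _) hint] at hz
  filter_upwards [hz, ae_restrict_mem (measurableSet_annulus N a b)] with x hx hxA
  by_contra hp
  have : ‖x‖ ∈ T := subset_toMeasurable _ _ (show ‖x‖ ∈ S from fun h' => hp (h' hxA))
  simp [hf, this] at hx

theorem aestronglyMeasurable_annulus_radial {N : ℕ} (hN : 1 ≤ N) {a b : ℝ} (ha : 0 ≤ a)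
    {f : ℝ → ℝ} (hf : AEStronglyMeasurable f (volume.restrict (Ioo a b))) :
    AEStronglyMeasurable (fun x : EuclideanSpace ℝ (Fin N) => f ‖x‖)
      (volume.restrict (annulus N a b)) := by
  obtain ⟨g, hg, hfg⟩ := hf
  refine ⟨fun x => g ‖x‖, hg.comp_measurable measurable_norm, ?_⟩
  rw [EventuallyEq, ae_restrict_iff' measurableSet_Ioo] at hfg
  exact ae_annulus_of_ae hN ha (p := fun r => f r = g r) hfg

/-- The σ-algebra of radial sets. -/
noncomputable abbrev radialSigma (N : ℕ) : MeasurableSpace (EuclideanSpace ℝ (Fin N)) :=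
  MeasurableSpace.comap norm inferInstance

/-- The spherical mean of an integrable function, in terms of a conditional expectation. -/
theorem exists_radial_average {N : ℕ} {a b : ℝ} {g : EuclideanSpace ℝ (Fin N) → ℝ}
    (hg : IntegrableOn g (annulus N a b)) :
    ∃ G : ℝ → ℝ, IntegrableOn (fun x => G ‖x‖) (annulus N a b) ∧
      ∀ η : ℝ → ℝ, Measurable η → (∃ C, ∀ r ∈ Ioo a b, |η r| ≤ C) →
        ∫ x in annulus N a b, g x * η ‖x‖ = ∫ x in annulus N a b, G ‖x‖ * η ‖x‖ := by
  set μ := (volume : Measure (EuclideanSpace ℝ (Fin N))).restrict (annulus N a b) with hμ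
  have hle := (measurable_norm (α := EuclideanSpace ℝ (Fin N))).comap_le
  -- The conditional expectation given the radial sets is measurable for a σ-algebra pulled back by
  -- the norm, hence factors through the norm. The test function `η ‖x‖` is then pulled out of it.
  obtain ⟨G, hGm, hG⟩ := (stronglyMeasurable_condExp (f := g) (m := radialSigma N) (μ := μ)).exists_eq_measurable_comp
  have hGi : Integrable (fun x => G ‖x‖) μ := by
    have := integrable_condExp (f := g) (m := radialSigma N) (μ := μ)
    rwa [hG] at this
  refine ⟨G, hGi, fun η hη ⟨C, hC⟩ => ?_⟩
  have hηm : StronglyMeasurable[radialSigma N] (fun x : EuclideanSpace ℝ (Fin N) => η ‖x‖) :=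
    (hη.stronglyMeasurable).comp_measurable (comap_measurable _)
  have h1 := condExp_stronglyMeasurable_mul_of_bound hle hηm (μ := μ) hg C (by
    filter_upwards [ae_restrict_mem (measurableSet_annulus N a b)] with x hx
    exact hC _ hx)
  have h2 := integral_condExp (μ := μ) hle
    (f := (fun x : EuclideanSpace ℝ (Fin N) => η ‖x‖) * g)
  rw [integral_congr_ae h1, hG] at h2
  simp only [Pi.mul_apply, Function.comp] at h2
  simp_rw [mul_comm (g _), mul_comm (G _)]
  exact h2.symm

/-! ### Locally absolutely continuous functions on an open interval. -/

theorem AbsolutelyContinuousOnInterval.congr_on {f g : ℝ → ℝ} {a b : ℝ}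
    (hf : AbsolutelyContinuousOnInterval f a b) (h : EqOn f g (uIcc a b)) :
    AbsolutelyContinuousOnInterval g a b := by
  rw [absolutelyContinuousOnInterval_iff] at hf ⊢
  intro ε hε
  obtain ⟨δ, hδ, H⟩ := hf ε hε
  refine ⟨δ, hδ, fun E hE hlt => ?_⟩
  have := H E hE hlt
  refine lt_of_eq_of_lt (Finset.sum_congr rfl fun i hi => ?_) this
  rw [h (hE.1 i hi).1, h (hE.1 i hi).2]

theorem AbsolutelyContinuousOnInterval.abs_fun {f : ℝ → ℝ} {a b : ℝ}
    (hf : AbsolutelyContinuousOnInterval f a b) :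
    AbsolutelyContinuousOnInterval (fun r => |f r|) a b := by
  rw [absolutelyContinuousOnInterval_iff] at hf ⊢
  intro ε hε
  obtain ⟨δ, hδ, H⟩ := hf ε hε
  refine ⟨δ, hδ, fun E hE hlt => lt_of_le_of_lt (Finset.sum_le_sum fun i _ => ?_) (H E hE hlt)⟩
  rw [Real.dist_eq, Real.dist_eq]
  exact abs_abs_sub_abs_le_abs_sub _ _

/-- `A` is locally absolutely continuous on `(a,b)`, with derivative `q` almost everywhere. -/
def LocAC (A q : ℝ → ℝ) (a b : ℝ) : Prop :=
  (∀ x ∈ Ioo a b, ∀ y ∈ Ioo a b, AbsolutelyContinuousOnInterval A x y) ∧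
    ∀ᵐ r, r ∈ Ioo a b → HasDerivAt A (q r) r

theorem uIcc_subset_Ioo {a b x y : ℝ} (hx : x ∈ Ioo a b) (hy : y ∈ Ioo a b) :
    uIcc x y ⊆ Ioo a b :=
  ordConnected_Ioo.uIcc_subset hx hy

namespace LocAC

variable {A B p q : ℝ → ℝ} {a b : ℝ}

theorem ae_deriv_eq (h : LocAC A q a b) {x y : ℝ} (hx : x ∈ Ioo a b) (hy : y ∈ Ioo a b) :
    ∀ᵐ r, r ∈ uIcc x y → deriv A r = q r := by
  filter_upwards [h.2] with r hr hxy
  exact (hr (uIcc_subset_Ioo hx hy hxy)).deriv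

theorem ae_deriv_eq' (h : LocAC A q a b) {x y : ℝ} (hx : x ∈ Ioo a b) (hy : y ∈ Ioo a b) :
    ∀ᵐ r, r ∈ uIoc x y → deriv A r = q r := by
  filter_upwards [h.ae_deriv_eq hx hy] with r hr hxy
  exact hr (uIoc_subset_uIcc hxy)

theorem intervalIntegrable (h : LocAC A q a b) {x y : ℝ} (hx : x ∈ Ioo a b) (hy : y ∈ Ioo a b) :
    IntervalIntegrable q volume x y :=
  (h.1 x hx y hy).intervalIntegrable_deriv.congr_ae
    ((ae_restrict_iff' measurableSet_uIoc).2 (h.ae_deriv_eq' hx hy))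

theorem integral_eq (h : LocAC A q a b) {x y : ℝ} (hx : x ∈ Ioo a b) (hy : y ∈ Ioo a b) :
    ∫ t in x..y, q t = A y - A x := by
  rw [← (h.1 x hx y hy).integral_deriv_eq_sub]
  refine intervalIntegral.integral_congr_ae ?_
  filter_upwards [h.ae_deriv_eq' hx hy] with r hr hxy
  exact (hr hxy).symm

theorem continuousOn (h : LocAC A q a b) : ContinuousOn A (Ioo a b) := by
  intro r hr
  obtain ⟨x, hx⟩ := exists_between hr.1
  obtain ⟨y, hy⟩ := exists_between hr.2
  have hx' : x ∈ Ioo a b := ⟨hx.1, hx.2.trans hr.2⟩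
  have hy' : y ∈ Ioo a b := ⟨hr.1.trans hy.1, hy.2⟩
  have := (h.1 x hx' y hy').continuousOn
  rw [uIcc_of_le (hx.2.trans hy.1).le] at this
  exact (this.continuousAt (Icc_mem_nhds hx.2 hy.1)).continuousWithinAt

theorem locallyIntegrableOn (h : LocAC A q a b) : LocallyIntegrableOn q (Ioo a b) := by
  intro r hr
  obtain ⟨x, hx⟩ := exists_between hr.1
  obtain ⟨y, hy⟩ := exists_between hr.2
  have hx' : x ∈ Ioo a b := ⟨hx.1, hx.2.trans hr.2⟩
  have hy' : y ∈ Ioo a b := ⟨hr.1.trans hy.1, hy.2⟩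
  refine ⟨Ioc x y, mem_nhdsWithin_of_mem_nhds (Ioc_mem_nhds hx.2 hy.1), ?_⟩
  exact (h.intervalIntegrable hx' hy').1

theorem mono {a' b' : ℝ} (h : LocAC A q a b) (hs : Ioo a' b' ⊆ Ioo a b) : LocAC A q a' b' := by
  refine ⟨fun x hx y hy => h.1 x (hs hx) y (hs hy), ?_⟩
  filter_upwards [h.2] with r hr hm using hr (hs hm)

theorem congr_deriv (h : LocAC A q a b) (hq : ∀ᵐ r, r ∈ Ioo a b → q r = p r) : LocAC A p a b := by
  refine ⟨h.1, ?_⟩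
  filter_upwards [h.2, hq] with r hr hq hm
  rw [← hq hm]
  exact hr hm

theorem congr_fun (h : LocAC A q a b) (hAB : EqOn A B (Ioo a b)) : LocAC B q a b := by
  refine ⟨fun x hx y hy => (h.1 x hx y hy).congr_on (hAB.mono (uIcc_subset_Ioo hx hy)), ?_⟩
  filter_upwards [h.2] with r hr hm
  exact (hr hm).congr_of_eventuallyEq
    ((hAB.eventuallyEq_of_mem (isOpen_Ioo.mem_nhds hm)).symm)

/-- Differentiability almost everywhere is known on compact subintervals; the exceptional set is
locally null, hence null. -/
theorem of_absolutelyContinuous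
    (h : ∀ x ∈ Ioo a b, ∀ y ∈ Ioo a b, AbsolutelyContinuousOnInterval A x y) :
    LocAC A (deriv A) a b := by
  refine ⟨h, ?_⟩
  have key : ∀ x ∈ Ioo a b, ∃ s ∈ 𝓝[Ioo a b] x, ∀ᵐ r, r ∈ s → DifferentiableAt ℝ A r := by
    intro r hr
    obtain ⟨x, hx⟩ := exists_between hr.1
    obtain ⟨y, hy⟩ := exists_between hr.2
    have hx' : x ∈ Ioo a b := ⟨hx.1, hx.2.trans hr.2⟩
    have hy' : y ∈ Ioo a b := ⟨hr.1.trans hy.1, hy.2⟩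
    refine ⟨uIcc x y, mem_nhdsWithin_of_mem_nhds ?_, (h x hx' y hy').ae_differentiableAt⟩
    rw [uIcc_of_le (hx.2.trans hy.1).le]
    exact Icc_mem_nhds hx.2 hy.1
  have h0 : volume ({r | ¬ DifferentiableAt ℝ A r} ∩ Ioo a b) = 0 := by
    refine measure_null_of_locally_null _ fun x hx => ?_
    obtain ⟨s, hs, hs'⟩ := key x hx.2
    refine ⟨s ∩ {r | ¬ DifferentiableAt ℝ A r}, ?_, ?_⟩
    · refine inter_mem (nhdsWithin_mono _ inter_subset_right hs) ?_
      exact mem_of_superset self_mem_nhdsWithin inter_subset_left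
    · refine measure_mono_null (fun r hr => ?_) hs'
      simp only [mem_compl_iff, mem_ofPred_eq, not_forall]
      exact ⟨hr.1, hr.2⟩
  rw [ae_iff]
  refine measure_mono_null (fun r hr => ?_) h0
  simp only [mem_ofPred_eq, not_forall] at hr
  exact ⟨fun hd => hr.2 hd.hasDerivAt, hr.1⟩

theorem of_intervalIntegral (hq : LocallyIntegrableOn q (Ioo a b)) {c r₁ : ℝ} (hr₁ : r₁ ∈ Ioo a b) :
    LocAC (fun r => c + ∫ t in r₁..r, q t) q a b := by
  have hii : ∀ x ∈ Ioo a b, ∀ y ∈ Ioo a b, IntervalIntegrable q volume x y := fun x hx y hy =>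
    ((hq.integrableOn_compact_subset (uIcc_subset_Ioo hx hy) isCompact_uIcc)).intervalIntegrable
  have hac : ∀ x ∈ Ioo a b, ∀ y ∈ Ioo a b,
      AbsolutelyContinuousOnInterval (fun r => c + ∫ t in r₁..r, q t) x y := by
    intro x hx y hy
    have h1 := (hii x hx y hy).absolutelyContinuousOnInterval_intervalIntegral left_mem_uIcc
    have h2 : AbsolutelyContinuousOnInterval (fun _ : ℝ => c + ∫ t in r₁..x, q t) x y :=
      (LipschitzWith.const _ : LipschitzWith 0 _).lipschitzOnWith.absolutelyContinuousOnInterval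
    refine (h2.add h1).congr_on fun r hr => ?_
    have hr' := uIcc_subset_Ioo hx hy hr
    simp only [Pi.add_apply]
    rw [add_assoc, intervalIntegral.integral_add_adjacent_intervals (hii _ hr₁ _ hx) (hii _ hx _ hr')]
  have h := of_absolutelyContinuous hac
  refine h.congr_deriv ?_
  have hloc : ∀ x ∈ Ioo a b, ∃ s ∈ 𝓝[Ioo a b] x, ∀ᵐ r, r ∈ s →
      deriv (fun r => c + ∫ t in r₁..r, q t) r = q r := by
    intro r hr
    -- Lebesgue's differentiation theorem is applied on a compact interval that contains both `r`
    -- and the base point `r₁` of the primitive.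
    obtain ⟨x, hx⟩ := exists_between (lt_min hr.1 hr₁.1)
    obtain ⟨y, hy⟩ := exists_between (max_lt hr.2 hr₁.2)
    have hx' : x ∈ Ioo a b := ⟨hx.1, (hx.2.trans_le (min_le_left _ _)).trans hr.2⟩
    have hy' : y ∈ Ioo a b := ⟨hr.1.trans ((le_max_left _ _).trans_lt hy.1), hy.2⟩
    have h1 := hx.2.trans_le (min_le_left _ _)
    have h2 := hx.2.trans_le (min_le_right _ _)
    have h3 := (le_max_left _ _).trans_lt hy.1
    have h4 := (le_max_right _ _).trans_lt hy.1
    refine ⟨uIcc x y, mem_nhdsWithin_of_mem_nhds ?_, ?_⟩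
    · rw [uIcc_of_le (h1.trans h3).le]
      exact Icc_mem_nhds h1 h3
    · filter_upwards [(hii x hx' y hy').ae_hasDerivAt_integral] with s hs hsm
      refine ((hs hsm r₁ ?_).const_add c).deriv
      rw [uIcc_of_le (h1.trans h3).le]
      exact ⟨h2.le, h4.le⟩
  have h0 : volume ({r | deriv (fun r => c + ∫ t in r₁..r, q t) r ≠ q r} ∩ Ioo a b) = 0 := by
    refine measure_null_of_locally_null _ fun x hx => ?_
    obtain ⟨s, hs, hs'⟩ := hloc x hx.2
    refine ⟨s ∩ {r | deriv (fun r => c + ∫ t in r₁..r, q t) r ≠ q r}, ?_, ?_⟩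
    · refine inter_mem (nhdsWithin_mono _ inter_subset_right hs) ?_
      exact mem_of_superset self_mem_nhdsWithin inter_subset_left
    · refine measure_mono_null (fun r hr => ?_) hs'
      simp only [mem_compl_iff, mem_ofPred_eq, not_forall]
      exact ⟨hr.1, hr.2⟩
  rw [ae_iff]
  refine measure_mono_null (fun r hr => ?_) h0
  simp only [mem_ofPred_eq, not_forall] at hr
  exact ⟨hr.2, hr.1⟩

theorem of_hasDerivAt (h : ∀ r ∈ Ioo a b, HasDerivAt A (q r) r) (hq : ContinuousOn q (Ioo a b)) :
    LocAC A q a b := by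
  refine ⟨fun x hx y hy => ?_, Eventually.of_forall h⟩
  have hs := uIcc_subset_Ioo hx hy
  have hcd : ContDiffOn ℝ 1 A (Ioo a b) := by
    have : ContDiffOn ℝ (0 + 1) A (Ioo a b) := by
      rw [contDiffOn_succ_iff_deriv_of_isOpen isOpen_Ioo]
      refine ⟨fun r hr => (h r hr).differentiableAt.differentiableWithinAt, by simp, ?_⟩
      exact contDiffOn_zero.2 (hq.congr fun r hr => (h r hr).deriv)
    simpa using this
  exact (hcd.mono hs).absolutelyContinuousOnInterval

/-- If the almost everywhere derivative has a continuous representative, the fundamental theorem of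
calculus makes it the derivative everywhere. This is the source of the `C¹` regularity of profiles.
-/
theorem hasDerivAt (h : LocAC A q a b) (hq : ContinuousOn q (Ioo a b)) {r : ℝ}
    (hr : r ∈ Ioo a b) : HasDerivAt A (q r) r := by
  have h1 : HasDerivAt (fun s => A r + ∫ t in r..s, q t) (q r) r := by
    refine HasDerivAt.const_add _ (intervalIntegral.integral_hasDerivAt_right ?_ ?_ ?_)
    · exact h.intervalIntegrable hr hr
    · exact hq.stronglyMeasurableAtFilter isOpen_Ioo r hr
    · exact hq.continuousAt (isOpen_Ioo.mem_nhds hr)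
  refine h1.congr_of_eventuallyEq ?_
  filter_upwards [isOpen_Ioo.mem_nhds hr] with s hs
  rw [h.integral_eq hr hs]
  ring

theorem add (hA : LocAC A p a b) (hB : LocAC B q a b) :
    LocAC (fun r => A r + B r) (fun r => p r + q r) a b := by
  refine ⟨fun x hx y hy => (hA.1 x hx y hy).add (hB.1 x hx y hy), ?_⟩
  filter_upwards [hA.2, hB.2] with r h1 h2 hm using (h1 hm).add (h2 hm)

theorem const_mul (c : ℝ) (hA : LocAC A p a b) :
    LocAC (fun r => c * A r) (fun r => c * p r) a b := by
  refine ⟨fun x hx y hy => (hA.1 x hx y hy).const_mul c, ?_⟩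
  filter_upwards [hA.2] with r h1 hm using (h1 hm).const_mul c

theorem mul (hA : LocAC A p a b) (hB : LocAC B q a b) :
    LocAC (fun r => A r * B r) (fun r => p r * B r + A r * q r) a b := by
  refine ⟨fun x hx y hy => (hA.1 x hx y hy).fun_mul (hB.1 x hx y hy), ?_⟩
  filter_upwards [hA.2, hB.2] with r h1 h2 hm using (h1 hm).mul (h2 hm)

theorem abs (hA : LocAC A p a b) :
    LocAC (fun r => |A r|) (deriv fun r => |A r|) a b :=
  of_absolutelyContinuous fun x hx y hy => (hA.1 x hx y hy).abs_fun

end LocAC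

/-! ### The lemma of du Bois-Reymond. -/

theorem exists_Icc_of_tsupport_subset {a b : ℝ} (hab : a < b) {η : ℝ → ℝ}
    (hc : HasCompactSupport η) (hs : tsupport η ⊆ Ioo a b) :
    ∃ x ∈ Ioo a b, ∃ y ∈ Ioo a b, x < y ∧ tsupport η ⊆ Ioo x y := by
  obtain ⟨c, hc1⟩ := exists_between hab
  obtain ⟨x, hx, hxy⟩ : ∃ x, x ∈ Ioo a c ∧ ∀ t ∈ tsupport η, x < t := by
    rcases (tsupport η).eq_empty_or_nonempty with h0 | h0
    · obtain ⟨x, hx⟩ := exists_between hc1.1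
      exact ⟨x, hx, by simp [h0]⟩
    · obtain ⟨m, hm, hmin⟩ := hc.isCompact.exists_isLeast h0
      obtain ⟨x, hx⟩ := exists_between (lt_min (hs hm).1 hc1.1)
      exact ⟨x, ⟨hx.1, hx.2.trans_le (min_le_right _ _)⟩,
        fun t ht => (hx.2.trans_le (min_le_left _ _)).trans_le (hmin ht)⟩
  obtain ⟨y, hy, hyx⟩ : ∃ y, y ∈ Ioo c b ∧ ∀ t ∈ tsupport η, t < y := by
    rcases (tsupport η).eq_empty_or_nonempty with h0 | h0
    · obtain ⟨x, hx⟩ := exists_between hc1.2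
      exact ⟨x, hx, by simp [h0]⟩
    · obtain ⟨m, hm, hmax⟩ := hc.isCompact.exists_isGreatest h0
      obtain ⟨y, hy⟩ := exists_between (max_lt (hs hm).2 hc1.2)
      exact ⟨y, ⟨(le_max_right _ _).trans_lt hy.1, hy.2⟩,
        fun t ht => (hmax ht).trans_lt ((le_max_left _ _).trans_lt hy.1)⟩
  exact ⟨x, ⟨hx.1, hx.2.trans hc1.2⟩, y, ⟨hc1.1.trans hy.1, hy.2⟩, hx.2.trans hy.1,
    fun t ht => ⟨hxy t ht, hyx t ht⟩⟩

theorem hasDerivAt_primitive {θ : ℝ → ℝ} (hθ : Continuous θ) (c r : ℝ) :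
    HasDerivAt (fun r => ∫ t in c..r, θ t) (θ r) r :=
  intervalIntegral.integral_hasDerivAt_right (hθ.intervalIntegrable _ _)
    hθ.stronglyMeasurable.stronglyMeasurableAtFilter hθ.continuousAt

theorem contDiff_primitive {θ : ℝ → ℝ} (hθ : ContDiff ℝ ∞ θ) (c : ℝ) :
    ContDiff ℝ ∞ (fun r => ∫ t in c..r, θ t) := by
  rw [contDiff_infty_iff_deriv]
  refine ⟨fun r => (hasDerivAt_primitive hθ.continuous c r).differentiableAt, ?_⟩
  rwa [show deriv (fun r => ∫ t in c..r, θ t) = θ from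
    funext fun r => (hasDerivAt_primitive hθ.continuous c r).deriv]

theorem integral_Ioo_eq_interval {a b x y : ℝ} (hx : x ∈ Ioo a b) (hy : y ∈ Ioo a b) (hxy : x ≤ y)
    {f : ℝ → ℝ} (h : ∀ r ∉ Ioo x y, f r = 0) : ∫ r in Ioo a b, f r = ∫ r in x..y, f r := by
  rw [intervalIntegral.integral_of_le hxy, integral_Ioc_eq_integral_Ioo]
  refine setIntegral_eq_of_subset_of_forall_sdiff_eq_zero measurableSet_Ioo
    (Ioo_subset_Ioo hx.1.le hy.2.le) fun r hr => h r hr.2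

/-- Du Bois-Reymond: a function with a locally integrable weak derivative is locally absolutely
continuous. -/
theorem exists_locAC_of_weak_deriv {a b : ℝ} (hab : a < b) {g h : ℝ → ℝ}
    (hg : LocallyIntegrableOn g (Ioo a b)) (hh : LocallyIntegrableOn h (Ioo a b))
    (H : ∀ η : ℝ → ℝ, ContDiff ℝ ∞ η → HasCompactSupport η → tsupport η ⊆ Ioo a b →
      ∫ r in Ioo a b, g r * deriv η r = -∫ r in Ioo a b, h r * η r) :
    ∃ A, LocAC A h a b ∧ ∀ᵐ r, r ∈ Ioo a b → g r = A r := by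
  obtain ⟨c, hc⟩ := exists_between hab
  have hI := LocAC.of_intervalIntegral hh (c := 0) hc
  set I : ℝ → ℝ := fun r => 0 + ∫ t in c..r, h t with hIdef
  have hIcont := hI.continuousOn
  have hIloc : LocallyIntegrableOn I (Ioo a b) :=
    hIcont.locallyIntegrableOn measurableSet_Ioo
  have zero_off : ∀ {η : ℝ → ℝ} {s : Set ℝ}, tsupport η ⊆ s → ∀ r ∉ s, η r = 0 :=
    fun hs r hr => image_eq_zero_of_notMem_tsupport fun h' => hr (hs h')
  have dzero_off : ∀ {η : ℝ → ℝ} {s : Set ℝ}, tsupport η ⊆ s → ∀ r ∉ s, deriv η r = 0 :=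
    fun hs r hr => image_eq_zero_of_notMem_tsupport fun h' =>
      hr (hs (closure_minimal (support_deriv_subset) (isClosed_tsupport _) h'))
  have hIη : ∀ η : ℝ → ℝ, ContDiff ℝ ∞ η → HasCompactSupport η → tsupport η ⊆ Ioo a b →
      ∫ r in Ioo a b, I r * deriv η r = -∫ r in Ioo a b, h r * η r := by
    intro η h1 h2 h3
    obtain ⟨x, hx, y, hy, hxy, hs⟩ := exists_Icc_of_tsupport_subset hab h2 h3
    rw [integral_Ioo_eq_interval hx hy hxy.le fun r hr => by rw [dzero_off hs r hr, mul_zero],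
      integral_Ioo_eq_interval hx hy hxy.le fun r hr => by rw [zero_off hs r hr, mul_zero]]
    have hη : AbsolutelyContinuousOnInterval η x y :=
      (h1.of_le (by simp)).contDiffOn.absolutelyContinuousOnInterval
    rw [(hI.1 x hx y hy).integral_mul_deriv_eq_deriv_mul hη, zero_off hs x (by simp),
      zero_off hs y (by simp)]
    simp only [mul_zero, sub_zero, zero_sub]
    congr 1
    refine intervalIntegral.integral_congr_ae ?_
    filter_upwards [hI.ae_deriv_eq' hx hy] with r hr hm
    rw [hr hm]
  have test_int : ∀ {f η : ℝ → ℝ}, LocallyIntegrableOn f (Ioo a b) → Continuous η →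
      HasCompactSupport η → tsupport η ⊆ Ioo a b → IntegrableOn (fun r => f r * η r) (Ioo a b) := by
    intro f η hf h1 h2 h3
    obtain ⟨x, hx, y, hy, hxy, hs⟩ := exists_Icc_of_tsupport_subset hab h2 h3
    have h4 : IntegrableOn (fun r => f r * η r) (Icc x y) := by
      refine IntegrableOn.mul_continuousOn ?_ h1.continuousOn isCompact_Icc
      exact hf.integrableOn_compact_subset (Icc_subset_Ioo hx.1 hy.2) isCompact_Icc
    refine (h4.of_forall_sdiff_eq_zero measurableSet_Ioo fun r hr => ?_)
    rw [zero_off (hs.trans Ioo_subset_Icc_self) r hr.2, mul_zero]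
  set G : ℝ → ℝ := fun r => g r - I r with hGdef
  have hG : LocallyIntegrableOn G (Ioo a b) := hg.sub hIloc
  have hG0 : ∀ η : ℝ → ℝ, ContDiff ℝ ∞ η → HasCompactSupport η → tsupport η ⊆ Ioo a b →
      ∫ r in Ioo a b, G r * deriv η r = 0 := by
    intro η h1 h2 h3
    have h1' : Continuous (deriv η) := h1.continuous_deriv (by simp)
    have h2' : HasCompactSupport (deriv η) := h2.deriv
    have h3' : tsupport (deriv η) ⊆ Ioo a b :=
      (closure_minimal (support_deriv_subset) (isClosed_tsupport _)).trans h3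
    simp only [hGdef, sub_mul]
    rw [integral_sub (test_int hg h1' h2' h3') (test_int hIloc h1' h2' h3'), H η h1 h2 h3,
      hIη η h1 h2 h3, sub_self]
  obtain ⟨χ, hχs, hχc, hχ, hχr, hχ1⟩ := exists_contDiff_tsupport_subset (n := ⊤)
    (isOpen_Ioo.mem_nhds hc)
  have hχpos : 0 < ∫ r in Ioo a b, χ r := by
    rw [setIntegral_eq_integral_of_forall_compl_eq_zero fun r hr => zero_off hχs r hr]
    refine hχ.continuous.integral_pos_of_hasCompactSupport_nonneg_nonzero hχc
      (fun r => (hχr (mem_range_self r)).1) (x := c) (by rw [hχ1]; exact one_ne_zero)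
  set m := ∫ r in Ioo a b, χ r with hm
  -- The constant to which `G = g - I` must be equal, namely its mean against the fixed bump `χ`.
  set K := (∫ r in Ioo a b, G r * χ r) / m with hK
  have hfin : ∀ᵐ r, r ∈ Ioo a b → G r - K = 0 := by
    refine IsOpen.ae_eq_zero_of_integral_contDiff_smul_eq_zero isOpen_Ioo
      (hG.sub (continuous_const.locallyIntegrable.locallyIntegrableOn _)) fun ψ h1 h2 h3 => ?_
    set k := (∫ r in Ioo a b, ψ r) / m with hk
    -- Subtracting this multiple of the bump makes the integral of `θ` zero, so that `θ` is the
    -- derivative of a test function `η` and `hG0` applies.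
    set θ : ℝ → ℝ := fun r => ψ r - k * χ r with hθ
    have hθs : ContDiff ℝ ∞ θ := h1.sub (contDiff_const.mul hχ)
    have hθsupp : tsupport θ ⊆ tsupport ψ ∪ tsupport χ := by
      refine closure_minimal (fun r hr => ?_) ((isClosed_tsupport _).union (isClosed_tsupport _))
      by_contra hcon
      rw [mem_union, not_or] at hcon
      apply hr
      simp [hθ, image_eq_zero_of_notMem_tsupport hcon.1, image_eq_zero_of_notMem_tsupport hcon.2]
    have hθc : HasCompactSupport θ :=
      HasCompactSupport.of_support_subset_isCompact (h2.isCompact.union hχc.isCompact)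
        ((subset_tsupport _).trans hθsupp)
    have hθI : tsupport θ ⊆ Ioo a b := hθsupp.trans (union_subset h3 hχs)
    obtain ⟨x, hx, y, hy, hxy, hs⟩ := exists_Icc_of_tsupport_subset hab hθc hθI
    have iψ : IntegrableOn ψ (Ioo a b) := (h1.continuous.integrable_of_hasCompactSupport h2).integrableOn
    have iχ : IntegrableOn χ (Ioo a b) := (hχ.continuous.integrable_of_hasCompactSupport hχc).integrableOn
    have hθ0 : ∫ r in x..y, θ r = 0 := by
      rw [← integral_Ioo_eq_interval hx hy hxy.le (zero_off hs)]
      simp only [hθ]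
      rw [integral_sub iψ (iχ.const_mul k), integral_const_mul, hk, ← hm]
      field_simp
      ring
    set η : ℝ → ℝ := fun r => ∫ t in x..r, θ t with hη
    have hηd : deriv η = θ := funext fun r => (hasDerivAt_primitive hθs.continuous x r).deriv
    have hη0 : ∀ r ∉ Icc x y, η r = 0 := by
      intro r hr
      rw [mem_Icc, not_and_or, not_le, not_le] at hr
      have hz : ∀ u v : ℝ, (∀ t ∈ uIcc u v, t ∉ Ioo x y) → ∫ t in u..v, θ t = 0 := by
        intro u v huv
        rw [intervalIntegral.integral_congr (g := fun _ => 0)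
          (fun t ht => zero_off hs t (huv t ht))]
        simp
      rcases hr with hr | hr
      · refine hz _ _ fun t ht ht' => ?_
        rw [uIcc_of_ge hr.le] at ht
        exact absurd ht'.1 (not_lt.2 ht.2)
      · simp only [hη]
        rw [← intervalIntegral.integral_add_adjacent_intervals
          (hθs.continuous.intervalIntegrable x y) (hθs.continuous.intervalIntegrable y r), hθ0,
          zero_add]
        refine hz _ _ fun t ht ht' => ?_
        rw [uIcc_of_le hr.le] at ht
        exact absurd ht'.2 (not_lt.2 ht.1)
    have hηsupp : tsupport η ⊆ Icc x y := by
      refine closure_minimal (fun r hr => ?_) isClosed_Icc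
      by_contra hcon
      exact hr (hη0 r hcon)
    have h5 := hG0 η (contDiff_primitive hθs x)
      (HasCompactSupport.of_support_subset_isCompact isCompact_Icc
        ((subset_tsupport _).trans hηsupp)) (hηsupp.trans (Icc_subset_Ioo hx.1 hy.2))
    rw [hηd] at h5
    have iGψ := test_int hG h1.continuous h2 h3
    have iGχ := test_int hG hχ.continuous hχc hχs
    have h6 : ∫ r in Ioo a b, G r * ψ r = k * ∫ r in Ioo a b, G r * χ r := by
      rw [← sub_eq_zero, ← integral_const_mul, ← integral_sub iGψ (iGχ.const_mul k), ← h5]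
      congr 1
      ext r
      simp only [hθ]
      ring
    rw [← setIntegral_eq_integral_of_forall_compl_eq_zero (s := Ioo a b)
      (fun r hr => by rw [zero_off h3 r hr, zero_smul])]
    have : ∀ r, ψ r • (G r - K) = G r * ψ r - K * ψ r := fun r => by rw [smul_eq_mul]; ring
    simp only [this]
    rw [integral_sub iGψ (iψ.const_mul K), integral_const_mul, h6, hK, hk]
    field_simp
    ring
  have hfin2 := LocAC.of_intervalIntegral hh (c := K) hc
  refine ⟨_, hfin2, ?_⟩
  filter_upwards [hfin] with r hr hm
  have := hr hm
  simp only [hGdef, hIdef] at this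
  linarith

/-! ### Calculus of weak partial derivatives. -/

section WeakPartial

variable {N : ℕ} {Ω Ω' : Set (EuclideanSpace ℝ (Fin N))} {i : Fin N}
  {u v g h φ : EuclideanSpace ℝ (Fin N) → ℝ}

theorem IsTestFunction.eq_zero (hφ : IsTestFunction Ω φ) {x : EuclideanSpace ℝ (Fin N)}
    (hx : x ∉ Ω) : φ x = 0 :=
  image_eq_zero_of_notMem_tsupport fun h => hx (hφ.2.2 h)

theorem IsTestFunction.mono (hφ : IsTestFunction Ω φ) (h : Ω ⊆ Ω') : IsTestFunction Ω' φ :=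
  ⟨hφ.1, hφ.2.1, hφ.2.2.trans h⟩

theorem support_classicalPartial_subset :
    Function.support (classicalPartial i φ) ⊆ tsupport φ := by
  intro x hx
  refine support_fderiv_subset ℝ ?_
  intro h0
  exact hx (by simp [classicalPartial, h0])

theorem tsupport_classicalPartial_subset : tsupport (classicalPartial i φ) ⊆ tsupport φ :=
  closure_minimal support_classicalPartial_subset (isClosed_tsupport _)

theorem contDiff_classicalPartial (hφ : ContDiff ℝ ∞ φ) : ContDiff ℝ ∞ (classicalPartial i φ) :=
  (hφ.fderiv_right (m := ∞) (by simp)).clm_apply contDiff_const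

theorem IsTestFunction.classicalPartial (hφ : IsTestFunction Ω φ) (i : Fin N) :
    IsTestFunction Ω (classicalPartial i φ) :=
  ⟨contDiff_classicalPartial hφ.1,
    HasCompactSupport.of_support_subset_isCompact hφ.2.1 support_classicalPartial_subset,
    tsupport_classicalPartial_subset.trans hφ.2.2⟩

theorem IsTestFunction.integrable_mul (hu : LocallyIntegrableOn u Ω) (hφ : IsTestFunction Ω φ) :
    Integrable (fun x => u x * φ x) := by
  have h1 : IntegrableOn (fun x => u x * φ x) (tsupport φ) :=
    (hu.integrableOn_compact_subset hφ.2.2 hφ.2.1).mul_continuousOn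
      hφ.1.continuous.continuousOn hφ.2.1
  refine h1.integrable_of_forall_notMem_eq_zero fun x hx => ?_
  rw [image_eq_zero_of_notMem_tsupport hx, mul_zero]

theorem IsTestFunction.setIntegral_eq (hφ : IsTestFunction Ω φ)
    (u : EuclideanSpace ℝ (Fin N) → ℝ) : ∫ x in Ω, u x * φ x = ∫ x, u x * φ x :=
  setIntegral_eq_integral_of_forall_compl_eq_zero fun x hx => by rw [hφ.eq_zero hx, mul_zero]

theorem hasWeakPartial_iff : HasWeakPartial Ω i u g ↔ LocallyIntegrableOn u Ω volume ∧
    LocallyIntegrableOn g Ω volume ∧ ∀ φ, IsTestFunction Ω φ →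
      ∫ x, u x * classicalPartial i φ x = -∫ x, g x * φ x := by
  refine and_congr_right fun _ => and_congr_right fun _ => forall₂_congr fun φ hφ => ?_
  rw [hφ.setIntegral_eq, (hφ.classicalPartial i).setIntegral_eq]

theorem HasWeakPartial.unique (hΩ : IsOpen Ω) (h1 : HasWeakPartial Ω i u g)
    (h2 : HasWeakPartial Ω i u h) : g =ᵐ[volume.restrict Ω] h := by
  rw [EventuallyEq, ae_restrict_iff' hΩ.measurableSet]
  have := IsOpen.ae_eq_zero_of_integral_contDiff_smul_eq_zero hΩ (h1.2.1.sub h2.2.1)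
    (fun φ a b c => by
      have hφ : IsTestFunction Ω φ := ⟨a, b, c⟩
      rw [hasWeakPartial_iff] at h1 h2
      have e1 := h1.2.2 φ hφ
      have e2 := h2.2.2 φ hφ
      have : ∀ x, φ x • (g - h) x = g x * φ x - h x * φ x := fun x => by
        simp only [Pi.sub_apply, smul_eq_mul]
        ring
      simp only [this]
      rw [integral_sub (hφ.integrable_mul h1.2.1) (hφ.integrable_mul h2.2.1)]
      linarith)
  filter_upwards [this] with x hx hxΩ
  exact sub_eq_zero.1 (hx hxΩ)

theorem HasWeakPartial.congr (h1 : HasWeakPartial Ω i u g)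
    (hu : u =ᵐ[volume.restrict Ω] v) (hg : g =ᵐ[volume.restrict Ω] h) : HasWeakPartial Ω i v h := by
  refine ⟨h1.1.congr hu, h1.2.1.congr hg, fun φ hφ => ?_⟩
  have e1 : ∫ x in Ω, v x * _root_.classicalPartial i φ x =
      ∫ x in Ω, u x * _root_.classicalPartial i φ x :=
    integral_congr_ae (by filter_upwards [hu] with x hx; rw [hx])
  have e2 : ∫ x in Ω, h x * φ x = ∫ x in Ω, g x * φ x :=
    integral_congr_ae (by filter_upwards [hg] with x hx; rw [hx])
  rw [e1, e2, h1.2.2 φ hφ]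

theorem HasWeakPartial.mono (h1 : HasWeakPartial Ω i u g) (hs : Ω' ⊆ Ω) :
    HasWeakPartial Ω' i u g := by
  rw [hasWeakPartial_iff] at h1 ⊢
  exact ⟨h1.1.mono_set hs, h1.2.1.mono_set hs, fun φ hφ => h1.2.2 φ (hφ.mono hs)⟩

theorem HasWeakPartial.weakPartial (h1 : HasWeakPartial Ω i u g) :
    HasWeakPartial Ω i u (weakPartial Ω i u) := by
  have h : ∃ g, HasWeakPartial Ω i u g := ⟨g, h1⟩
  rw [_root_.weakPartial, dif_pos h]
  exact h.choose_spec

theorem HasWeakPartial.weakPartial_ae_eq (hΩ : IsOpen Ω) (h1 : HasWeakPartial Ω i u g) :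
    _root_.weakPartial Ω i u =ᵐ[volume.restrict Ω] g :=
  h1.weakPartial.unique hΩ h1

theorem classicalPartial_mul {B : EuclideanSpace ℝ (Fin N) → ℝ} {x : EuclideanSpace ℝ (Fin N)}
    (hB : DifferentiableAt ℝ B x) (hφ : DifferentiableAt ℝ φ x) :
    classicalPartial i (fun x => B x * φ x) x =
      B x * classicalPartial i φ x + classicalPartial i B x * φ x := by
  unfold classicalPartial
  rw [fderiv_fun_mul hB hφ]
  simp only [add_apply, smul_apply, smul_eq_mul]
  ring

theorem IsTestFunction.smooth_mul (hφ : IsTestFunction Ω φ)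
    {B : EuclideanSpace ℝ (Fin N) → ℝ} (hB : ContDiff ℝ ∞ B) :
    IsTestFunction Ω (fun x => B x * φ x) :=
  ⟨hB.mul hφ.1, hφ.2.1.mul_left, (tsupport_mul_subset_right).trans hφ.2.2⟩

theorem HasWeakPartial.mul_smooth (h1 : HasWeakPartial Ω i u g) (hΩ : IsOpen Ω)
    {B : EuclideanSpace ℝ (Fin N) → ℝ} (hB : ContDiff ℝ ∞ B) :
    HasWeakPartial Ω i (fun x => u x * B x)
      (fun x => g x * B x + u x * _root_.classicalPartial i B x) := by
  rw [hasWeakPartial_iff] at h1 ⊢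
  have hB' := contDiff_classicalPartial (i := i) hB
  have loc : ∀ {f B : EuclideanSpace ℝ (Fin N) → ℝ}, LocallyIntegrableOn f Ω → Continuous B →
      LocallyIntegrableOn (fun x => f x * B x) Ω := by
    intro f B hf hB
    rw [locallyIntegrableOn_iff hΩ.isLocallyClosed]
    intro k hk hkc
    exact (hf.integrableOn_compact_subset hk hkc).mul_continuousOn hB.continuousOn hkc
  refine ⟨loc h1.1 hB.continuous, (loc h1.2.1 hB.continuous).add (loc h1.1 hB'.continuous),
    fun φ hφ => ?_⟩
  have e := h1.2.2 _ (hφ.smooth_mul hB)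
  have hd : ∀ x, _root_.classicalPartial i (fun x => B x * φ x) x =
      B x * _root_.classicalPartial i φ x + _root_.classicalPartial i B x * φ x := fun x =>
    classicalPartial_mul (hB.differentiable (by simp) x) (hφ.1.differentiable (by simp) x)
  simp only [hd] at e
  have i1 := ((hφ.classicalPartial i).smooth_mul hB).integrable_mul h1.1
  have i2 := (hφ.smooth_mul hB').integrable_mul h1.1
  have i3 := (hφ.smooth_mul hB).integrable_mul h1.2.1
  have e1 : ∫ x, u x * (B x * _root_.classicalPartial i φ x + _root_.classicalPartial i B x * φ x)
      = (∫ x, u x * (B x * _root_.classicalPartial i φ x)) +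
        ∫ x, u x * (_root_.classicalPartial i B x * φ x) := by
    rw [← integral_add i1 i2]
    simp only [mul_add]
  have e2 : ∫ x, (g x * B x + u x * _root_.classicalPartial i B x) * φ x =
      (∫ x, g x * (B x * φ x)) + ∫ x, u x * (_root_.classicalPartial i B x * φ x) := by
    rw [← integral_add i3 i2]
    congr 1
    ext x
    ring
  have e3 : ∫ x, u x * B x * _root_.classicalPartial i φ x =
      ∫ x, u x * (B x * _root_.classicalPartial i φ x) := by
    simp only [mul_assoc]
  rw [e3, e2]
  linarith

/-- Needed near the origin of a ball, where the competitor is a multiple of the minimizer plus a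
constant. The constant drops out because a derivative of a test function has integral zero. -/
theorem HasWeakPartial.affine (h1 : HasWeakPartial Ω i u g) (c k : ℝ) :
    HasWeakPartial Ω i (fun x => c * u x + k) (fun x => c * g x) := by
  rw [hasWeakPartial_iff] at h1 ⊢
  refine ⟨(h1.1.smul c).add (continuous_const.locallyIntegrable.locallyIntegrableOn _),
    h1.2.1.smul c, fun φ hφ => ?_⟩
  have e := h1.2.2 φ hφ
  have hz : ∫ x, _root_.classicalPartial i φ x = 0 := by
    have := integral_mul_fderiv_eq_neg_fderiv_mul_of_integrable
      (μ := (volume : Measure (EuclideanSpace ℝ (Fin N)))) (f := fun _ => (1 : ℝ)) (g := φ)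
      (v := EuclideanSpace.single i 1) (by simp)
      (by
        simp only [one_mul]
        exact (hφ.classicalPartial i).1.continuous.integrable_of_hasCompactSupport
          (hφ.classicalPartial i).2.1)
      (by
        simp only [one_mul]
        exact hφ.1.continuous.integrable_of_hasCompactSupport hφ.2.1)
      (fun x _ => differentiableAt_const _) (fun x _ => hφ.1.differentiable (by simp) x)
    simpa [_root_.classicalPartial] using this
  have i1 := (hφ.classicalPartial i).integrable_mul h1.1
  have i2 : Integrable (_root_.classicalPartial i φ) :=
    (hφ.classicalPartial i).1.continuous.integrable_of_hasCompactSupport (hφ.classicalPartial i).2.1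
  have : ∀ x, (c * u x + k) * _root_.classicalPartial i φ x =
    c * (u x * _root_.classicalPartial i φ x) + k * _root_.classicalPartial i φ x := fun x => by ring
  simp only [this, mul_assoc]
  rw [integral_add (i1.const_mul c) (i2.const_mul k), integral_const_mul, integral_const_mul,
    integral_const_mul, hz, e]
  ring

/-- Weak derivatives in a neighbourhood of the origin and away from it give weak derivatives. -/
theorem HasWeakPartial.glue_origin {δ R : ℝ} (hδ : 0 < δ)
    (h1 : HasWeakPartial (Metric.ball 0 δ) i u g) (h2 : HasWeakPartial (annulus N 0 R) i u g) :
    HasWeakPartial (Metric.ball 0 R) i u g := by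
  have hloc : ∀ {f : EuclideanSpace ℝ (Fin N) → ℝ}, LocallyIntegrableOn f (Metric.ball 0 δ) →
      LocallyIntegrableOn f (annulus N 0 R) → LocallyIntegrableOn f (Metric.ball 0 R) := by
    intro f f1 f2 x hx
    by_cases h0 : x = 0
    · subst h0
      have := f1 0 (by simpa using hδ)
      rw [IntegrableAtFilter] at this ⊢
      obtain ⟨s, hs, hs'⟩ := this
      rw [Metric.isOpen_ball.nhdsWithin_eq (by simpa using hδ)] at hs
      exact ⟨s, mem_nhdsWithin_of_mem_nhds hs, hs'⟩
    · have hxA : x ∈ annulus N 0 R := ⟨norm_pos_iff.2 h0, by simpa using hx⟩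
      have := f2 x hxA
      rw [IntegrableAtFilter] at this ⊢
      obtain ⟨s, hs, hs'⟩ := this
      rw [(isOpen_annulus N 0 R).nhdsWithin_eq hxA] at hs
      exact ⟨s, mem_nhdsWithin_of_mem_nhds hs, hs'⟩
  rw [hasWeakPartial_iff] at h1 h2 ⊢
  refine ⟨hloc h1.1 h2.1, hloc h1.2.1 h2.2.1, fun φ hφ => ?_⟩
  have hlu := hloc h1.1 h2.1
  have hlg := hloc h1.2.1 h2.2.1
  -- Partition of unity: `χφ` is supported in the small ball, and `(1 - χ)φ` vanishes near the
  -- origin.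
  set χ : ContDiffBump (0 : EuclideanSpace ℝ (Fin N)) := ⟨δ / 3, δ / 2, by positivity, by linarith⟩
    with hχ
  have hχs : ContDiff ℝ ∞ (fun x => χ x) := χ.contDiff
  have hφ1 : IsTestFunction (Metric.ball 0 δ) (fun x => χ x * φ x) := by
    refine ⟨hχs.mul hφ.1, hφ.2.1.mul_left, (tsupport_mul_subset_left).trans ?_⟩
    rw [χ.tsupport_eq]
    exact Metric.closedBall_subset_ball (by simp only [hχ]; linarith)
  have hφ1' : IsTestFunction (Metric.ball 0 R) (fun x => χ x * φ x) := hφ.smooth_mul hχs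
  have hχs2 : ContDiff ℝ ∞ (fun x => 1 - χ x) := contDiff_const.sub hχs
  have hφ2' : IsTestFunction (Metric.ball 0 R) (fun x => (1 - χ x) * φ x) := hφ.smooth_mul hχs2
  have hφ2 : IsTestFunction (annulus N 0 R) (fun x => (1 - χ x) * φ x) := by
    refine ⟨hφ2'.1, hφ2'.2.1, fun x hx => ?_⟩
    have hxR := hφ2'.2.2 hx
    refine ⟨norm_pos_iff.2 ?_, by simpa using hxR⟩
    rintro rfl
    have hev : (fun x => (1 - χ x) * φ x) =ᶠ[𝓝 0] 0 := by
      filter_upwards [χ.eventuallyEq_one] with x hx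
      simp [hx]
    exact (notMem_tsupport_iff_eventuallyEq.2 hev) hx
  have e1 := h1.2.2 _ hφ1
  have e2 := h2.2.2 _ hφ2
  have hsum : ∀ x, classicalPartial i φ x = classicalPartial i (fun x => χ x * φ x) x +
      classicalPartial i (fun x => (1 - χ x) * φ x) x := by
    intro x
    have : φ = fun x => χ x * φ x + (1 - χ x) * φ x := by ext x; ring
    conv_lhs => rw [this]
    unfold classicalPartial
    rw [fderiv_fun_add (hφ1.1.differentiable (by simp) x) (hφ2.1.differentiable (by simp) x)]
    simp
  simp only [hsum, mul_add]
  rw [integral_add ((hφ1'.classicalPartial i).integrable_mul hlu)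
    ((hφ2'.classicalPartial i).integrable_mul hlu), e1, e2, ← neg_add,
    ← integral_add (hφ1'.integrable_mul hlg) (hφ2'.integrable_mul hlg)]
  congr 2
  ext x
  ring

end WeakPartial

/-! ### Weak gradients of radial functions. -/

theorem hasFDerivAt_norm_of_ne_zero {N : ℕ} {x : EuclideanSpace ℝ (Fin N)} (hx : x ≠ 0) :
    HasFDerivAt (fun x : EuclideanSpace ℝ (Fin N) => ‖x‖) (‖x‖⁻¹ • innerSL ℝ x) x := by
  have h1 := (hasStrictFDerivAt_norm_sq x).hasFDerivAt
  have hne : ‖x‖ ^ 2 ≠ 0 := by positivity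
  have h2 := (Real.hasDerivAt_sqrt hne).comp_hasFDerivAt x h1
  have h3 : (Real.sqrt ∘ fun x : EuclideanSpace ℝ (Fin N) => ‖x‖ ^ 2) = fun x => ‖x‖ := by
    ext y
    simp
  rw [h3] at h2
  refine h2.congr_fderiv ?_
  have hn : ‖x‖ ≠ 0 := by positivity
  rw [Real.sqrt_sq (norm_nonneg _), ← Nat.cast_smul_eq_nsmul ℝ, smul_smul]
  congr 1
  field_simp
  norm_num

theorem hasFDerivAt_radial {N : ℕ} {A : ℝ → ℝ} {q : ℝ} {x : EuclideanSpace ℝ (Fin N)} (hx : x ≠ 0)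
    (hA : HasDerivAt A q ‖x‖) :
    HasFDerivAt (fun x : EuclideanSpace ℝ (Fin N) => A ‖x‖) (q • (‖x‖⁻¹ • innerSL ℝ x)) x :=
  hA.comp_hasFDerivAt x (hasFDerivAt_norm_of_ne_zero hx)

theorem classicalPartial_radial {N : ℕ} {A : ℝ → ℝ} {q : ℝ} {x : EuclideanSpace ℝ (Fin N)}
    (hx : x ≠ 0) (hA : HasDerivAt A q ‖x‖) (i : Fin N) :
    classicalPartial i (fun x => A ‖x‖) x = q * (x i / ‖x‖) := by
  rw [classicalPartial, (hasFDerivAt_radial hx hA).fderiv]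
  simp [EuclideanSpace.inner_single_right]
  left
  field_simp

theorem exists_Ioo_of_isCompact {a b : ℝ} (hab : a < b) {K : Set ℝ} (hc : IsCompact K)
    (hs : K ⊆ Ioo a b) : ∃ x ∈ Ioo a b, ∃ y ∈ Ioo a b, x < y ∧ K ⊆ Ioo x y := by
  obtain ⟨c, hc1⟩ := exists_between hab
  have hc' : IsCompact (insert c K) := hc.insert c
  have hs' : insert c K ⊆ Ioo a b := insert_subset hc1 hs
  obtain ⟨m, hm, hmin⟩ := hc'.exists_isLeast (insert_nonempty _ _)
  obtain ⟨M, hM, hmax⟩ := hc'.exists_isGreatest (insert_nonempty _ _)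
  obtain ⟨x, hx⟩ := exists_between (hs' hm).1
  obtain ⟨y, hy⟩ := exists_between (hs' hM).2
  have hmM := hmin hM
  refine ⟨x, ⟨hx.1, hx.2.trans (hs' hm).2⟩, y, ⟨(hs' hM).1.trans hy.1, hy.2⟩,
    hx.2.trans_le (hmM.trans hy.1.le), fun t ht => ⟨?_, ?_⟩⟩
  · exact hx.2.trans_le (hmin (mem_insert_of_mem _ ht))
  · exact (hmax (mem_insert_of_mem _ ht)).trans_lt hy.1

theorem abs_coord_div_norm_le {N : ℕ} (x : EuclideanSpace ℝ (Fin N)) (i : Fin N) :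
    |x i / ‖x‖| ≤ 1 := by
  rw [abs_div, abs_norm]
  exact div_le_one_of_le₀ (by simpa using PiLp.norm_apply_le x i) (norm_nonneg _)

theorem measurable_coord_div_norm {N : ℕ} (i : Fin N) :
    Measurable (fun x : EuclideanSpace ℝ (Fin N) => x i / ‖x‖) :=
  by fun_prop

theorem integrableOn_annulus_of_integrableOn {N : ℕ} (hN : 1 ≤ N) {a b : ℝ} (ha : 0 ≤ a)
    {q : ℝ → ℝ} (hq : IntegrableOn q (Ioo a b)) :
    IntegrableOn (fun x : EuclideanSpace ℝ (Fin N) => q ‖x‖) (annulus N a b) := by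
  rw [integrableOn_annulus_radial hN ha]
  have : IntegrableOn (fun r : ℝ => r ^ (N - 1)) (Icc a b) :=
    (continuous_pow _).continuousOn.integrableOn_Icc
  refine Integrable.bdd_mul hq (c := b ^ (N - 1)) (continuous_pow _).aestronglyMeasurable ?_
  filter_upwards [ae_restrict_mem measurableSet_Ioo] with r hr
  rw [Real.norm_eq_abs, abs_of_nonneg (pow_nonneg (ha.trans hr.1.le) _)]
  exact pow_le_pow_left₀ (ha.trans hr.1.le) hr.2.le _

theorem locallyIntegrableOn_annulus {N : ℕ} (hN : 1 ≤ N) {a b : ℝ} (ha : 0 ≤ a)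
    {q : ℝ → ℝ} (hq : LocallyIntegrableOn q (Ioo a b)) :
    LocallyIntegrableOn (fun x : EuclideanSpace ℝ (Fin N) => q ‖x‖) (annulus N a b) := by
  intro z hz
  obtain ⟨x, hx⟩ := exists_between hz.1
  obtain ⟨y, hy⟩ := exists_between hz.2
  refine ⟨annulus N x y, mem_nhdsWithin_of_mem_nhds
    ((isOpen_annulus N x y).mem_nhds ⟨hx.2, hy.1⟩), ?_⟩
  refine integrableOn_annulus_of_integrableOn hN (ha.trans hx.1.le) ?_
  exact (hq.integrableOn_compact_subset (Icc_subset_Ioo hx.1 hy.2) isCompact_Icc).mono_set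
    Ioo_subset_Icc_self

theorem LocallyIntegrableOn.mul_coord_div_norm {N : ℕ} {Ω : Set (EuclideanSpace ℝ (Fin N))}
    {f : EuclideanSpace ℝ (Fin N) → ℝ} (hf : LocallyIntegrableOn f Ω) (i : Fin N) :
    LocallyIntegrableOn (fun x => f x * (x i / ‖x‖)) Ω := by
  intro z hz
  obtain ⟨s, hs, hs'⟩ := hf z hz
  refine ⟨s, hs, Integrable.mul_bdd (c := 1) hs' (measurable_coord_div_norm i).aestronglyMeasurable
    (Eventually.of_forall fun x => ?_)⟩
  exact abs_coord_div_norm_le x i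

/-- Since `A` is only absolutely continuous, the derivative is obtained by approximation: `q` is
replaced by a continuous `p` close to it in `L¹`, and `A` by the primitive `B` of `p`. Then `B` is
uniformly close to `A`, classical integration by parts holds for `B(|x|)`, and the error is
proportional to the `L¹` distance. -/
theorem HasWeakPartial.of_radial {N : ℕ} (hN : 1 ≤ N) {a b : ℝ} (ha : 0 ≤ a)
    {A q : ℝ → ℝ} (hA : LocAC A q a b) (i : Fin N) :
    HasWeakPartial (annulus N a b) i (fun x => A ‖x‖) (fun x => q ‖x‖ * (x i / ‖x‖)) := by
  rw [hasWeakPartial_iff]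
  have hAl := locallyIntegrableOn_annulus hN ha (hA.continuousOn.locallyIntegrableOn measurableSet_Ioo)
  have hql := LocallyIntegrableOn.mul_coord_div_norm
    (locallyIntegrableOn_annulus hN ha hA.locallyIntegrableOn) i
  refine ⟨hAl, hql, fun ψ hψ => ?_⟩
  rcases le_or_gt b a with hba | hab
  · have : ∀ x, ψ x = 0 := fun x => hψ.eq_zero fun hx => by
      have := hx.1.trans hx.2
      linarith
    have h0 : ψ = fun _ => 0 := funext this
    simp [h0, classicalPartial]
  -- The test function lives in a smaller annulus that avoids the origin even when `a = 0`. There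
  -- the weight `r^(N-1)` is at most `β^(N-1)`, and `q` is integrable.
  obtain ⟨α, hα, β, hβ, hαβ, hsub⟩ := exists_Ioo_of_isCompact hab
    (hψ.2.1.isCompact.image continuous_norm) (by rintro _ ⟨x, hx, rfl⟩; exact hψ.2.2 hx)
  have hα0 : 0 < α := ha.trans_lt hα.1
  have hψD : IsTestFunction (annulus N α β) ψ :=
    ⟨hψ.1, hψ.2.1, fun x hx => hsub (mem_image_of_mem _ hx)⟩
  have hψ'D := hψD.classicalPartial i
  obtain ⟨C1, hC1⟩ := hψ.1.continuous.bounded_above_of_compact_support hψ.2.1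
  obtain ⟨C2, hC2⟩ := hψ'D.1.continuous.bounded_above_of_compact_support hψ'D.2.1
  obtain ⟨c, hc⟩ := exists_between hαβ
  have hc' : c ∈ Ioo a b := ⟨hα.1.trans hc.1, hc.2.trans hβ.2⟩
  have hqi : IntegrableOn q (Ioo α β) :=
    (hA.intervalIntegrable hα hβ).1.mono_set (by rw [← Ioo_union_right hαβ]; exact subset_union_left)
  set V := (volume (annulus N α β)).toReal with hV
  set S := sphereArea N * β ^ (N - 1) with hS
  have hS0 : 0 ≤ S := mul_nonneg (sphereArea_pos hN).le (pow_nonneg (hα0.trans hαβ).le _)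
  have hC10 : 0 ≤ C1 := (norm_nonneg _).trans (hC1 0)
  have hC20 : 0 ≤ C2 := (norm_nonneg _).trans (hC2 0)
  have main : ∀ ε > 0, |(∫ x, A ‖x‖ * classicalPartial i ψ x) +
      ∫ x, q ‖x‖ * (x i / ‖x‖) * ψ x| ≤ ε * (C2 * V + C1 * S) := by
    intro ε hε
    obtain ⟨p, -, hpε, hpc, hpi⟩ := ((integrable_indicator_iff measurableSet_Ioo).2
      hqi).exists_hasCompactSupport_integral_sub_le hε
    have hdiff : IntegrableOn (fun r => q r - p r) (Ioo α β) := hqi.sub hpi.integrableOn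
    have hpε' : ∫ r in Ioo α β, |q r - p r| ≤ ε := by
      refine le_trans ?_ hpε
      rw [← integral_indicator measurableSet_Ioo]
      refine integral_mono (IntegrableOn.integrable_indicator hdiff.abs measurableSet_Ioo)
        ((((integrable_indicator_iff measurableSet_Ioo).2 hqi).sub hpi).norm) fun r => ?_
      by_cases hr : r ∈ Ioo α β
      · simp [indicator_of_mem hr]
      · rw [indicator_of_notMem hr]
        exact norm_nonneg _
    set B : ℝ → ℝ := fun r => A c + ∫ t in c..r, p t with hB
    have hBd : ∀ r, HasDerivAt B (p r) r := fun r => (hasDerivAt_primitive hpc c r).const_add _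
    have hBc : Continuous B := continuous_iff_continuousAt.2 fun r => (hBd r).continuousAt
    have hAB : ∀ r ∈ Ioo α β, |A r - B r| ≤ ε := by
      intro r hr
      have hr' : r ∈ Ioo a b := ⟨hα.1.trans hr.1, hr.2.trans hβ.2⟩
      have e : A r - B r = ∫ t in c..r, (q t - p t) := by
        rw [intervalIntegral.integral_sub (hA.intervalIntegrable hc' hr')
          (hpc.intervalIntegrable _ _), hA.integral_eq hc' hr']
        simp only [hB]
        ring
      rw [e, ← Real.norm_eq_abs]
      refine le_trans ?_ hpε'
      refine (intervalIntegral.norm_integral_le_integral_norm_uIoc).trans ?_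
      refine setIntegral_mono_set hdiff.abs (Eventually.of_forall fun _ => abs_nonneg _) ?_
      refine (uIoc_subset_uIcc.trans (uIcc_subset_Ioo hc hr)).eventuallyLE
    have hne : ∀ x ∈ annulus N α β, x ≠ 0 := fun x hx => norm_pos_iff.1 (hα0.trans hx.1)
    have hx0 : ∀ x ∈ tsupport ψ, x ≠ 0 := fun x hx => hne x (hψD.2.2 hx)
    have hfd : ∀ x, (fderiv ℝ (fun x : EuclideanSpace ℝ (Fin N) => B ‖x‖) x)
        (EuclideanSpace.single i 1) * ψ x = p ‖x‖ * (x i / ‖x‖) * ψ x := by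
      intro x
      by_cases hx : x ∈ tsupport ψ
      · rw [← classicalPartial_radial (hx0 x hx) (hBd _) i, classicalPartial]
      · rw [image_eq_zero_of_notMem_tsupport hx, mul_zero, mul_zero]
    have hpl : LocallyIntegrableOn (fun x => p ‖x‖ * (x i / ‖x‖)) (annulus N a b) :=
      LocallyIntegrableOn.mul_coord_div_norm
        ((hpc.comp continuous_norm).locallyIntegrable.locallyIntegrableOn _) i
    have hBl : LocallyIntegrableOn (fun x : EuclideanSpace ℝ (Fin N) => B ‖x‖) (annulus N a b) :=
      (hBc.comp continuous_norm).locallyIntegrable.locallyIntegrableOn _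
    have ibp := integral_mul_fderiv_eq_neg_fderiv_mul_of_integrable
      (μ := (volume : Measure (EuclideanSpace ℝ (Fin N)))) (f := fun x => B ‖x‖) (g := ψ)
      (v := EuclideanSpace.single i 1)
      (by simp only [hfd]; exact hψ.integrable_mul hpl)
      ((hψ.classicalPartial i).integrable_mul hBl) (hψ.integrable_mul hBl)
      (fun x hx => (hasFDerivAt_radial (hx0 x hx) (hBd _)).differentiableAt)
      (fun x _ => hψ.1.differentiable (by simp) x)
    simp only [hfd] at ibp
    change ∫ x, B ‖x‖ * classicalPartial i ψ x = _ at ibp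
    have i1 := (hψ.classicalPartial i).integrable_mul hAl
    have i2 := hψ.integrable_mul hql
    have i3 := (hψ.classicalPartial i).integrable_mul hBl
    have i4 := hψ.integrable_mul hpl
    have e : (∫ x, A ‖x‖ * classicalPartial i ψ x) + ∫ x, q ‖x‖ * (x i / ‖x‖) * ψ x =
        ∫ x in annulus N α β, ((A ‖x‖ - B ‖x‖) * classicalPartial i ψ x +
          (q ‖x‖ - p ‖x‖) * (x i / ‖x‖) * ψ x) := by
      rw [setIntegral_eq_integral_of_forall_compl_eq_zero fun x hx => by
        rw [hψD.eq_zero hx, hψ'D.eq_zero hx, mul_zero, mul_zero, add_zero]]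
      have : ∀ x, (A ‖x‖ - B ‖x‖) * classicalPartial i ψ x +
          (q ‖x‖ - p ‖x‖) * (x i / ‖x‖) * ψ x =
          (A ‖x‖ * classicalPartial i ψ x + q ‖x‖ * (x i / ‖x‖) * ψ x) -
          (B ‖x‖ * classicalPartial i ψ x + p ‖x‖ * (x i / ‖x‖) * ψ x) := fun x => by ring
      simp only [this]
      rw [integral_sub (i1.fun_add i2) (i3.fun_add i4), integral_add i1 i2, integral_add i3 i4, ibp]
      ring
    rw [e]
    have hrad : IntegrableOn (fun x : EuclideanSpace ℝ (Fin N) => |q ‖x‖ - p ‖x‖|)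
        (annulus N α β) := integrableOn_annulus_of_integrableOn hN hα0.le hdiff.abs
    have hbd : ∀ᵐ x ∂(volume.restrict (annulus N α β)),
        ‖(A ‖x‖ - B ‖x‖) * classicalPartial i ψ x + (q ‖x‖ - p ‖x‖) * (x i / ‖x‖) * ψ x‖ ≤
        ε * C2 + C1 * |q ‖x‖ - p ‖x‖| := by
      filter_upwards [ae_restrict_mem (measurableSet_annulus N α β)] with x hx
      refine (norm_add_le _ _).trans (add_le_add ?_ ?_)
      · rw [norm_mul]
        exact mul_le_mul (hAB _ hx) (hC2 x) (norm_nonneg _) hε.le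
      · rw [norm_mul, norm_mul, mul_comm C1]
        refine mul_le_mul ?_ (hC1 x) (norm_nonneg _) (abs_nonneg _)
        exact mul_le_of_le_one_right (norm_nonneg _) (abs_coord_div_norm_le x i)
    refine (norm_integral_le_of_norm_le ((integrable_const _).fun_add (hrad.const_mul C1)) hbd).trans ?_
    rw [integral_add (integrable_const _) (hrad.const_mul C1), integral_const_mul C1,
      integral_annulus_radial hN hα0.le (fun r => |q r - p r|), integral_const]
    have hw : ∫ r in Ioo α β, r ^ (N - 1) * |q r - p r| ≤ β ^ (N - 1) * ε := by
      refine le_trans (setIntegral_mono_on (g := fun r => β ^ (N - 1) * |q r - p r|) ?_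
        (hdiff.abs.const_mul _) measurableSet_Ioo fun r hr => ?_) ?_
      · exact (integrableOn_annulus_radial hN hα0.le (fun r => |q r - p r|)).1 hrad
      · exact mul_le_mul_of_nonneg_right (pow_le_pow_left₀ (hα0.le.trans hr.1.le) hr.2.le _)
          (abs_nonneg _)
      · rw [integral_const_mul]
        exact mul_le_mul_of_nonneg_left hpε' (pow_nonneg (hα0.le.trans hαβ.le) _)
    have hw2 := mul_le_mul_of_nonneg_left hw (mul_nonneg hC10 (sphereArea_pos hN).le)
    rw [smul_eq_mul, measureReal_restrict_apply_univ, Measure.real, ← hV]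
    rw [hS]
    linarith
  have hzero : |(∫ x, A ‖x‖ * classicalPartial i ψ x) + ∫ x, q ‖x‖ * (x i / ‖x‖) * ψ x| ≤ 0 := by
    set T := C2 * V + C1 * S with hT
    have hT0 : 0 ≤ T := add_nonneg (mul_nonneg hC20 ENNReal.toReal_nonneg) (mul_nonneg hC10 hS0)
    refine le_of_forall_pos_le_add fun ε hε => ?_
    have := main (ε / (T + 1)) (by positivity)
    refine this.trans ?_
    rw [zero_add, div_mul_eq_mul_div, div_le_iff₀ (by positivity)]
    nlinarith
  have := abs_nonpos_iff.1 hzero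
  linarith

/-! ### Limits in `L²` and integration by parts in `H¹₀`. -/

theorem tendsto_integral_mul_of_tendsto_eLpNorm {α : Type*} [MeasurableSpace α] {μ : Measure α}
    {f ψ : α → ℝ} {F : ℕ → α → ℝ} (hf : MemLp f 2 μ) (hF : ∀ n, MemLp (F n) 2 μ)
    (hψ : MemLp ψ 2 μ) (h : Tendsto (fun n => eLpNorm (fun x => F n x - f x) 2 μ) atTop (𝓝 0)) :
    Tendsto (fun n => ∫ x, F n x * ψ x ∂μ) atTop (𝓝 (∫ x, f x * ψ x ∂μ)) := by
  have hb : Tendsto (fun n => eLpNorm (fun x => F n x - f x) 2 μ * eLpNorm ψ 2 μ) atTop (𝓝 0) := by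
    have := ENNReal.Tendsto.mul_const h (Or.inr hψ.eLpNorm_ne_top) (b := eLpNorm ψ 2 μ)
    simpa using this
  have hle : ∀ n, eLpNorm ((fun x => F n x * ψ x) - fun x => f x * ψ x) 1 μ ≤
      eLpNorm (fun x => F n x - f x) 2 μ * eLpNorm ψ 2 μ := by
    intro n
    have := eLpNorm_smul_le_mul_eLpNorm (p := 2) (q := 2) (r := 1) hψ.1 ((hF n).sub hf).1
    refine le_trans (le_of_eq ?_) this
    congr 1
    ext x
    simp only [Pi.sub_apply, Pi.smul_apply', smul_eq_mul]
    ring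
  have hlim : Tendsto (fun n => eLpNorm ((fun x => F n x * ψ x) - fun x => f x * ψ x) 1 μ) atTop
      (𝓝 0) :=
    tendsto_of_tendsto_of_tendsto_of_le_of_le tendsto_const_nhds hb (fun _ => zero_le) hle
  exact tendsto_integral_of_L1' (fun x => f x * ψ x) (hf.integrable_mul hψ).aestronglyMeasurable
    (Eventually.of_forall fun n => (hF n).integrable_mul hψ) hlim

theorem IsTestFunction.memLp {N : ℕ} {Ω Ω' : Set (EuclideanSpace ℝ (Fin N))}
    {φ : EuclideanSpace ℝ (Fin N) → ℝ} (hφ : IsTestFunction Ω φ) (p : ℝ≥0∞) :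
    MemLp φ p (volume.restrict Ω') :=
  (hφ.1.continuous.memLp_of_hasCompactSupport hφ.2.1).restrict _

theorem IsTestFunction.integral_mul_classicalPartial {N : ℕ}
    {Ω Ω' : Set (EuclideanSpace ℝ (Fin N))} {φ ψ : EuclideanSpace ℝ (Fin N) → ℝ}
    (hφ : IsTestFunction Ω φ) (hψ : IsTestFunction Ω' ψ) (i : Fin N) :
    ∫ x, φ x * _root_.classicalPartial i ψ x = -∫ x, _root_.classicalPartial i φ x * ψ x := by
  have hc := hφ.1.continuous
  have hc' := hψ.1.continuous
  have hd := (hφ.classicalPartial i).1.continuous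
  have hd' := (hψ.classicalPartial i).1.continuous
  exact integral_mul_fderiv_eq_neg_fderiv_mul_of_integrable
    ((hd.mul hc').integrable_of_hasCompactSupport hψ.2.1.mul_left)
    ((hc.mul hd').integrable_of_hasCompactSupport hφ.2.1.mul_right)
    ((hc.mul hc').integrable_of_hasCompactSupport hφ.2.1.mul_right)
    (fun x _ => hφ.1.differentiable (by simp) x) (fun x _ => hψ.1.differentiable (by simp) x)

/-- Integration by parts without boundary terms for functions in `H¹₀`, against functions
that need not vanish on the boundary. -/
theorem MemH1Zero.integral_mul_classicalPartial {N : ℕ} {Ω : Set (EuclideanSpace ℝ (Fin N))}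
    {u ψ : EuclideanSpace ℝ (Fin N) → ℝ}
    (hu : MemH1Zero Ω u) (hψ : IsTestFunction univ ψ) (i : Fin N) :
    ∫ x in Ω, u x * classicalPartial i ψ x = -∫ x in Ω, weakPartial Ω i u x * ψ x := by
  obtain ⟨hH1, φ, hφ, hL, hD⟩ := hu
  have t1 := tendsto_integral_mul_of_tendsto_eLpNorm hH1.1 (fun n => (hφ n).memLp 2)
    ((hψ.classicalPartial i).memLp 2) hL
  have t2 := tendsto_integral_mul_of_tendsto_eLpNorm (hH1.2 i).2
    (fun n => ((hφ n).classicalPartial i).memLp 2) (hψ.memLp 2) (hD i)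
  have e : ∀ n, ∫ x in Ω, φ n x * classicalPartial i ψ x =
      -∫ x in Ω, classicalPartial i (φ n) x * ψ x := by
    intro n
    rw [setIntegral_eq_integral_of_forall_compl_eq_zero fun x hx => by
        rw [(hφ n).eq_zero hx, zero_mul],
      setIntegral_eq_integral_of_forall_compl_eq_zero fun x hx => by
        rw [((hφ n).classicalPartial i).eq_zero hx, zero_mul]]
    exact (hφ n).integral_mul_classicalPartial hψ i
  simp only [e] at t1
  exact tendsto_nhds_unique t1 t2.neg

/-! ### Radial test functions and second derivatives of radial functions. -/

theorem contDiff_radial {N : ℕ} {ξ : ℝ → ℝ} (hξ : ContDiff ℝ ∞ ξ) (h0 : ∀ᶠ r in 𝓝 0, ξ r = ξ 0) :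
    ContDiff ℝ ∞ (fun x : EuclideanSpace ℝ (Fin N) => ξ ‖x‖) := by
  rw [contDiff_iff_contDiffAt]
  intro x
  by_cases hx : x = 0
  · subst hx
    have : (fun x : EuclideanSpace ℝ (Fin N) => ξ ‖x‖) =ᶠ[𝓝 0] fun _ => ξ 0 := by
      have ht : Tendsto (fun x : EuclideanSpace ℝ (Fin N) => ‖x‖) (𝓝 0) (𝓝 0) := by
        simpa using (continuous_norm (E := EuclideanSpace ℝ (Fin N))).tendsto 0
      exact ht.eventually h0
    exact contDiffAt_const.congr_of_eventuallyEq this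
  · exact hξ.contDiffAt.comp x (contDiffAt_norm ℝ hx)

theorem tsupport_radial_subset {N : ℕ} (ξ : ℝ → ℝ) :
    tsupport (fun x : EuclideanSpace ℝ (Fin N) => ξ ‖x‖) ⊆ (fun x => ‖x‖) ⁻¹' tsupport ξ :=
  closure_minimal (fun _ hx => subset_tsupport ξ hx) ((isClosed_tsupport ξ).preimage continuous_norm)

theorem hasCompactSupport_radial {N : ℕ} {ξ : ℝ → ℝ} {R : ℝ} (h : ∀ r, R < r → ξ r = 0) :
    HasCompactSupport (fun x : EuclideanSpace ℝ (Fin N) => ξ ‖x‖) := by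
  refine HasCompactSupport.of_support_subset_isCompact (isCompact_closedBall 0 R) fun x hx => ?_
  by_contra hcon
  exact hx (h _ (by simpa using hcon))

theorem eventually_zero_of_tsupport {ξ : ℝ → ℝ} (h : tsupport ξ ⊆ Ioi 0) :
    ∀ᶠ r in 𝓝 0, ξ r = ξ 0 := by
  have h0 : (0 : ℝ) ∉ tsupport ξ := fun h' => lt_irrefl _ (mem_Ioi.1 (h h'))
  have := notMem_tsupport_iff_eventuallyEq.1 h0
  filter_upwards [this] with r hr
  rw [hr, image_eq_zero_of_notMem_tsupport h0]
  rfl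

theorem contDiff_pow_inv_mul {η : ℝ → ℝ} (hη : ContDiff ℝ ∞ η) (h : tsupport η ⊆ Ioi 0) (n : ℕ) :
    ContDiff ℝ ∞ (fun r => (r ^ n)⁻¹ * η r) := by
  rw [contDiff_iff_contDiffAt]
  intro r
  by_cases hr : r ∈ tsupport η
  · have : r ^ n ≠ 0 := pow_ne_zero _ (ne_of_gt (h hr))
    exact ((contDiff_id.pow n).contDiffAt.inv this).mul hη.contDiffAt
  · have := notMem_tsupport_iff_eventuallyEq.1 hr
    refine (contDiffAt_const (c := (0 : ℝ))).congr_of_eventuallyEq ?_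
    filter_upwards [this] with s hs
    simp [hs]

theorem sum_coord_div_norm_sq {N : ℕ} {x : EuclideanSpace ℝ (Fin N)} (hx : x ≠ 0) :
    ∑ i, (x i / ‖x‖) ^ 2 = 1 := by
  have h : ‖x‖ ≠ 0 := norm_ne_zero_iff.2 hx
  simp only [div_pow]
  rw [← Finset.sum_div, div_eq_one_iff_eq (by positivity), EuclideanSpace.norm_sq_eq]
  simp

/-- The second weak partial derivatives of a radial function with profile derivative `w` and
`w' = q`. -/
noncomputable def radialHessian {N : ℕ} (w q : ℝ → ℝ) (i j : Fin N)
    (x : EuclideanSpace ℝ (Fin N)) : ℝ :=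
  (q ‖x‖ / ‖x‖ - w ‖x‖ / ‖x‖ ^ 2) * (x j / ‖x‖) * x i + w ‖x‖ / ‖x‖ * (if i = j then 1 else 0)

/-- Write the component as `(w(r)/r) * x i`, a radial locally absolutely continuous function times a
smooth one, and use the product rule. -/
theorem hasWeakPartial_radialHessian {N : ℕ} (hN : 1 ≤ N) {a b : ℝ} (ha : 0 ≤ a) {w q : ℝ → ℝ}
    (hw : LocAC w q a b) (i j : Fin N) :
    HasWeakPartial (annulus N a b) j (fun x => w ‖x‖ * (x i / ‖x‖)) (radialHessian w q i j) := by
  have h1 : LocAC (fun r : ℝ => r⁻¹) (fun r => -(r ^ 2)⁻¹) a b := by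
    refine LocAC.of_hasDerivAt (fun r hr => hasDerivAt_inv (ha.trans_lt hr.1).ne') ?_
    refine ContinuousOn.neg (ContinuousOn.inv₀ (by fun_prop) fun r hr => ?_)
    exact pow_ne_zero _ (ha.trans_lt hr.1).ne'
  have hB : ContDiff ℝ ∞ (fun x : EuclideanSpace ℝ (Fin N) => x i) := by fun_prop
  have h2 := (HasWeakPartial.of_radial hN ha (hw.mul h1) j).mul_smooth (isOpen_annulus N a b) hB
  have hder : ∀ x : EuclideanSpace ℝ (Fin N), classicalPartial j (fun x : EuclideanSpace ℝ (Fin N) => x i) x =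
      if i = j then 1 else 0 := by
    intro x
    have : HasFDerivAt (fun x : EuclideanSpace ℝ (Fin N) => x i)
        (EuclideanSpace.proj i : EuclideanSpace ℝ (Fin N) →L[ℝ] ℝ) x :=
      (EuclideanSpace.proj i : EuclideanSpace ℝ (Fin N) →L[ℝ] ℝ).hasFDerivAt
    rw [classicalPartial, this.fderiv]
    simp
  refine h2.congr (Eventually.of_forall fun x => ?_) (Eventually.of_forall fun x => ?_)
  · simp only
    ring
  · simp only [hder, radialHessian]
    ring

theorem radialLaplacian {N : ℕ} {w q : ℝ → ℝ} {x : EuclideanSpace ℝ (Fin N)} (hx : x ≠ 0) :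
    ∑ i, radialHessian w q i i x = q ‖x‖ + (N - 1) * (w ‖x‖ / ‖x‖) := by
  have h : ‖x‖ ≠ 0 := norm_ne_zero_iff.2 hx
  have h1 : ∀ i, radialHessian w q i i x =
      (q ‖x‖ - w ‖x‖ / ‖x‖) * (x i / ‖x‖) ^ 2 + w ‖x‖ / ‖x‖ := by
    intro i
    simp only [radialHessian, if_true]
    field_simp
  simp only [h1]
  rw [Finset.sum_add_distrib, ← Finset.mul_sum, sum_coord_div_norm_sq hx]
  simp
  ring

theorem LocAC.div_pow {A q : ℝ → ℝ} {a b : ℝ} (ha : 0 ≤ a) (h : LocAC A q a b) (n : ℕ) :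
    ∃ q', LocAC (fun r => (r ^ n)⁻¹ * A r) q' a b := by
  have h1 : LocAC (fun r : ℝ => (r ^ n)⁻¹) (fun r => -(n * r ^ (n - 1)) / (r ^ n) ^ 2) a b := by
    refine LocAC.of_hasDerivAt (fun r hr => ?_) ?_
    · exact (hasDerivAt_pow n r).inv (pow_ne_zero _ (ha.trans_lt hr.1).ne')
    · refine ContinuousOn.div (by fun_prop) (by fun_prop) fun r hr => ?_
      exact pow_ne_zero _ (pow_ne_zero _ (ha.trans_lt hr.1).ne')
  exact ⟨_, h1.mul h⟩

/-- `A` is the primitive of `w` on `(R₀,R)` with the Dirichlet boundary conditions of the radial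
domain: `A(R) = 0` and, if `R₀ > 0`, `A(R₀) = 0`. -/
def IsDirichletPrimitive (V w : ℝ → ℝ) (R₀ R : ℝ) : Prop :=
  (∀ r ∈ Ioo R₀ R, IntervalIntegrable w volume r R ∧ V r = -∫ t in r..R, w t) ∧
    (0 < R₀ → IntervalIntegrable w volume R₀ R ∧ ∫ t in R₀..R, w t = 0)

theorem IsDirichletPrimitive.congr {V w w' : ℝ → ℝ} {R₀ R : ℝ} (hR : R₀ < R)
    (h : IsDirichletPrimitive V w R₀ R)
    (hw : ∀ᵐ r, r ∈ Ioo R₀ R → w r = w' r) : IsDirichletPrimitive V w' R₀ R := by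
  have key : ∀ r, R₀ ≤ r → r < R → ∀ᵐ t, t ∈ uIoc r R → w t = w' t := by
    intro r h1 h2
    have hR : ∀ᵐ t : ℝ, t ≠ R := by simp [ae_iff]
    filter_upwards [hw, hR] with t ht htR hm
    rw [uIoc_of_le h2.le] at hm
    exact ht ⟨h1.trans_lt hm.1, lt_of_le_of_ne hm.2 htR⟩
  refine ⟨fun r hr => ?_, fun h0 => ?_⟩
  · obtain ⟨h1, h2⟩ := h.1 r hr
    have k := key r hr.1.le hr.2
    exact ⟨h1.congr_ae ((ae_restrict_iff' measurableSet_uIoc).2 k),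
      by rw [h2, intervalIntegral.integral_congr_ae k]⟩
  · obtain ⟨h1, h2⟩ := h.2 h0
    have k := key R₀ le_rfl hR
    exact ⟨h1.congr_ae ((ae_restrict_iff' measurableSet_uIoc).2 k),
      by rw [← h2, intervalIntegral.integral_congr_ae k]⟩

theorem locallyIntegrableOn_of_pow_mul {n : ℕ} {a b c d : ℝ} {f : ℝ → ℝ} (ha : 0 ≤ a)
    (h : IntegrableOn (fun r => r ^ n * f r) (Ioo c d)) :
    LocallyIntegrableOn ((Ioo c d).indicator f) (Ioo a b) := by
  rw [locallyIntegrableOn_iff isOpen_Ioo.isLocallyClosed]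
  intro K hK hKc
  have h1 : IntegrableOn ((Ioo c d).indicator fun r => r ^ n * f r) K :=
    (IntegrableOn.integrable_indicator h measurableSet_Ioo).integrableOn
  have h2 : IntegrableOn (fun r => (r ^ n)⁻¹ * (Ioo c d).indicator (fun r => r ^ n * f r) r) K := by
    refine h1.continuousOn_mul (ContinuousOn.inv₀ (by fun_prop) fun r hr => ?_) hKc
    exact pow_ne_zero _ (ha.trans_lt (hK hr).1).ne'
  refine h2.congr_fun (fun r hr => ?_) hKc.measurableSet
  by_cases hm : r ∈ Ioo c d
  · have : r ^ n ≠ 0 := pow_ne_zero _ (ha.trans_lt (hK hr).1).ne'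
    simp only [indicator_of_mem hm]
    field_simp
  · simp [indicator_of_notMem hm]

theorem LocAC.eq_zero_of_ae {A q : ℝ → ℝ} {a b c d : ℝ} (h : LocAC A q a b)
    (hcd : Ioo c d ⊆ Ioo a b) (h0 : ∀ᵐ r, r ∈ Ioo c d → A r = 0) : ∀ r ∈ Ioo c d, A r = 0 := by
  have hc : ContinuousOn A (Ioo c d) := h.continuousOn.mono hcd
  have : A =ᵐ[volume.restrict (Ioo c d)] 0 := (ae_restrict_iff' measurableSet_Ioo).2 h0
  exact Measure.eqOn_open_of_ae_eq this isOpen_Ioo hc continuousOn_const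

theorem integral_indicator_mul_eq {a b c : ℝ} (ha : 0 ≤ a) (hbc : b ≤ c) (n : ℕ) (f k : ℝ → ℝ) :
    ∫ r in Ioo 0 c, (Ioo a b).indicator f r * k r =
      ∫ r in Ioo a b, r ^ n * (f r * ((r ^ n)⁻¹ * k r)) := by
  rw [setIntegral_eq_of_subset_of_forall_sdiff_eq_zero measurableSet_Ioo
    (Ioo_subset_Ioo ha hbc) (fun r hr => by rw [indicator_of_notMem hr.2, zero_mul])]
  refine setIntegral_congr_fun measurableSet_Ioo fun r hr => ?_
  have := pow_ne_zero n (ha.trans_lt hr.1).ne'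
  rw [indicator_of_mem hr]
  field_simp

/-- For `ξ = r^(-N) η` the left side is the divergence of the field `ξ(|x|) x`. The right side
cancels the polar weight `r^(N-1)` and leaves the one-dimensional test derivative `η'`. -/
theorem deriv_pow_inv_mul {N : ℕ} (hN : 1 ≤ N) {η : ℝ → ℝ} (h1 : ContDiff ℝ ∞ η) {r : ℝ}
    (hr : 0 < r) : deriv (fun r => (r ^ N)⁻¹ * η r) r * r + N * ((r ^ N)⁻¹ * η r) =
      (r ^ (N - 1))⁻¹ * deriv η r := by
  have hd := ((hasDerivAt_pow N r).inv (pow_ne_zero _ hr.ne')).mul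
    (h1.differentiable (by simp) r).hasDerivAt
  have : deriv (fun r => (r ^ N)⁻¹ * η r) r = _ := hd.deriv
  rw [this]
  have hpow : r ^ N = r ^ (N - 1) * r := by
    rw [← pow_succ, Nat.sub_add_cancel hN]
  simp only [Pi.inv_apply]
  rw [hpow]
  have := pow_ne_zero (N - 1) hr.ne'
  have := hr.ne'
  field_simp
  ring

/-! ### Profiles of functions in `H¹₀` and `H_r`. -/

section Regularity

variable {N : ℕ} {Ω : Set (EuclideanSpace ℝ (Fin N))} {R₀ R : ℝ}
  {u : EuclideanSpace ℝ (Fin N) → ℝ}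

theorem sum_classicalPartial_radial_field {ξ : ℝ → ℝ} (hξ : ContDiff ℝ ∞ ξ)
    {x : EuclideanSpace ℝ (Fin N)} (hx : x ≠ 0) :
    ∑ i, classicalPartial i (fun x : EuclideanSpace ℝ (Fin N) => ξ ‖x‖ * x i) x =
      deriv ξ ‖x‖ * ‖x‖ + N * ξ ‖x‖ := by
  have hn : ‖x‖ ≠ 0 := norm_ne_zero_iff.2 hx
  have hder : ∀ i : Fin N, classicalPartial i (fun x : EuclideanSpace ℝ (Fin N) => x i) x = 1 := by
    intro i
    have : HasFDerivAt (fun x : EuclideanSpace ℝ (Fin N) => x i)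
        (EuclideanSpace.proj i : EuclideanSpace ℝ (Fin N) →L[ℝ] ℝ) x :=
      (EuclideanSpace.proj i : EuclideanSpace ℝ (Fin N) →L[ℝ] ℝ).hasFDerivAt
    rw [classicalPartial, this.fderiv]
    simp
  have hd : HasDerivAt ξ (deriv ξ ‖x‖) ‖x‖ := (hξ.differentiable (by simp) _).hasDerivAt
  have h1 : ∀ i : Fin N, classicalPartial i (fun x : EuclideanSpace ℝ (Fin N) => ξ ‖x‖ * x i) x =
      deriv ξ ‖x‖ * ‖x‖ * (x i / ‖x‖) ^ 2 + ξ ‖x‖ := by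
    intro i
    have hp : DifferentiableAt ℝ (fun x : EuclideanSpace ℝ (Fin N) => x i) x := by fun_prop
    rw [classicalPartial_mul (hasFDerivAt_radial hx hd).differentiableAt hp, hder,
      classicalPartial_radial hx hd]
    field_simp
    ring
  simp only [h1]
  rw [Finset.sum_add_distrib, ← Finset.mul_sum, sum_coord_div_norm_sq hx]
  simp

set_option maxHeartbeats 1000000 in
/-- A radial function in `H¹₀` has a locally absolutely continuous profile which vanishes on the
boundary. -/
theorem exists_profile_of_memH1Zero (hN : 1 ≤ N) (hR₀ : 0 ≤ R₀) (hR : R₀ < R)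
    (hsub : annulus N R₀ R ⊆ Ω) (hae : Ω =ᵐ[volume] annulus N R₀ R)
    (hu : MemH1Zero Ω u) (hrad : IsRadialOn Ω u) :
    ∃ V G : ℝ → ℝ, LocAC V G R₀ R ∧ IsDirichletPrimitive V G R₀ R ∧
      IntegrableOn (fun x : EuclideanSpace ℝ (Fin N) => G ‖x‖) (annulus N R₀ R) ∧
      (∀ᵐ x ∂(volume.restrict Ω), u x = V ‖x‖) ∧
      ∀ i, weakPartial Ω i u =ᵐ[volume.restrict Ω] fun x => G ‖x‖ * (x i / ‖x‖) := by
  have hμ : volume.restrict Ω = volume.restrict (annulus N R₀ R) := Measure.restrict_congr_set hae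
  obtain ⟨V₀, hV₀⟩ := hrad
  have hui : IntegrableOn u (annulus N R₀ R) := by
    have := hu.1.1
    rw [hμ] at this
    exact this.integrable (by norm_num)
  have hDi : ∀ i, IntegrableOn (weakPartial Ω i u) (annulus N R₀ R) := by
    intro i
    have := (hu.1.2 i).2
    rw [hμ] at this
    exact this.integrable (by norm_num)
  have hVi : IntegrableOn (fun x : EuclideanSpace ℝ (Fin N) => V₀ ‖x‖) (annulus N R₀ R) :=
    hui.congr (by rw [← hμ]; exact hV₀)
  -- The radial component of the gradient; its spherical mean `G` is the candidate for the
  -- derivative of the profile.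
  set g : EuclideanSpace ℝ (Fin N) → ℝ := fun x => ∑ i, weakPartial Ω i u x * (x i / ‖x‖) with hg
  have hgi' : ∀ i, IntegrableOn (fun x => weakPartial Ω i u x * (x i / ‖x‖)) (annulus N R₀ R) :=
    fun i => Integrable.mul_bdd (c := 1) (hDi i) (measurable_coord_div_norm i).aestronglyMeasurable
      (Eventually.of_forall fun x => abs_coord_div_norm_le x i)
  have hgi : IntegrableOn g (annulus N R₀ R) := integrable_finsetSum _ fun i _ => hgi' i
  obtain ⟨G, hGi, hG⟩ := exists_radial_average hgi
  have hV1 := (integrableOn_annulus_radial hN hR₀ V₀).1 hVi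
  have hG1 := (integrableOn_annulus_radial hN hR₀ G).1 hGi
  have hS := sphereArea_pos hN
  -- The support of `η` may cross `R` and `R₀`, since functions in `H¹₀` can be tested against
  -- functions that do not vanish on the boundary. Hence the extension of the profile by zero has a
  -- weak derivative on `(0, R + 1)`, and this encodes the boundary values.
  have weak : ∀ η : ℝ → ℝ, ContDiff ℝ ∞ η → HasCompactSupport η → tsupport η ⊆ Ioo 0 (R + 1) →
      ∫ r in Ioo 0 (R + 1), (Ioo R₀ R).indicator V₀ r * deriv η r =
        -∫ r in Ioo 0 (R + 1), (Ioo R₀ R).indicator G r * η r := by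
    intro η h1 h2 h3
    have h3' : tsupport η ⊆ Ioi 0 := h3.trans fun r hr => hr.1
    set ξ : ℝ → ℝ := fun r => (r ^ N)⁻¹ * η r with hξ
    have hξs : ContDiff ℝ ∞ ξ := contDiff_pow_inv_mul h1 h3' N
    have hξt : tsupport ξ ⊆ tsupport η := tsupport_mul_subset_right
    have hη0 : ∀ r, R + 1 < r → η r = 0 := fun r hr =>
      image_eq_zero_of_notMem_tsupport fun h' => absurd (h3 h').2 (not_lt.2 hr.le)
    have hφ : ∀ i : Fin N, IsTestFunction univ
        (fun x : EuclideanSpace ℝ (Fin N) => ξ ‖x‖ * x i) := by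
      intro i
      refine ⟨(contDiff_radial hξs (eventually_zero_of_tsupport (hξt.trans h3'))).mul (by fun_prop),
        ?_, subset_univ _⟩
      have hcs := hasCompactSupport_radial (N := N) (ξ := ξ) (R := R + 1) fun r hr => by
        rw [hξ]
        simp only [hη0 r hr, mul_zero]
      exact hcs.mul_right
    have e := Finset.sum_congr rfl fun i (_ : i ∈ Finset.univ) =>
      hu.integral_mul_classicalPartial (hφ i) i
    rw [Finset.sum_neg_distrib, hμ] at e
    have i1 : ∀ i, Integrable (fun x => u x * classicalPartial i
        (fun x : EuclideanSpace ℝ (Fin N) => ξ ‖x‖ * x i) x) (volume.restrict (annulus N R₀ R)) := by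
      intro i
      obtain ⟨C, hC⟩ := ((hφ i).classicalPartial i).1.continuous.bounded_above_of_compact_support
        ((hφ i).classicalPartial i).2.1
      exact Integrable.mul_bdd (c := C) hui
        ((hφ i).classicalPartial i).1.continuous.aestronglyMeasurable (Eventually.of_forall hC)
    have i2 : ∀ i, Integrable (fun x => weakPartial Ω i u x *
        (ξ ‖x‖ * x i)) (volume.restrict (annulus N R₀ R)) := by
      intro i
      obtain ⟨C, hC⟩ := (hφ i).1.continuous.bounded_above_of_compact_support (hφ i).2.1
      exact Integrable.mul_bdd (c := C) (hDi i)
        (hφ i).1.continuous.aestronglyMeasurable (Eventually.of_forall hC)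
    rw [← integral_finsetSum _ fun i _ => i1 i, ← integral_finsetSum _ fun i _ => i2 i] at e
    have hdξ : ∀ r : ℝ, 0 < r → deriv ξ r * r + N * ξ r = (r ^ (N - 1))⁻¹ * deriv η r :=
      fun r hr => deriv_pow_inv_mul hN h1 hr
    have e1 : ∫ x in annulus N R₀ R, ∑ i, u x * classicalPartial i
        (fun x : EuclideanSpace ℝ (Fin N) => ξ ‖x‖ * x i) x =
        ∫ x in annulus N R₀ R, V₀ ‖x‖ * ((‖x‖ ^ (N - 1))⁻¹ * deriv η ‖x‖) := by
      rw [hμ] at hV₀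
      refine integral_congr_ae ?_
      filter_upwards [hV₀, ae_restrict_mem (measurableSet_annulus N R₀ R)] with x hx hxA
      have hn : 0 < ‖x‖ := hR₀.trans_lt hxA.1
      rw [← Finset.mul_sum, sum_classicalPartial_radial_field hξs (norm_pos_iff.1 hn), hx, hdξ _ hn]
    have e2 : ∫ x in annulus N R₀ R, ∑ i, weakPartial Ω i u x * (ξ ‖x‖ * x i) =
        ∫ x in annulus N R₀ R, G ‖x‖ * ((‖x‖ ^ (N - 1))⁻¹ * η ‖x‖) := by
      have hm : ContDiff ℝ ∞ (fun r => (r ^ (N - 1))⁻¹ * η r) := contDiff_pow_inv_mul h1 h3' _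
      have hcs : HasCompactSupport (fun r => (r ^ (N - 1))⁻¹ * η r) := h2.mul_left
      obtain ⟨C, hC⟩ := hm.continuous.bounded_above_of_compact_support hcs
      rw [← hG _ hm.continuous.measurable ⟨C, fun r _ => hC r⟩]
      refine setIntegral_congr_fun (measurableSet_annulus N R₀ R) fun x hxA => ?_
      have hn : ‖x‖ ≠ 0 := (hR₀.trans_lt hxA.1).ne'
      simp only [hg, Finset.sum_mul, hξ]
      refine Finset.sum_congr rfl fun i _ => ?_
      have hpow : ‖x‖ ^ N = ‖x‖ ^ (N - 1) * ‖x‖ := by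
        rw [← pow_succ, Nat.sub_add_cancel hN]
      rw [hpow]
      have := pow_ne_zero (N - 1) hn
      field_simp
    rw [e1, e2, integral_annulus_radial hN hR₀ (fun r => V₀ r * ((r ^ (N - 1))⁻¹ * deriv η r)),
      integral_annulus_radial hN hR₀ (fun r => G r * ((r ^ (N - 1))⁻¹ * η r)), ← mul_neg] at e
    have e' := mul_left_cancel₀ hS.ne' e
    have R1le : R ≤ R + 1 := by linarith
    rw [integral_indicator_mul_eq hR₀ R1le (N - 1), integral_indicator_mul_eq hR₀ R1le (N - 1)]
    exact e'
  have hR1 : (0 : ℝ) < R + 1 := by linarith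
  obtain ⟨V, hVac, hVae⟩ := exists_locAC_of_weak_deriv hR1
    (locallyIntegrableOn_of_pow_mul le_rfl hV1) (locallyIntegrableOn_of_pow_mul le_rfl hG1) weak
  -- The continuous representative of the zero extension vanishes outside `[R₀,R]`, hence by
  -- continuity at `R` and, if `R₀ > 0`, at `R₀`.
  have hVR : ∀ r ∈ Ioo R (R + 1), V r = 0 := by
    refine hVac.eq_zero_of_ae (Ioo_subset_Ioo (hR₀.trans hR.le) le_rfl) ?_
    filter_upwards [hVae] with r hr hm
    rw [← hr ⟨(hR₀.trans_lt hR).trans hm.1, hm.2⟩, indicator_of_notMem fun h' => lt_asymm h'.2 hm.1]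
  have hRmem : R ∈ Ioo 0 (R + 1) := ⟨hR₀.trans_lt hR, by linarith⟩
  have hVR0 : V R = 0 := by
    have hc : ContinuousAt V R := hVac.continuousOn.continuousAt (isOpen_Ioo.mem_nhds hRmem)
    have h1 : Tendsto V (𝓝[>] R) (𝓝 (V R)) := hc.tendsto.mono_left nhdsWithin_le_nhds
    have h2 : Tendsto V (𝓝[>] R) (𝓝 0) := by
      refine tendsto_const_nhds.congr' ?_
      filter_upwards [Ioo_mem_nhdsGT (show R < R + 1 by linarith)] with r hr using (hVR r hr).symm
    exact tendsto_nhds_unique h1 h2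
  have hVR₀ : 0 < R₀ → V R₀ = 0 := by
    intro h0
    have hz : ∀ r ∈ Ioo 0 R₀, V r = 0 := by
      refine hVac.eq_zero_of_ae (Ioo_subset_Ioo le_rfl (by linarith)) ?_
      filter_upwards [hVae] with r hr hm
      rw [← hr ⟨hm.1, by linarith [hm.2]⟩, indicator_of_notMem fun h' => lt_asymm h'.1 hm.2]
    have hc : ContinuousAt V R₀ :=
      hVac.continuousOn.continuousAt (isOpen_Ioo.mem_nhds ⟨h0, by linarith⟩)
    have h1 : Tendsto V (𝓝[<] R₀) (𝓝 (V R₀)) := hc.tendsto.mono_left nhdsWithin_le_nhds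
    have h2 : Tendsto V (𝓝[<] R₀) (𝓝 0) := by
      refine tendsto_const_nhds.congr' ?_
      filter_upwards [Ioo_mem_nhdsLT h0] with r hr using (hz r hr).symm
    exact tendsto_nhds_unique h1 h2
  have hDir : IsDirichletPrimitive V ((Ioo R₀ R).indicator G) R₀ R := by
    refine ⟨fun r hr => ?_, fun h0 => ?_⟩
    · have hrm : r ∈ Ioo 0 (R + 1) := ⟨hR₀.trans_lt hr.1, by linarith [hr.2]⟩
      refine ⟨hVac.intervalIntegrable hrm hRmem, ?_⟩
      rw [hVac.integral_eq hrm hRmem, hVR0]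
      ring
    · have hrm : R₀ ∈ Ioo 0 (R + 1) := ⟨h0, by linarith⟩
      refine ⟨hVac.intervalIntegrable hrm hRmem, ?_⟩
      rw [hVac.integral_eq hrm hRmem, hVR0, hVR₀ h0, sub_zero]
  have hind : ∀ᵐ r, r ∈ Ioo R₀ R → (Ioo R₀ R).indicator G r = G r :=
    Eventually.of_forall fun r hr => indicator_of_mem hr _
  have hVac' : LocAC V G R₀ R :=
    (hVac.mono (Ioo_subset_Ioo hR₀ (by linarith))).congr_deriv hind
  have huV : ∀ᵐ x ∂(volume.restrict Ω), u x = V ‖x‖ := by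
    have h1 : ∀ᵐ x ∂(volume.restrict (annulus N R₀ R)), V₀ ‖x‖ = V ‖x‖ := by
      refine ae_annulus_of_ae hN hR₀ (p := fun r => V₀ r = V r) ?_
      filter_upwards [hVae] with r hr hm
      rw [← hr ⟨hR₀.trans_lt hm.1, by linarith [hm.2]⟩, indicator_of_mem hm]
    rw [← hμ] at h1
    filter_upwards [h1, hV₀] with x hx hx' using hx'.trans hx
  refine ⟨V, G, hVac', hDir.congr hR hind, hGi, huV, fun i => ?_⟩
  -- Uniqueness of weak derivatives shows that the whole gradient, not only its radial component, is
  -- `G x/|x|`.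
  have h1 := HasWeakPartial.of_radial hN hR₀ hVac' i
  have h2 := (hu.1.2 i).1.mono hsub
  have h3 := (h2.congr (v := fun x => V ‖x‖) (by rw [← hμ]; exact huV) (EventuallyEq.refl _ _)).unique
    (isOpen_annulus N R₀ R) h1
  rw [hμ]
  exact h3

/-- Regularity of radial functions in `H² ∩ H¹₀`. -/
theorem exists_profile_of_memHr (hN : 1 ≤ N) (hR₀ : 0 ≤ R₀) (hR : R₀ < R)
    (hsub : annulus N R₀ R ⊆ Ω) (hae : Ω =ᵐ[volume] annulus N R₀ R) (hu : MemHr Ω u) :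
    ∃ V w q : ℝ → ℝ, (∀ r ∈ Ioo R₀ R, HasDerivAt V (w r) r) ∧ LocAC w q R₀ R ∧
      IsDirichletPrimitive V w R₀ R ∧ (∀ᵐ x ∂(volume.restrict Ω), u x = V ‖x‖) ∧
      (∀ i, weakPartial Ω i u =ᵐ[volume.restrict Ω] fun x => w ‖x‖ * (x i / ‖x‖)) ∧
      ∀ i j, weakPartial Ω j (weakPartial Ω i u) =ᵐ[volume.restrict Ω] radialHessian w q i j := by
  have hμ : volume.restrict Ω = volume.restrict (annulus N R₀ R) := Measure.restrict_congr_set hae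
  obtain ⟨hH2, hH10, hrad⟩ := hu
  obtain ⟨V, G, hVG, hDir, hGi, huV, hD⟩ :=
    exists_profile_of_memH1Zero hN hR₀ hR hsub hae hH10 hrad
  have hS := sphereArea_pos hN
  have hLi' : ∀ i, IntegrableOn (weakPartial Ω i (weakPartial Ω i u)) (annulus N R₀ R) := by
    intro i
    have := ((hH2.2 i).2 i).2
    rw [hμ] at this
    exact this.integrable (by norm_num)
  have hLi : IntegrableOn (weakLaplacian Ω u) (annulus N R₀ R) :=
    integrable_finsetSum _ fun i _ => hLi' i
  obtain ⟨F, hFi, hF⟩ := exists_radial_average hLi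
  have hG1 := (integrableOn_annulus_radial hN hR₀ G).1 hGi
  have hF1 := (integrableOn_annulus_radial hN hR₀ F).1 hFi
  -- Testing the Laplacian with `η(|x|)` gives `(r^(N-1) G)' = r^(N-1) F` weakly, where `F` is the
  -- spherical mean of the Laplacian.
  have weak : ∀ η : ℝ → ℝ, ContDiff ℝ ∞ η → HasCompactSupport η → tsupport η ⊆ Ioo R₀ R →
      ∫ r in Ioo R₀ R, (r ^ (N - 1) * G r) * deriv η r =
        -∫ r in Ioo R₀ R, (r ^ (N - 1) * F r) * η r := by
    intro η h1 h2 h3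
    have h3' : tsupport η ⊆ Ioi 0 := h3.trans fun r hr => hR₀.trans_lt hr.1
    have hη0 : ∀ r, R < r → η r = 0 := fun r hr =>
      image_eq_zero_of_notMem_tsupport fun h' => absurd (h3 h').2 (not_lt.2 hr.le)
    have hφA : IsTestFunction (annulus N R₀ R) (fun x : EuclideanSpace ℝ (Fin N) => η ‖x‖) :=
      ⟨contDiff_radial h1 (eventually_zero_of_tsupport h3'), hasCompactSupport_radial hη0,
        (tsupport_radial_subset η).trans (preimage_mono h3)⟩
    have hφ := hφA.mono hsub
    have e := Finset.sum_congr rfl fun i (_ : i ∈ Finset.univ) => ((hH2.2 i).2 i).1.2.2 _ hφ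
    rw [Finset.sum_neg_distrib, hμ] at e
    have i1 : ∀ i, Integrable (fun x => weakPartial Ω i u x * classicalPartial i
        (fun x : EuclideanSpace ℝ (Fin N) => η ‖x‖) x) (volume.restrict (annulus N R₀ R)) :=
      fun i => ((hφ.classicalPartial i).integrable_mul (hH2.1.2 i).1.2.1).integrableOn
    have i2 : ∀ i, Integrable (fun x => weakPartial Ω i (weakPartial Ω i u) x *
        η ‖x‖) (volume.restrict (annulus N R₀ R)) :=
      fun i => (hφ.integrable_mul ((hH2.2 i).2 i).1.2.1).integrableOn
    rw [← integral_finsetSum _ fun i _ => i1 i, ← integral_finsetSum _ fun i _ => i2 i] at e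
    have e1 : ∫ x in annulus N R₀ R, ∑ i, weakPartial Ω i u x * classicalPartial i
        (fun x : EuclideanSpace ℝ (Fin N) => η ‖x‖) x =
        ∫ x in annulus N R₀ R, G ‖x‖ * deriv η ‖x‖ := by
      refine integral_congr_ae ?_
      have hD' : ∀ᵐ x ∂(volume.restrict (annulus N R₀ R)), ∀ i,
          weakPartial Ω i u x = G ‖x‖ * (x i / ‖x‖) := by
        rw [← hμ, ae_all_iff]
        exact hD
      filter_upwards [hD', ae_restrict_mem (measurableSet_annulus N R₀ R)] with x hx hxA
      have hx0 : x ≠ 0 := norm_pos_iff.1 (hR₀.trans_lt hxA.1)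
      have hd : HasDerivAt η (deriv η ‖x‖) ‖x‖ := (h1.differentiable (by simp) _).hasDerivAt
      have : ∀ i, weakPartial Ω i u x * classicalPartial i
          (fun x : EuclideanSpace ℝ (Fin N) => η ‖x‖) x =
          G ‖x‖ * deriv η ‖x‖ * (x i / ‖x‖) ^ 2 := fun i => by
        rw [hx i, classicalPartial_radial hx0 hd]
        ring
      simp only [this]
      rw [← Finset.mul_sum, sum_coord_div_norm_sq hx0, mul_one]
    have e2 : ∫ x in annulus N R₀ R, ∑ i, weakPartial Ω i (weakPartial Ω i u) x * η ‖x‖ =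
        ∫ x in annulus N R₀ R, F ‖x‖ * η ‖x‖ := by
      obtain ⟨C, hC⟩ := h1.continuous.bounded_above_of_compact_support h2
      rw [← hF _ h1.continuous.measurable ⟨C, fun r _ => hC r⟩]
      simp only [weakLaplacian, Finset.sum_mul]
    rw [e1, e2, integral_annulus_radial hN hR₀ (fun r => G r * deriv η r),
      integral_annulus_radial hN hR₀ (fun r => F r * η r), ← mul_neg] at e
    simpa only [mul_assoc] using mul_left_cancel₀ hS.ne' e
  obtain ⟨P, hP, hPae⟩ := exists_locAC_of_weak_deriv hR hG1.locallyIntegrableOn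
    hF1.locallyIntegrableOn weak
  obtain ⟨q, hq⟩ := hP.div_pow hR₀ (N - 1)
  -- The absolutely continuous representative of `G`. As it is continuous, the profile `V` is `C¹`.
  set w : ℝ → ℝ := fun r => (r ^ (N - 1))⁻¹ * P r with hw
  have hwG : ∀ᵐ r, r ∈ Ioo R₀ R → G r = w r := by
    filter_upwards [hPae] with r hr hm
    have := pow_ne_zero (N - 1) (hR₀.trans_lt hm.1).ne'
    simp only [hw]
    rw [← hr hm]
    field_simp
  have hVw := hVG.congr_deriv hwG
  have hDw : ∀ i, weakPartial Ω i u =ᵐ[volume.restrict Ω] fun x => w ‖x‖ * (x i / ‖x‖) := by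
    intro i
    have h1 := ae_annulus_of_ae hN hR₀ (p := fun r => G r = w r) hwG
    rw [← hμ] at h1
    filter_upwards [h1, hD i] with x hx hx'
    rw [hx', hx]
  refine ⟨V, w, q, fun r hr => hVw.hasDerivAt hq.continuousOn hr, hq, hDir.congr hR hwG, huV, hDw,
    fun i j => ?_⟩
  have h1 := hasWeakPartial_radialHessian hN hR₀ hq i j
  have h2 := ((hH2.2 i).2 j).1.mono hsub
  have h3 := (h2.congr (v := fun x => w ‖x‖ * (x i / ‖x‖)) (by rw [← hμ]; exact hDw i)
    (EventuallyEq.refl _ _)).unique (isOpen_annulus N R₀ R) h1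
  rw [hμ]
  exact h3

end Regularity

/-! ### A radial Poincaré inequality and density of test functions. -/

theorem MeasureTheory.MemLp.eLpNorm_two_eq {α : Type*} [MeasurableSpace α] {μ : Measure α}
    {f : α → ℝ} (hf : MemLp f 2 μ) : eLpNorm f 2 μ = ENNReal.ofReal (√(∫ x, f x ^ 2 ∂μ)) := by
  rw [hf.eLpNorm_eq_integral_rpow_norm (by norm_num) (by norm_num)]
  simp [Real.sqrt_eq_rpow]

theorem sq_intervalIntegral_le {a b : ℝ} (hab : a < b) {f : ℝ → ℝ}
    (hf : IntervalIntegrable f volume a b) (hf2 : IntervalIntegrable (fun r => f r ^ 2) volume a b) :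
    (∫ r in a..b, f r) ^ 2 ≤ (b - a) * ∫ r in a..b, f r ^ 2 := by
  set I := ∫ r in a..b, f r with hI
  have hba : 0 < b - a := by linarith
  have h0 : 0 ≤ ∫ r in a..b, (f r - I / (b - a)) ^ 2 :=
    intervalIntegral.integral_nonneg hab.le fun r _ => sq_nonneg _
  have h1 : ∫ r in a..b, (f r - I / (b - a)) ^ 2 =
      (∫ r in a..b, f r ^ 2) - 2 * (I / (b - a)) * I + (b - a) * (I / (b - a)) ^ 2 := by
    have : ∀ r, (f r - I / (b - a)) ^ 2 = f r ^ 2 - 2 * (I / (b - a)) * f r + (I / (b - a)) ^ 2 :=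
      fun r => by ring
    simp only [this]
    rw [intervalIntegral.integral_add (hf2.sub (hf.const_mul _)) intervalIntegrable_const,
      intervalIntegral.integral_sub hf2 (hf.const_mul _), intervalIntegral.integral_const_mul,
      intervalIntegral.integral_const, smul_eq_mul, hI]
  rw [h1] at h0
  have h2 : (∫ r in a..b, f r ^ 2) - 2 * (I / (b - a)) * I + (b - a) * (I / (b - a)) ^ 2 =
      (∫ r in a..b, f r ^ 2) - I ^ 2 / (b - a) := by
    field_simp
    ring
  rw [h2, sub_nonneg, div_le_iff₀ hba] at h0
  linarith

section Approximation

variable {N : ℕ} {R₀ R : ℝ}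

theorem integrableOn_sq_of_memLp (hN : 1 ≤ N) (hR₀ : 0 ≤ R₀) {g : ℝ → ℝ}
    (hg : MemLp (fun x : EuclideanSpace ℝ (Fin N) => g ‖x‖) 2
      (volume.restrict (annulus N R₀ R))) :
    IntegrableOn (fun r => r ^ (N - 1) * g r ^ 2) (Ioo R₀ R) :=
  (integrableOn_annulus_radial hN hR₀ (fun r => g r ^ 2)).1 hg.integrable_sq

theorem intervalIntegrable_of_pow_mul {n : ℕ} {r : ℝ} {f : ℝ → ℝ} (hr0 : 0 < r) (hr : R₀ ≤ r)
    (hrR : r ≤ R) (h : IntegrableOn (fun r => r ^ n * f r) (Ioo R₀ R)) :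
    IntervalIntegrable f volume r R := by
  rw [intervalIntegrable_iff_integrableOn_Ioo_of_le hrR]
  have h1 : IntegrableOn (fun r => r ^ n * f r) (Ioo r R) := h.mono_set (Ioo_subset_Ioo hr le_rfl)
  have h2 : IntegrableOn (fun r => (r ^ n)⁻¹ * (r ^ n * f r)) (Ioo r R) := by
    refine IntegrableOn.continuousOn_mul_of_subset (K := Icc r R) ?_ h1 isCompact_Icc measurableSet_Ioo Ioo_subset_Icc_self
    refine ContinuousOn.inv₀ (by fun_prop) fun s hs => ?_
    exact pow_ne_zero _ (hr0.trans_le hs.1).ne'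
  refine h2.congr_fun (fun s hs => ?_) measurableSet_Ioo
  have : s ^ n ≠ 0 := pow_ne_zero _ (hr0.trans hs.1).ne'
  field_simp

/-- Poincaré's inequality for radial functions vanishing on the outer boundary. -/
theorem poincare_radial (hN : 1 ≤ N) (hR₀ : 0 ≤ R₀) (hR : R₀ < R) {D g : ℝ → ℝ}
    (hDc : ContinuousOn D (Ioo R₀ R))
    (hD : ∀ r ∈ Ioo R₀ R, IntervalIntegrable g volume r R ∧ D r = -∫ t in r..R, g t)
    (hg : MemLp (fun x : EuclideanSpace ℝ (Fin N) => g ‖x‖) 2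
      (volume.restrict (annulus N R₀ R))) :
    MemLp (fun x : EuclideanSpace ℝ (Fin N) => D ‖x‖) 2 (volume.restrict (annulus N R₀ R)) ∧
    eLpNorm (fun x : EuclideanSpace ℝ (Fin N) => D ‖x‖) 2 (volume.restrict (annulus N R₀ R)) ≤
      ENNReal.ofReal R * eLpNorm (fun x : EuclideanSpace ℝ (Fin N) => g ‖x‖) 2
        (volume.restrict (annulus N R₀ R)) := by
  have hS := sphereArea_pos hN
  have hg2 := integrableOn_sq_of_memLp hN hR₀ hg
  set I := ∫ r in Ioo R₀ R, r ^ (N - 1) * g r ^ 2 with hI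
  have hI0 : 0 ≤ I := setIntegral_nonneg measurableSet_Ioo fun r hr =>
    mul_nonneg (pow_nonneg (hR₀.trans hr.1.le) _) (sq_nonneg _)
  have hR' : 0 ≤ R := hR₀.trans hR.le
  -- Cauchy-Schwarz on `(r,R)`, where the weight at `r` is at most the weight at each `t > r`. The
  -- bound is pointwise and also holds when `R₀ = 0`.
  have hpt : ∀ r ∈ Ioo R₀ R, r ^ (N - 1) * D r ^ 2 ≤ R * I := by
    intro r hr
    have hr0 : 0 < r := hR₀.trans_lt hr.1
    obtain ⟨h1, h2⟩ := hD r hr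
    have h3 := intervalIntegrable_of_pow_mul hr0 hr.1.le hr.2.le hg2
    have h4 := sq_intervalIntegral_le hr.2 h1 h3
    have h5 : r ^ (N - 1) * ∫ t in r..R, g t ^ 2 ≤ I := by
      rw [← intervalIntegral.integral_const_mul, intervalIntegral.integral_of_le hr.2.le,
        integral_Ioc_eq_integral_Ioo]
      have hi : IntegrableOn (fun t => r ^ (N - 1) * g t ^ 2) (Ioo r R) :=
        ((intervalIntegrable_iff_integrableOn_Ioo_of_le hr.2.le).1 h3).const_mul _
      refine (setIntegral_mono_on hi (hg2.mono_set (Ioo_subset_Ioo hr.1.le le_rfl))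
        measurableSet_Ioo fun t ht => ?_).trans ?_
      · exact mul_le_mul_of_nonneg_right (pow_le_pow_left₀ hr0.le ht.1.le _) (sq_nonneg _)
      · refine setIntegral_mono_set hg2 ?_ (Ioo_subset_Ioo hr.1.le le_rfl).eventuallyLE
        filter_upwards [ae_restrict_mem measurableSet_Ioo] with t ht
        exact mul_nonneg (pow_nonneg (hR₀.trans ht.1.le) _) (sq_nonneg _)
    calc r ^ (N - 1) * D r ^ 2 = r ^ (N - 1) * (∫ t in r..R, g t) ^ 2 := by rw [h2]; ring
      _ ≤ r ^ (N - 1) * ((R - r) * ∫ t in r..R, g t ^ 2) :=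
        mul_le_mul_of_nonneg_left h4 (pow_nonneg hr0.le _)
      _ = (R - r) * (r ^ (N - 1) * ∫ t in r..R, g t ^ 2) := by ring
      _ ≤ (R - r) * I := mul_le_mul_of_nonneg_left h5 (by linarith [hr.2])
      _ ≤ R * I := mul_le_mul_of_nonneg_right (by linarith) hI0
  have hDm := aestronglyMeasurable_annulus_radial hN hR₀ (hDc.aestronglyMeasurable measurableSet_Ioo
    (μ := volume))
  have hDi : IntegrableOn (fun r => r ^ (N - 1) * D r ^ 2) (Ioo R₀ R) := by
    refine Integrable.of_bound ?_ (R * I) ?_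
    · exact ((continuousOn_pow (N - 1)).mul (hDc.pow 2)).aestronglyMeasurable measurableSet_Ioo
    · filter_upwards [ae_restrict_mem measurableSet_Ioo] with r hr
      rw [Real.norm_eq_abs, abs_of_nonneg (mul_nonneg (pow_nonneg (hR₀.trans hr.1.le) _)
        (sq_nonneg _))]
      exact hpt r hr
  have hmem : MemLp (fun x : EuclideanSpace ℝ (Fin N) => D ‖x‖) 2
      (volume.restrict (annulus N R₀ R)) :=
    (memLp_two_iff_integrable_sq hDm).2
      ((integrableOn_annulus_radial hN hR₀ (fun r => D r ^ 2)).2 hDi)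
  refine ⟨hmem, ?_⟩
  rw [hmem.eLpNorm_two_eq, hg.eLpNorm_two_eq, ← ENNReal.ofReal_mul hR']
  refine ENNReal.ofReal_le_ofReal ?_
  rw [integral_annulus_radial hN hR₀ (fun r => D r ^ 2),
    integral_annulus_radial hN hR₀ (fun r => g r ^ 2), ← hI,
    Real.sqrt_le_left (mul_nonneg hR' (Real.sqrt_nonneg _)), mul_pow,
    Real.sq_sqrt (mul_nonneg hS.le hI0)]
  have hle : ∫ r in Ioo R₀ R, r ^ (N - 1) * D r ^ 2 ≤ (R - R₀) * (R * I) := by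
    refine (setIntegral_mono_on (g := fun _ => R * I) hDi (integrable_const _) measurableSet_Ioo hpt).trans ?_
    simp [hR.le]
  have h2 : (R - R₀) * (R * I) ≤ R * (R * I) :=
    mul_le_mul_of_nonneg_right (by linarith) (mul_nonneg hR' hI0)
  nlinarith [mul_le_mul_of_nonneg_left (hle.trans h2) hS.le]

/-- Density of test functions on `(R₀,R)` in the weighted space `L²(r^{N-1} dr)`. -/
theorem exists_test_approx {h : ℝ → ℝ}
    (hc : ContinuousOn h (Ioo R₀ R))
    (hh : MemLp (fun x : EuclideanSpace ℝ (Fin N) => h ‖x‖) 2 (volume.restrict (annulus N R₀ R)))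
    {ε : ℝ} (hε : 0 < ε) :
    ∃ k : ℝ → ℝ, ContDiff ℝ ∞ k ∧ HasCompactSupport k ∧ tsupport k ⊆ Ioo R₀ R ∧
      eLpNorm (fun x : EuclideanSpace ℝ (Fin N) => h ‖x‖ - k ‖x‖) 2
        (volume.restrict (annulus N R₀ R)) ≤ ENNReal.ofReal ε := by
  set μ := (volume : Measure (EuclideanSpace ℝ (Fin N))).restrict (annulus N R₀ R) with hμ
  -- Pushing the measure forward by the norm reduces the approximation to a finite measure on the
  -- line.
  set ν : Measure ℝ := μ.map norm with hν
  have hνfin : IsFiniteMeasure ν := Measure.isFiniteMeasure_map _ _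
  have hνr : ν = ((volume : Measure (EuclideanSpace ℝ (Fin N))).map norm).restrict (Ioo R₀ R) := by
    rw [Measure.restrict_map measurable_norm measurableSet_Ioo]
    rfl
  have hmeas : AEStronglyMeasurable h ν := by
    rw [hνr]
    exact hc.aestronglyMeasurable measurableSet_Ioo
  have hhν : MemLp h 2 ν := (memLp_map_measure_iff hmeas measurable_norm.aemeasurable).2 hh
  have hε2 : 0 < ε / 2 := by positivity
  obtain ⟨k₁, hk₁c, hk₁s, hk₁⟩ := hhν.exist_eLpNorm_sub_le (by norm_num) (by norm_num) hε2
  obtain ⟨C, hC⟩ := hk₁s.continuous.bounded_above_of_compact_support hk₁c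
  have hC0 : 0 ≤ C := (norm_nonneg _).trans (hC 0)
  -- Cutoffs that vanish within distance `1/(n+1)` of the ends and equal one at distance at least
  -- `2/(n+1)` from both ends.
  set χ : ℕ → ℝ → ℝ := fun n r => Real.smoothTransition ((n + 1) * (r - R₀) - 1) *
    Real.smoothTransition ((n + 1) * (R - r) - 1) with hχ
  have hχs : ∀ n, ContDiff ℝ ∞ (χ n) := fun n =>
    ((Real.smoothTransition.contDiff (n := ⊤)).comp (by fun_prop)).mul
      ((Real.smoothTransition.contDiff (n := ⊤)).comp (by fun_prop))
  have hχ01 : ∀ n r, 0 ≤ χ n r ∧ χ n r ≤ 1 := fun n r =>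
    ⟨mul_nonneg (Real.smoothTransition.nonneg _) (Real.smoothTransition.nonneg _),
      mul_le_one₀ (Real.smoothTransition.le_one _) (Real.smoothTransition.nonneg _)
        (Real.smoothTransition.le_one _)⟩
  have hχsupp : ∀ n, tsupport (χ n) ⊆ Ioo R₀ R := by
    intro n
    have hn : (0 : ℝ) < n + 1 := by positivity
    have hinv : 0 < 1 / ((n : ℝ) + 1) := by positivity
    refine (closure_minimal (t := Icc (R₀ + 1 / (n + 1)) (R - 1 / (n + 1))) (fun r hr => ?_)
      isClosed_Icc).trans (Icc_subset_Ioo (by linarith) (by linarith))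
    by_contra hcon
    apply hr
    rw [mem_Icc, not_and_or, not_le, not_le] at hcon
    rcases hcon with h' | h'
    · have : ((n : ℝ) + 1) * (r - R₀) - 1 ≤ 0 := by
        have : r - R₀ < 1 / (n + 1) := by linarith
        rw [lt_div_iff₀ hn] at this
        linarith
      simp only [hχ, Real.smoothTransition.zero_of_nonpos this, zero_mul]
    · have : ((n : ℝ) + 1) * (R - r) - 1 ≤ 0 := by
        have : R - r < 1 / (n + 1) := by linarith
        rw [lt_div_iff₀ hn] at this
        linarith
      simp only [hχ, Real.smoothTransition.zero_of_nonpos this, mul_zero]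
  have hd : ∀ n, MemLp (fun r => (1 - χ n r) * k₁ r) 2 ν := fun n =>
    MemLp.of_bound (((contDiff_const.sub (hχs n)).mul hk₁s).continuous.aestronglyMeasurable) C
      (Eventually.of_forall fun r => by
        rw [norm_mul, Real.norm_eq_abs, abs_of_nonneg (by linarith [(hχ01 n r).2])]
        exact (mul_le_of_le_one_left (norm_nonneg _) (by linarith [(hχ01 n r).1])).trans (hC r))
  have hlim : Tendsto (fun n => ∫ r, ((1 - χ n r) * k₁ r) ^ 2 ∂ν) atTop (𝓝 (∫ _, (0 : ℝ) ∂ν)) := by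
    refine tendsto_integral_of_dominated_convergence (fun _ => C ^ 2)
      (fun n => ((hd n).1.pow 2)) (integrable_const _) (fun n => Eventually.of_forall fun r => ?_) ?_
    · rw [norm_pow]
      refine pow_le_pow_left₀ (norm_nonneg _) ?_ 2
      rw [norm_mul, Real.norm_eq_abs, abs_of_nonneg (by linarith [(hχ01 n r).2])]
      exact (mul_le_of_le_one_left (norm_nonneg _) (by linarith [(hχ01 n r).1])).trans (hC r)
    · rw [hνr]
      filter_upwards [ae_restrict_mem measurableSet_Ioo] with r hr
      refine tendsto_const_nhds.congr' ?_
      obtain ⟨n₀, hn₀⟩ := exists_nat_gt (2 / min (r - R₀) (R - r))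
      have hmin : 0 < min (r - R₀) (R - r) := lt_min (by linarith [hr.1]) (by linarith [hr.2])
      filter_upwards [eventually_ge_atTop n₀] with n hn
      have hn' : (n₀ : ℝ) ≤ n := by exact_mod_cast hn
      rw [div_lt_iff₀ hmin] at hn₀
      have hkey : 2 ≤ ((n : ℝ) + 1) * min (r - R₀) (R - r) := by nlinarith
      have h1 : 1 ≤ ((n : ℝ) + 1) * (r - R₀) - 1 := by
        have := mul_le_mul_of_nonneg_left (min_le_left (r - R₀) (R - r))
          (by positivity : (0 : ℝ) ≤ n + 1)
        linarith
      have h2 : 1 ≤ ((n : ℝ) + 1) * (R - r) - 1 := by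
        have := mul_le_mul_of_nonneg_left (min_le_right (r - R₀) (R - r))
          (by positivity : (0 : ℝ) ≤ n + 1)
        linarith
      simp [hχ, Real.smoothTransition.one_of_one_le h1, Real.smoothTransition.one_of_one_le h2]
  simp only [integral_zero] at hlim
  obtain ⟨n, hn⟩ := (hlim.eventually (gt_mem_nhds (show (0 : ℝ) < (ε / 2) ^ 2 by positivity))).exists
  refine ⟨fun r => χ n r * k₁ r, (hχs n).mul hk₁s, hk₁c.mul_left,
    (tsupport_mul_subset_left).trans (hχsupp n), ?_⟩
  have hk₁ν : MemLp k₁ 2 ν := hk₁s.continuous.memLp_of_hasCompactSupport hk₁c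
  have hfin : eLpNorm (fun r => h r - χ n r * k₁ r) 2 ν ≤ ENNReal.ofReal ε := by
    have e : (fun r => h r - χ n r * k₁ r) = (h - k₁) + fun r => (1 - χ n r) * k₁ r := by
      ext r
      simp only [Pi.add_apply, Pi.sub_apply]
      ring
    rw [e]
    refine (eLpNorm_add_le (hhν.sub hk₁ν).1 (hd n).1 (by norm_num)).trans ?_
    rw [show ε = ε / 2 + ε / 2 by ring, ENNReal.ofReal_add hε2.le hε2.le]
    refine add_le_add hk₁ ?_
    rw [(hd n).eLpNorm_two_eq]
    exact ENNReal.ofReal_le_ofReal ((Real.sqrt_le_left hε2.le).2 hn.le)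
  have hm : AEStronglyMeasurable (fun r => h r - χ n r * k₁ r) ν :=
    hhν.1.sub ((hχs n).mul hk₁s).continuous.aestronglyMeasurable
  rw [eLpNorm_map_measure hm measurable_norm.aemeasurable] at hfin
  exact hfin

end Approximation

/-! ### From profiles back to functions in `H_r`. -/

section Membership

variable {N : ℕ} {R₀ R : ℝ} {Ω : Set (EuclideanSpace ℝ (Fin N))}

theorem memLp_two_radial_of_continuous {k : ℝ → ℝ} (hk : Continuous k) (hc : HasCompactSupport k)
    (p : ℝ≥0∞) :
    MemLp (fun x : EuclideanSpace ℝ (Fin N) => k ‖x‖) p (volume.restrict (annulus N R₀ R)) := by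
  obtain ⟨C, hC⟩ := hk.bounded_above_of_compact_support hc
  exact MemLp.of_bound (hk.comp continuous_norm).aestronglyMeasurable C
    (Eventually.of_forall fun x => hC _)

/-- Density of test functions with vanishing mean. -/
theorem exists_test_approx_zero_mean (hN : 1 ≤ N) (hR₀ : 0 < R₀) (hR : R₀ < R) {h : ℝ → ℝ}
    (hc : ContinuousOn h (Ioo R₀ R))
    (hh : MemLp (fun x : EuclideanSpace ℝ (Fin N) => h ‖x‖) 2 (volume.restrict (annulus N R₀ R)))
    (hi : IntervalIntegrable h volume R₀ R) (h0 : ∫ r in R₀..R, h r = 0) {ε : ℝ} (hε : 0 < ε) :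
    ∃ k : ℝ → ℝ, ContDiff ℝ ∞ k ∧ HasCompactSupport k ∧ tsupport k ⊆ Ioo R₀ R ∧
      ∫ r in R₀..R, k r = 0 ∧
      eLpNorm (fun x : EuclideanSpace ℝ (Fin N) => h ‖x‖ - k ‖x‖) 2
        (volume.restrict (annulus N R₀ R)) ≤ ENNReal.ofReal ε := by
  obtain ⟨c, hcm⟩ := exists_between hR
  obtain ⟨χ, hχs, hχc, hχ, hχr, hχ1⟩ := exists_contDiff_tsupport_subset (n := ⊤)
    (isOpen_Ioo.mem_nhds hcm)
  have hχ' : ContDiff ℝ ∞ χ := hχ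
  have hχpos : 0 < ∫ r in R₀..R, χ r := by
    rw [intervalIntegral.integral_of_le hR.le, integral_Ioc_eq_integral_Ioo,
      setIntegral_eq_integral_of_forall_compl_eq_zero fun r hr =>
      image_eq_zero_of_notMem_tsupport fun h' => hr (hχs h')]
    exact hχ.continuous.integral_pos_of_hasCompactSupport_nonneg_nonzero hχc
      (fun r => (hχr (mem_range_self r)).1) (x := c) (by rw [hχ1]; exact one_ne_zero)
  set m₀ := ∫ r in R₀..R, χ r with hm₀
  have hχL := memLp_two_radial_of_continuous (N := N) (R₀ := R₀) (R := R) hχ.continuous hχc 2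
  set T := (eLpNorm (fun x : EuclideanSpace ℝ (Fin N) => χ ‖x‖) 2
    (volume.restrict (annulus N R₀ R))).toReal with hT
  have hT0 : 0 ≤ T := ENNReal.toReal_nonneg
  have hS := sphereArea_pos hN
  have hpow : 0 < R₀ ^ (N - 1) := pow_pos hR₀ _
  -- By Cauchy-Schwarz `C` bounds the mean over `(R₀,R)` by the weighted `L²` norm; the weight is
  -- bounded below since `R₀ > 0`.
  set C := √((R - R₀) / (sphereArea N * R₀ ^ (N - 1))) with hC
  have hC0 : 0 ≤ C := Real.sqrt_nonneg _
  -- Approximation within `δ` leaves a mean of size at most `Cδ`. Removing it with a multiple of the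
  -- bump `χ` costs at most `CδT/m₀`, and the total is `ε`.
  set δ := ε / (1 + C * T / m₀) with hδ
  have hδ0 : 0 < δ := by positivity
  obtain ⟨k, hk, hkc, hks, hkε⟩ := exists_test_approx hc hh hδ0
  have hkL := memLp_two_radial_of_continuous (N := N) (R₀ := R₀) (R := R) hk.continuous hkc 2
  have hdL : MemLp (fun x : EuclideanSpace ℝ (Fin N) => h ‖x‖ - k ‖x‖) 2
      (volume.restrict (annulus N R₀ R)) := hh.sub hkL
  have hki : IntervalIntegrable k volume R₀ R := hk.continuous.intervalIntegrable _ _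
  set m := ∫ r in R₀..R, k r with hm
  have hmb : |m| ≤ C * δ := by
    have hd2 := integrableOn_sq_of_memLp hN hR₀.le (g := fun r => h r - k r) hdL
    have hdi := intervalIntegrable_of_pow_mul hR₀ le_rfl hR.le hd2
    have h1 := sq_intervalIntegral_le hR (hi.sub hki) hdi
    rw [intervalIntegral.integral_sub hi hki, h0, zero_sub, ← hm, neg_sq] at h1
    have h2 : R₀ ^ (N - 1) * ∫ r in R₀..R, (h r - k r) ^ 2 ≤
        ∫ r in Ioo R₀ R, r ^ (N - 1) * (h r - k r) ^ 2 := by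
      rw [← intervalIntegral.integral_const_mul, intervalIntegral.integral_of_le hR.le,
        integral_Ioc_eq_integral_Ioo]
      have hi' : IntegrableOn (fun t => R₀ ^ (N - 1) * (h t - k t) ^ 2) (Ioo R₀ R) :=
        ((intervalIntegrable_iff_integrableOn_Ioo_of_le hR.le).1 hdi).const_mul _
      refine setIntegral_mono_on hi' hd2 measurableSet_Ioo fun t ht => ?_
      exact mul_le_mul_of_nonneg_right (pow_le_pow_left₀ hR₀.le ht.1.le _) (sq_nonneg _)
    have h3 : ∫ x in annulus N R₀ R, (h ‖x‖ - k ‖x‖) ^ 2 ≤ δ ^ 2 := by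
      rw [hdL.eLpNorm_two_eq, ENNReal.ofReal_le_ofReal_iff hδ0.le,
        Real.sqrt_le_left hδ0.le] at hkε
      exact hkε
    rw [integral_annulus_radial hN hR₀.le (fun r => (h r - k r) ^ 2)] at h3
    refine abs_le_of_sq_le_sq ?_ (by positivity)
    rw [mul_pow, hC, Real.sq_sqrt (div_nonneg (by linarith) (by positivity))]
    have h4 : sphereArea N * (R₀ ^ (N - 1) * ∫ r in R₀..R, (h r - k r) ^ 2) ≤ δ ^ 2 :=
      (mul_le_mul_of_nonneg_left h2 hS.le).trans h3
    rw [div_mul_eq_mul_div, le_div_iff₀ (by positivity)]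
    calc m ^ 2 * (sphereArea N * R₀ ^ (N - 1))
        ≤ ((R - R₀) * ∫ r in R₀..R, (h r - k r) ^ 2) * (sphereArea N * R₀ ^ (N - 1)) :=
          mul_le_mul_of_nonneg_right h1 (by positivity)
      _ = (R - R₀) * (sphereArea N * (R₀ ^ (N - 1) * ∫ r in R₀..R, (h r - k r) ^ 2)) := by ring
      _ ≤ (R - R₀) * δ ^ 2 := mul_le_mul_of_nonneg_left h4 (by linarith)
  refine ⟨fun r => k r - m / m₀ * χ r, hk.sub (contDiff_const.mul hχ'), ?_, ?_, ?_, ?_⟩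
  · exact hkc.sub (hχc.mul_left)
  · refine (closure_minimal (t := tsupport k ∪ tsupport χ) (fun r hr => ?_)
      ((isClosed_tsupport _).union (isClosed_tsupport _))).trans (union_subset hks hχs)
    by_contra hcon
    rw [mem_union, not_or] at hcon
    apply hr
    simp [image_eq_zero_of_notMem_tsupport hcon.1, image_eq_zero_of_notMem_tsupport hcon.2]
  · rw [intervalIntegral.integral_sub hki ((hχ.continuous.intervalIntegrable _ _).const_mul _),
      intervalIntegral.integral_const_mul, ← hm₀, ← hm]
    field_simp
    ring
  · have e : (fun x : EuclideanSpace ℝ (Fin N) => h ‖x‖ - (k ‖x‖ - m / m₀ * χ ‖x‖)) =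
        (fun x => h ‖x‖ - k ‖x‖) + (m / m₀) • fun x => χ ‖x‖ := by
      ext x
      simp only [Pi.add_apply, Pi.smul_apply, smul_eq_mul]
      ring
    have hTe : eLpNorm (fun x : EuclideanSpace ℝ (Fin N) => χ ‖x‖) 2
        (volume.restrict (annulus N R₀ R)) = ENNReal.ofReal T :=
      (ENNReal.ofReal_toReal hχL.eLpNorm_ne_top).symm
    change eLpNorm (fun x : EuclideanSpace ℝ (Fin N) => h ‖x‖ - (k ‖x‖ - m / m₀ * χ ‖x‖)) 2 _ ≤ _
    rw [e]
    refine (eLpNorm_add_le hdL.1 (hχL.1.const_smul _) (by norm_num)).trans ?_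
    rw [eLpNorm_const_smul, hTe, ← ofReal_norm, ← ENNReal.ofReal_mul (norm_nonneg _)]
    refine (add_le_add_left hkε _).trans ?_
    rw [← ENNReal.ofReal_add hδ0.le (by positivity)]
    refine ENNReal.ofReal_le_ofReal ?_
    rw [Real.norm_eq_abs, abs_div, abs_of_pos hχpos]
    have h5 : |m| / m₀ * T ≤ C * δ / m₀ * T := by gcongr
    have h6 : δ + C * δ / m₀ * T = ε := by
      rw [hδ]
      field_simp
    linarith

/-- Approximate the derivative `h` by test functions `k` and integrate inwards from `R`. Gradients
are close by construction, values by the Poincaré inequality. In the annulus `k` has mean zero, so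
its primitive vanishes near `R₀`; in the ball the primitive is constant near the origin, hence
smooth as a radial function. -/
theorem memH1Zero_of_profile (hN : 1 ≤ N) (hR₀ : 0 ≤ R₀) (hR : R₀ < R)
    (hsub : annulus N R₀ R ⊆ Ω) (hae : Ω =ᵐ[volume] annulus N R₀ R)
    (hball : R₀ = 0 → Metric.ball 0 R ⊆ Ω) {Y h : ℝ → ℝ}
    (hY : ContinuousOn Y (Ioo R₀ R)) (hc : ContinuousOn h (Ioo R₀ R))
    (hDir : IsDirichletPrimitive Y h R₀ R)
    (hh : MemLp (fun x : EuclideanSpace ℝ (Fin N) => h ‖x‖) 2 (volume.restrict Ω))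
    (hH1 : MemH1 Ω fun x => Y ‖x‖)
    (hD : ∀ i, weakPartial Ω i (fun x => Y ‖x‖) =ᵐ[volume.restrict Ω]
      fun x => h ‖x‖ * (x i / ‖x‖)) :
    MemH1Zero Ω fun x => Y ‖x‖ := by
  have hμ : volume.restrict Ω = volume.restrict (annulus N R₀ R) := Measure.restrict_congr_set hae
  refine ⟨hH1, ?_⟩
  rw [hμ] at hh
  have hR' : 0 < R := hR₀.trans_lt hR
  have key : ∀ n : ℕ, ∃ φ : EuclideanSpace ℝ (Fin N) → ℝ, IsTestFunction Ω φ ∧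
      eLpNorm (fun x => φ x - Y ‖x‖) 2 (volume.restrict Ω) ≤
        ENNReal.ofReal R * ENNReal.ofReal (1 / (n + 1)) ∧
      ∀ i, eLpNorm (fun x => classicalPartial i φ x - weakPartial Ω i (fun x => Y ‖x‖) x) 2
        (volume.restrict Ω) ≤ ENNReal.ofReal (1 / (n + 1)) := by
    intro n
    have hε : (0 : ℝ) < 1 / (n + 1) := by positivity
    obtain ⟨k, hk, hkc, hks, hk0, hkε⟩ : ∃ k : ℝ → ℝ, ContDiff ℝ ∞ k ∧ HasCompactSupport k ∧
        tsupport k ⊆ Ioo R₀ R ∧ (0 < R₀ → ∫ r in R₀..R, k r = 0) ∧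
        eLpNorm (fun x : EuclideanSpace ℝ (Fin N) => h ‖x‖ - k ‖x‖) 2
          (volume.restrict (annulus N R₀ R)) ≤ ENNReal.ofReal (1 / (n + 1)) := by
      rcases hR₀.eq_or_lt with h0 | h0
      · obtain ⟨k, h1, h2, h3, h4⟩ := exists_test_approx hc hh hε
        exact ⟨k, h1, h2, h3, fun h' => absurd h' (by rw [← h0]; exact lt_irrefl _), h4⟩
      · obtain ⟨k, h1, h2, h3, h4, h5⟩ := exists_test_approx_zero_mean hN h0 hR hc hh
          (hDir.2 h0).1 (hDir.2 h0).2 hε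
        exact ⟨k, h1, h2, h3, fun _ => h4, h5⟩
    obtain ⟨α, hα, β, hβ, hαβ, hs⟩ := exists_Icc_of_tsupport_subset hR hkc hks
    have hα0 : 0 < α := hR₀.trans_lt hα.1
    have hkz : ∀ r ∉ Ioo α β, k r = 0 := fun r hr =>
      image_eq_zero_of_notMem_tsupport fun h' => hr (hs h')
    set Z : ℝ → ℝ := fun r => ∫ t in R..r, k t with hZ
    have hZd : ∀ r, HasDerivAt Z (k r) r := fun r => hasDerivAt_primitive hk.continuous R r
    have hZs : ContDiff ℝ ∞ Z := contDiff_primitive hk R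
    have hii : ∀ a b, IntervalIntegrable k volume a b := fun a b =>
      hk.continuous.intervalIntegrable _ _
    have hzero : ∀ a b : ℝ, (∀ t ∈ uIcc a b, t ∉ Ioo α β) → ∫ t in a..b, k t = 0 := by
      intro a b hab
      rw [intervalIntegral.integral_congr (g := fun _ => 0) fun t ht => hkz t (hab t ht)]
      simp
    have hZα : ∀ r ≤ α, Z r = Z α := by
      intro r hr
      rw [← sub_eq_zero]
      simp only [hZ]
      rw [intervalIntegral.integral_interval_sub_left (hii _ _) (hii _ _)]
      refine hzero _ _ fun t ht ht' => ?_
      rw [uIcc_of_ge hr] at ht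
      exact absurd ht'.1 (not_lt.2 ht.2)
    have hZβ : ∀ r, β ≤ r → Z r = 0 := by
      intro r hr
      refine hzero _ _ fun t ht ht' => ?_
      have := (le_min hβ.2.le hr).trans ht.1
      exact absurd ht'.2 (not_lt.2 this)
    have hφs : ContDiff ℝ ∞ (fun x : EuclideanSpace ℝ (Fin N) => Z ‖x‖) := by
      refine contDiff_radial hZs ?_
      filter_upwards [Iic_mem_nhds hα0] with r hr
      rw [hZα r hr, hZα 0 hα0.le]
    have hφc : HasCompactSupport (fun x : EuclideanSpace ℝ (Fin N) => Z ‖x‖) :=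
      hasCompactSupport_radial fun r hr => hZβ r hr.le
    have hφΩ : tsupport (fun x : EuclideanSpace ℝ (Fin N) => Z ‖x‖) ⊆ Ω := by
      rcases hR₀.eq_or_lt with h0 | h0
      · refine Subset.trans ?_ (hball h0.symm)
        refine (closure_minimal (t := Metric.closedBall 0 β) (fun x hx => ?_)
          Metric.isClosed_closedBall).trans (Metric.closedBall_subset_ball hβ.2)
        by_contra hcon
        exact hx (hZβ _ (le_of_lt (by simpa using hcon)))
      · refine Subset.trans ?_ hsub
        refine (closure_minimal (t := (fun x => ‖x‖) ⁻¹' Icc α β) (fun x hx => ?_)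
          (isClosed_Icc.preimage continuous_norm)).trans (preimage_mono (Icc_subset_Ioo hα.1 hβ.2))
        by_contra hcon
        rw [mem_preimage, mem_Icc, not_and_or, not_le, not_le] at hcon
        apply hx
        rcases hcon with h' | h'
        · change Z ‖x‖ = 0
          rw [hZα _ h'.le, ← hZα R₀ hα.1.le]
          simp only [hZ]
          rw [intervalIntegral.integral_symm, hk0 h0, neg_zero]
        · exact hZβ _ h'.le
    have hkL := memLp_two_radial_of_continuous (N := N) (R₀ := R₀) (R := R) hk.continuous hkc 2
    have hdL : MemLp (fun x : EuclideanSpace ℝ (Fin N) => k ‖x‖ - h ‖x‖) 2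
        (volume.restrict (annulus N R₀ R)) := hkL.sub hh
    have hnorm : eLpNorm (fun x : EuclideanSpace ℝ (Fin N) => k ‖x‖ - h ‖x‖) 2
        (volume.restrict (annulus N R₀ R)) ≤ ENNReal.ofReal (1 / (n + 1)) := by
      refine le_trans (le_of_eq ?_) hkε
      exact eLpNorm_sub_comm (fun x : EuclideanSpace ℝ (Fin N) => k ‖x‖)
        (fun x : EuclideanSpace ℝ (Fin N) => h ‖x‖) _ _
    refine ⟨fun x => Z ‖x‖, ⟨hφs, hφc, hφΩ⟩, ?_, fun i => ?_⟩
    · have hp := poincare_radial hN hR₀ hR (D := fun r => Z r - Y r) (g := fun r => k r - h r)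
        (hZs.continuous.continuousOn.sub hY) (fun r hr => ⟨(hii _ _).sub (hDir.1 r hr).1, by
          rw [intervalIntegral.integral_sub (hii _ _) (hDir.1 r hr).1, (hDir.1 r hr).2]
          simp only [hZ]
          rw [intervalIntegral.integral_symm r R]
          ring⟩) hdL
      rw [hμ]
      refine hp.2.trans ?_
      gcongr
    · have hDi := hD i
      rw [hμ] at hDi ⊢
      refine le_trans (eLpNorm_mono_ae (g := fun x : EuclideanSpace ℝ (Fin N) => k ‖x‖ - h ‖x‖)
        ?_) hnorm
      filter_upwards [hDi, ae_restrict_mem (measurableSet_annulus N R₀ R)] with x hx hxA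
      rw [hx, classicalPartial_radial (norm_pos_iff.1 (hR₀.trans_lt hxA.1)) (hZd _), ← sub_mul,
        norm_mul]
      exact mul_le_of_le_one_right (norm_nonneg _) (abs_coord_div_norm_le x i)
  choose φ h1 h2 h3 using key
  have hlim : Tendsto (fun n : ℕ => ENNReal.ofReal (1 / ((n : ℝ) + 1))) atTop (𝓝 0) := by
    have := ENNReal.tendsto_ofReal tendsto_one_div_add_atTop_nhds_zero_nat
    simpa using this
  refine ⟨φ, h1, ?_, fun i => ?_⟩
  · have hlim2 : Tendsto (fun n : ℕ => ENNReal.ofReal R * ENNReal.ofReal (1 / ((n : ℝ) + 1))) atTop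
        (𝓝 0) := by
      have := ENNReal.Tendsto.const_mul hlim (Or.inr (ENNReal.ofReal_ne_top (r := R)))
      simpa using this
    exact tendsto_of_tendsto_of_tendsto_of_le_of_le tendsto_const_nhds hlim2
      (fun _ => zero_le) h2
  · exact tendsto_of_tendsto_of_tendsto_of_le_of_le tendsto_const_nhds hlim
      (fun _ => zero_le) fun n => h3 n i

/-- A radial function is in `H_r` if its profile has the derivatives and boundary values that
this requires. -/
theorem memHr_of_profile (hN : 1 ≤ N) (hR₀ : 0 ≤ R₀) (hR : R₀ < R) (hΩ : IsOpen Ω)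
    (hsub : annulus N R₀ R ⊆ Ω) (hae : Ω =ᵐ[volume] annulus N R₀ R)
    (hball : R₀ = 0 → Metric.ball 0 R ⊆ Ω) {Y h p : ℝ → ℝ}
    (hY : ContinuousOn Y (Ioo R₀ R)) (hc : ContinuousOn h (Ioo R₀ R))
    (hDir : IsDirichletPrimitive Y h R₀ R)
    (hgrad : ∀ i, HasWeakPartial Ω i (fun x => Y ‖x‖) fun x => h ‖x‖ * (x i / ‖x‖))
    (hhess : ∀ i j, HasWeakPartial Ω j (fun x => h ‖x‖ * (x i / ‖x‖)) (radialHessian h p i j))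
    (hh : MemLp (fun x : EuclideanSpace ℝ (Fin N) => h ‖x‖) 2 (volume.restrict Ω))
    (hp : ∀ i j, MemLp (radialHessian h p i j) 2 (volume.restrict Ω)) :
    MemHr Ω (fun x => Y ‖x‖) ∧
      (∀ i, weakPartial Ω i (fun x => Y ‖x‖) =ᵐ[volume.restrict Ω] fun x => h ‖x‖ * (x i / ‖x‖)) ∧
      ∀ i j, weakPartial Ω j (weakPartial Ω i fun x => Y ‖x‖) =ᵐ[volume.restrict Ω]
        radialHessian h p i j := by
  have hμ : volume.restrict Ω = volume.restrict (annulus N R₀ R) := Measure.restrict_congr_set hae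
  have hD := fun i => (hgrad i).weakPartial_ae_eq hΩ
  have hgL : ∀ i, MemLp (fun x : EuclideanSpace ℝ (Fin N) => h ‖x‖ * (x i / ‖x‖)) 2
      (volume.restrict Ω) := fun i => hh.mono
    (hh.1.mul (measurable_coord_div_norm i).aestronglyMeasurable) (Eventually.of_forall fun x => by
      rw [norm_mul]
      exact mul_le_of_le_one_right (norm_nonneg _) (abs_coord_div_norm_le x i))
  have hDL : ∀ i, MemLp (weakPartial Ω i fun x => Y ‖x‖) 2 (volume.restrict Ω) := fun i =>
    (memLp_congr_ae (hD i)).2 (hgL i)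
  have hYL : MemLp (fun x : EuclideanSpace ℝ (Fin N) => Y ‖x‖) 2 (volume.restrict Ω) := by
    rw [hμ] at hh ⊢
    exact (poincare_radial hN hR₀ hR hY hDir.1 hh).1
  have hhess' : ∀ i j, HasWeakPartial Ω j (weakPartial Ω i fun x => Y ‖x‖) (radialHessian h p i j) :=
    fun i j => (hhess i j).congr (hD i).symm (EventuallyEq.refl _ _)
  have hD2 := fun i j => (hhess' i j).weakPartial_ae_eq hΩ
  have hH1 : MemH1 Ω fun x => Y ‖x‖ := ⟨hYL, fun i => ⟨(hgrad i).weakPartial, hDL i⟩⟩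
  refine ⟨⟨⟨hH1, fun i => ⟨hDL i, fun j => ⟨(hhess' i j).weakPartial, ?_⟩⟩⟩,
    memH1Zero_of_profile hN hR₀ hR hsub hae hball hY hc hDir hh hH1 hD,
    ⟨Y, Eventually.of_forall fun _ => rfl⟩⟩, hD, hD2⟩
  exact (memLp_congr_ae (hD2 i j)).2 (hp i j)

theorem energy_eq_of_profile (hR₀ : 0 ≤ R₀)
    (hae : Ω =ᵐ[volume] annulus N R₀ R) {u : EuclideanSpace ℝ (Fin N) → ℝ} {V w q : ℝ → ℝ}
    (hu : ∀ᵐ x ∂(volume.restrict Ω), u x = V ‖x‖)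
    (hD : ∀ i, weakPartial Ω i u =ᵐ[volume.restrict Ω] fun x => w ‖x‖ * (x i / ‖x‖))
    (hD2 : ∀ i j, weakPartial Ω j (weakPartial Ω i u) =ᵐ[volume.restrict Ω]
      radialHessian w q i j) (β : ℝ) :
    energy β Ω u = ∫ x in annulus N R₀ R, ((q ‖x‖ + (N - 1) * (w ‖x‖ / ‖x‖)) ^ 2 / 2 +
      β * w ‖x‖ ^ 2 / 2 + V ‖x‖ ^ 4 / 4 - V ‖x‖ ^ 2 / 2) := by
  have hμ : volume.restrict Ω = volume.restrict (annulus N R₀ R) := Measure.restrict_congr_set hae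
  unfold energy
  simp only [hμ] at hu hD hD2 ⊢
  refine integral_congr_ae ?_
  have hD' := ae_all_iff.2 hD
  have hD2' := ae_all_iff.2 fun i => hD2 i i
  filter_upwards [hu, hD', hD2', ae_restrict_mem (measurableSet_annulus N R₀ R)] with x h1 h2 h3 hxA
  have hx0 : x ≠ 0 := norm_pos_iff.1 (hR₀.trans_lt hxA.1)
  have e1 : weakLaplacian Ω u x = q ‖x‖ + (N - 1) * (w ‖x‖ / ‖x‖) := by
    rw [weakLaplacian, ← radialLaplacian hx0]
    exact Finset.sum_congr rfl fun i _ => h3 i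
  have e2 : ∑ i, weakPartial Ω i u x ^ 2 = w ‖x‖ ^ 2 := by
    have : ∀ i, weakPartial Ω i u x ^ 2 = w ‖x‖ ^ 2 * (x i / ‖x‖) ^ 2 := fun i => by
      rw [h2 i]
      ring
    simp only [this]
    rw [← Finset.mul_sum, sum_coord_div_norm_sq hx0, mul_one]
  rw [e1, e2, h1]

end Membership

/-! ### Multiplication of a derivative by signs, truncation and reflection. -/

theorem ContinuousOn.pos_or_neg_of_ne_zero {f : ℝ → ℝ} {s : Set ℝ} (hf : ContinuousOn f s)
    (hs : s.OrdConnected) (h0 : ∀ r ∈ s, f r ≠ 0) : (∀ r ∈ s, 0 < f r) ∨ ∀ r ∈ s, f r < 0 := by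
  by_contra! hcon
  obtain ⟨⟨x, hx, hfx⟩, y, hy, hfy⟩ := hcon
  obtain ⟨z, hz, hfz⟩ := hs.isPreconnected.intermediate_value hx hy hf ⟨hfx, hfy⟩
  exact h0 z hz hfz

namespace LocAC

variable {w q : ℝ → ℝ} {p a R : ℝ}

/-- At a zero of `w` the function `|w|` has a minimum, so its derivative there is zero, in agreement
with `sign 0 = 0`. -/
theorem abs_sign (hw : LocAC w q p R) :
    LocAC (fun r => |w r|) (fun r => (SignType.sign (w r) : ℝ) * q r) p R := by
  refine hw.abs.congr_deriv ?_
  filter_upwards [hw.2, hw.abs.2] with r h1 h2 hr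
  by_cases h0 : w r = 0
  · have hmin : IsLocalMin (fun s => |w s|) r :=
      Eventually.of_forall fun s => by simp [h0]
    rw [hmin.deriv_eq_zero, h0]
    simp
  · have := (hasDerivAt_abs h0).comp r (h1 hr)
    exact this.deriv

theorem trunc (hw : LocAC w q p R) (ha : a ∈ Ioo p R) (h0 : w a = 0) :
    LocAC (fun r => if r ≤ a then 0 else w r) (fun r => if r ≤ a then 0 else q r) p R := by
  have e : (fun r => if r ≤ a then 0 else q r) = (Ioi a).indicator q := by
    ext r
    by_cases hr : r ≤ a <;> simp [indicator, hr]
  have hloc : LocallyIntegrableOn (fun r => if r ≤ a then 0 else q r) (Ioo p R) := by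
    rw [e]
    intro x hx
    obtain ⟨s, hs, hi⟩ := hw.locallyIntegrableOn x hx
    exact ⟨s, hs, hi.indicator measurableSet_Ioi⟩
  refine (of_intervalIntegral hloc (c := 0) ha).congr_fun fun r hr => ?_
  simp only [zero_add]
  split_ifs with h
  · refine intervalIntegral.integral_zero_ae (Eventually.of_forall fun x hx => ?_)
    rw [uIoc_of_ge h] at hx
    simp [hx.2]
  · have : ∫ t in a..r, (if t ≤ a then 0 else q t) = ∫ t in a..r, q t := by
      refine intervalIntegral.integral_congr_ae (Eventually.of_forall fun x hx => ?_)
      rw [uIoc_of_le (not_le.1 h).le] at hx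
      simp [not_le.2 hx.1]
    rw [this, hw.integral_eq ha hr, h0, sub_zero]

/-- The factor jumps only at zeros of `w`, so the product has no jumps and its derivative is the
factor times `q`. The alternative `a = p` stands for no truncation. -/
theorem trunc_abs (hw : LocAC w q p R) (ha : a = p ∨ a ∈ Ioo p R ∧ w a = 0) :
    LocAC (fun r => (if r ≤ a then 0 else (SignType.sign (w r) : ℝ)) * w r)
      (fun r => (if r ≤ a then 0 else (SignType.sign (w r) : ℝ)) * q r) p R := by
  rcases ha with rfl | ⟨ha, h0⟩
  · refine (hw.abs_sign.congr_fun fun r hr => ?_).congr_deriv (Eventually.of_forall fun r hr => ?_)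
    · simp [not_le.2 hr.1]
    · simp [not_le.2 hr.1]
  · refine ((hw.trunc ha h0).abs_sign.congr_fun fun r hr => ?_).congr_deriv
      (Eventually.of_forall fun r hr => ?_)
    · by_cases h : r ≤ a <;> simp [h]
    · by_cases h : r ≤ a <;> simp [h]

/-- Transfers the construction from tail integrals to head integrals, for the inner half of the
annulus. -/
theorem reflect (hw : LocAC w q p R) (S : ℝ) :
    LocAC (fun r => w (S - r)) (fun r => -q (S - r)) (S - R) (S - p) := by
  have hm : ∀ r ∈ Ioo (S - R) (S - p), S - r ∈ Ioo p R := fun r hr =>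
    ⟨by linarith [hr.2], by linarith [hr.1]⟩
  by_cases hne : (Ioo (S - R) (S - p)).Nonempty
  · obtain ⟨r₁, hr₁⟩ := hne
    have hae : ∀ᵐ r, r ∈ Ioo (S - R) (S - p) → HasDerivAt (fun r => w (S - r)) (-q (S - r)) r := by
      have h1 := (Measure.measurePreserving_sub_left volume S).quasiMeasurePreserving.ae hw.2
      filter_upwards [h1] with r hr hrm
      have : HasDerivAt (fun r => w (S - r)) (q (S - r) * -1) r :=
        (hr (hm r hrm)).comp r ((hasDerivAt_id r).const_sub S)
      rwa [mul_neg_one] at this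
    have hii : ∀ x ∈ Ioo (S - R) (S - p), ∀ y ∈ Ioo (S - R) (S - p),
        IntervalIntegrable (fun r => -q (S - r)) volume x y := fun x hx y hy => by
      have := (hw.intervalIntegrable (hm x hx) (hm y hy)).comp_sub_left S
      simp only [sub_sub_cancel] at this
      exact this.neg
    have hloc : LocallyIntegrableOn (fun r => -q (S - r)) (Ioo (S - R) (S - p)) := by
      intro r hr
      obtain ⟨x, hx⟩ := exists_between hr.1
      obtain ⟨y, hy⟩ := exists_between hr.2
      have hx' : x ∈ Ioo (S - R) (S - p) := ⟨hx.1, hx.2.trans hr.2⟩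
      have hy' : y ∈ Ioo (S - R) (S - p) := ⟨hr.1.trans hy.1, hy.2⟩
      exact ⟨Ioc x y, mem_nhdsWithin_of_mem_nhds (Ioc_mem_nhds hx.2 hy.1), (hii x hx' y hy').1⟩
    refine (of_intervalIntegral hloc (c := w (S - r₁)) hr₁).congr_fun fun r hr => ?_
    simp only
    rw [intervalIntegral.integral_neg, intervalIntegral.integral_comp_sub_left,
      hw.integral_eq (hm r hr) (hm r₁ hr₁)]
    ring
  · have hem := not_nonempty_iff_eq_empty.1 hne
    exact ⟨fun x hx => by simp [hem] at hx, Eventually.of_forall fun x hx => by simp [hem] at hx⟩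

end LocAC

theorem integral_trunc_abs {w : ℝ → ℝ} {p a r R : ℝ}
    (hint : ∀ r ∈ Ioo p R, IntervalIntegrable w volume r R) (haR : a < R) (hr : r ∈ Ioo p R) :
    IntervalIntegrable (fun t => (if t ≤ a then 0 else (SignType.sign (w t) : ℝ)) * w t) volume r R ∧
      ∫ t in r..R, (if t ≤ a then 0 else (SignType.sign (w t) : ℝ)) * w t =
        ∫ t in (max r a)..R, |w t| := by
  have hmR : max r a < R := max_lt hr.2 haR
  have hi := (hint _ ⟨hr.1.trans_le (le_max_left _ a), hmR⟩).abs
  have e1 : ∀ t ∈ uIoc r (max r a),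
      (if t ≤ a then 0 else (SignType.sign (w t) : ℝ)) * w t = 0 := by
    intro t ht
    rw [uIoc_of_le (le_max_left _ _)] at ht
    have : t ≤ a := by
      by_contra hc
      exact absurd ht.2 (not_le.2 (max_lt ht.1 (not_le.1 hc)))
    simp [this]
  have e2 : ∀ t ∈ uIoc (max r a) R,
      |w t| = (if t ≤ a then 0 else (SignType.sign (w t) : ℝ)) * w t := by
    intro t ht
    rw [uIoc_of_le hmR.le] at ht
    simp [not_le.2 ((le_max_right _ _).trans_lt ht.1)]
  have i1 : IntervalIntegrable (fun t => (if t ≤ a then 0 else (SignType.sign (w t) : ℝ)) * w t)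
      volume r (max r a) :=
    (intervalIntegrable_const (c := (0 : ℝ))).congr fun t ht => (e1 t ht).symm
  have i2 : IntervalIntegrable (fun t => (if t ≤ a then 0 else (SignType.sign (w t) : ℝ)) * w t)
      volume (max r a) R := hi.congr e2
  refine ⟨i1.trans i2, ?_⟩
  rw [← intervalIntegral.integral_add_adjacent_intervals i1 i2,
    intervalIntegral.integral_zero_ae (Eventually.of_forall e1), zero_add]
  exact (intervalIntegral.integral_congr_ae (Eventually.of_forall e2)).symm

/-! ### Tail integrals and the gap in which the variation reaches the bound. -/

section Tail

variable {w : ℝ → ℝ} {p R : ℝ}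

theorem hasDerivAt_tail (hw : ContinuousOn w (Ioo p R))
    (hint : ∀ r ∈ Ioo p R, IntervalIntegrable w volume r R) {r : ℝ} (hr : r ∈ Ioo p R) :
    HasDerivAt (fun r => ∫ t in r..R, w t) (-w r) r :=
  intervalIntegral.integral_hasDerivAt_left (hint r hr)
    (hw.stronglyMeasurableAtFilter isOpen_Ioo r hr) (hw.continuousAt (isOpen_Ioo.mem_nhds hr))

theorem continuousOn_tail (hint : ∀ r ∈ Ioo p R, IntervalIntegrable w volume r R) {r : ℝ}
    (hr : r ∈ Ioo p R) : ContinuousOn (fun r => ∫ t in r..R, w t) (Icc r R) := by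
  have h := hint r hr
  have h1 : IntegrableOn w (uIcc r R) := by
    rw [uIcc_of_le hr.2.le, integrableOn_Icc_iff_integrableOn_Ioc]
    exact (intervalIntegrable_iff_integrableOn_Ioc_of_le hr.2.le).1 h
  have := intervalIntegral.continuousOn_primitive_interval_left h1
  rwa [uIcc_of_le hr.2.le] at this

theorem tail_split (hint : ∀ r ∈ Ioo p R, IntervalIntegrable w volume r R) {r s : ℝ}
    (hr : r ∈ Ioo p R) (hs : s ∈ Ioo p R) :
    ∫ t in r..R, w t = (∫ t in r..s, w t) + ∫ t in s..R, w t :=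
  (intervalIntegral.integral_add_adjacent_intervals ((hint r hr).trans (hint s hs).symm)
    (hint s hs)).symm

theorem tail_abs_anti (hint : ∀ r ∈ Ioo p R, IntervalIntegrable w volume r R) {r s : ℝ}
    (hr : r ∈ Ioo p R) (hrs : r ≤ s) (hs : s ≤ R) :
    ∫ t in s..R, |w t| ≤ ∫ t in r..R, |w t| := by
  refine intervalIntegral.integral_mono_interval hrs hs le_rfl
    (Eventually.of_forall fun _ => abs_nonneg _) (hint r hr).abs

theorem tail_abs_nonneg {r : ℝ} (hr : r ≤ R) : 0 ≤ ∫ t in r..R, |w t| :=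
  intervalIntegral.integral_nonneg hr fun _ _ => abs_nonneg _

theorem abs_tail_le {r : ℝ} (hr : r ≤ R) : |∫ t in r..R, w t| ≤ ∫ t in r..R, |w t| :=
  intervalIntegral.abs_integral_le_integral_abs hr

theorem abs_tail_sub_le (hint : ∀ r ∈ Ioo p R, IntervalIntegrable w volume r R) {r s : ℝ}
    (hr : r ∈ Ioo p R) (hs : s ∈ Ioo p R) (hrs : r ≤ s) :
    |(∫ t in r..R, w t) - ∫ t in s..R, w t| ≤ (∫ t in r..R, |w t|) - ∫ t in s..R, |w t| := by
  rw [tail_split hint hr hs, tail_split (fun r hr => (hint r hr).abs) hr hs, add_sub_cancel_right,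
    add_sub_cancel_right]
  exact intervalIntegral.abs_integral_le_integral_abs hrs

/-- On an interval without zeros of `w` the tail integrals of `w` and `|w|` agree up to sign. -/
theorem exists_sign_tail (hw : ContinuousOn w (Ioo p R))
    (hint : ∀ r ∈ Ioo p R, IntervalIntegrable w volume r R) {s : Set ℝ} (hs : s.OrdConnected)
    (hsub : s ⊆ Ioo p R) (h0 : ∀ r ∈ s, w r ≠ 0) :
    ∃ ε : ℝ, |ε| = 1 ∧ (∀ r ∈ s, (SignType.sign (w r) : ℝ) = ε) ∧
      ∀ x ∈ s, ∀ y ∈ s, x ≤ y → (∫ t in x..R, w t) - ∫ t in y..R, w t =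
        ε * ((∫ t in x..R, |w t|) - ∫ t in y..R, |w t|) := by
  have key : ∀ ε : ℝ, |ε| = 1 → (∀ r ∈ s, (SignType.sign (w r) : ℝ) = ε) →
      ∀ x ∈ s, ∀ y ∈ s, x ≤ y → (∫ t in x..R, w t) - ∫ t in y..R, w t =
        ε * ((∫ t in x..R, |w t|) - ∫ t in y..R, |w t|) := by
    intro ε _ h x hx y hy hxy
    rw [tail_split hint (hsub hx) (hsub hy),
      tail_split (fun r hr => (hint r hr).abs) (hsub hx) (hsub hy), add_sub_cancel_right,
      add_sub_cancel_right, ← intervalIntegral.integral_const_mul]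
    refine intervalIntegral.integral_congr fun t ht => ?_
    rw [uIcc_of_le hxy] at ht
    rw [← h t (hs.out hx hy ht)]
    exact (sign_mul_abs (w t)).symm
  rcases (hw.mono hsub).pos_or_neg_of_ne_zero hs h0 with h | h
  · have h1 : ∀ r ∈ s, (SignType.sign (w r) : ℝ) = 1 := fun r hr => by simp [sign_pos (h r hr)]
    exact ⟨1, by simp, h1, key 1 (by simp) h1⟩
  · have h1 : ∀ r ∈ s, (SignType.sign (w r) : ℝ) = -1 := fun r hr => by simp [sign_neg (h r hr)]
    exact ⟨-1, by simp, h1, key (-1) (by simp) h1⟩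

/-- The zeros of `w` next to the last point where the tail integral of `|w|` reaches `M`. -/
theorem exists_zero_gap (hw : ContinuousOn w (Ioo p R))
    (hint : ∀ r ∈ Ioo p R, IntervalIntegrable w volume r R) {M : ℝ} (hM : 0 < M)
    (hV : ∀ r ∈ Ioo p R, |∫ t in r..R, w t| ≤ M)
    (hL : ∃ r ∈ Ioo p R, M ≤ ∫ t in r..R, |w t|) :
    ∃ a ρ b, a ≤ ρ ∧ ρ ≤ b ∧ b < R ∧ ρ ∈ Ioo p R ∧ (a = p ∨ a ∈ Ioo p R ∧ w a = 0) ∧ w b = 0 ∧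
      ∫ t in ρ..R, |w t| = M ∧ (∀ r ∈ Ioo a b, w r ≠ 0) ∧ (a < b → a < ρ ∧ ρ < b) ∧
      ∀ z ∈ Ioo p R, w z = 0 → M ≤ ∫ t in z..R, |w t| → p < a ∧ z ≤ a := by
  obtain ⟨r₁, hr₁, hL₁⟩ := hL
  have hint' : ∀ r ∈ Ioo p R, IntervalIntegrable (fun t => |w t|) volume r R :=
    fun r hr => (hint r hr).abs
  have hcont := continuousOn_tail hint' hr₁
  -- The last radius at which the tail integral of `|w|` is still at least `M`; by continuity it
  -- equals `M` there.
  obtain ⟨ρ, ⟨hρI, hρL⟩, hρmax⟩ : ∃ ρ, IsGreatest {r | r ∈ Icc r₁ R ∧ M ≤ ∫ t in r..R, |w t|} ρ := by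
    refine IsCompact.exists_isGreatest ?_ ⟨r₁, left_mem_Icc.2 hr₁.2.le, hL₁⟩
    have : IsClosed {r | r ∈ Icc r₁ R ∧ M ≤ ∫ t in r..R, |w t|} :=
      hcont.preimage_isClosed_of_isClosed isClosed_Icc isClosed_Ici
    exact isCompact_Icc.of_isClosed_subset this fun r hr => hr.1
  have hρR : ρ < R := by
    refine lt_of_le_of_ne hρI.2 fun h => ?_
    rw [h, intervalIntegral.integral_same] at hρL
    linarith
  have hρ : ρ ∈ Ioo p R := ⟨hr₁.1.trans_le hρI.1, hρR⟩
  have hρM : ∫ t in ρ..R, |w t| = M := by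
    refine le_antisymm ?_ hρL
    by_contra! hlt
    have hc' := hcont.mono (Icc_subset_Icc_left hρI.1)
    obtain ⟨s, hs, hsM⟩ := intermediate_value_Icc' hρR.le hc'
      (show M ∈ Icc (∫ t in R..R, |w t|) (∫ t in ρ..R, |w t|) from
        ⟨by rw [intervalIntegral.integral_same]; exact hM.le, hlt.le⟩)
    have : s ≤ ρ := hρmax ⟨⟨hρI.1.trans hs.1, hs.2⟩, hsM.ge⟩
    have : s = ρ := le_antisymm this hs.1
    rw [this] at hsM
    simp only at hsM
    linarith
  -- Without a zero of `w` on `[ρ,R)` the tail integral of `w` at `ρ` would have modulus `M`. Then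
  -- `ρ` would be an extremum of this integral, and `w ρ = 0`.
  have hρz : ∃ z ∈ Ico ρ R, w z = 0 := by
    by_contra! hcon
    have hsub : Ico ρ R ⊆ Ioo p R := fun r hr => ⟨hρ.1.trans_le hr.1, hr.2⟩
    obtain ⟨ε, hε, -, he⟩ := exists_sign_tail hw hint ordConnected_Ico hsub hcon
    have hVρ : |∫ t in ρ..R, w t| = M := by
      have c1 := continuousOn_tail hint hρ
      have c2 := continuousOn_tail hint' hρ
      have hne : (𝓝[<] R).NeBot := inferInstance
      have hin : 𝓝[<] R ≤ 𝓝[Icc ρ R] R := by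
        rw [← nhdsWithin_Ico_eq_nhdsLT hρR]
        exact nhdsWithin_mono _ Ico_subset_Icc_self
      have t1 : Tendsto (fun r => ∫ t in r..R, w t) (𝓝[<] R) (𝓝 0) := by
        simpa using (c1 R (right_mem_Icc.2 hρR.le)).tendsto.mono_left hin
      have t2 : Tendsto (fun r => ∫ t in r..R, |w t|) (𝓝[<] R) (𝓝 0) := by
        simpa using (c2 R (right_mem_Icc.2 hρR.le)).tendsto.mono_left hin
      have h1 := (t1.const_sub (∫ t in ρ..R, w t))
      have h2 := ((t2.const_sub (∫ t in ρ..R, |w t|)).const_mul ε)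
      have h3 := tendsto_nhds_unique_of_eventuallyEq h1 h2 (by
        filter_upwards [Ico_mem_nhdsLT hρR] with y hy
        exact he ρ (left_mem_Ico.2 hρR) y hy hy.1)
      rw [sub_zero, sub_zero] at h3
      rw [h3, abs_mul, hε, one_mul, hρM, abs_of_pos hM]
    have hext : IsLocalExtr (fun r => ∫ t in r..R, w t) ρ := by
      have hev : ∀ᶠ r in 𝓝 ρ, |∫ t in r..R, w t| ≤ M := by
        filter_upwards [isOpen_Ioo.mem_nhds hρ] with r hr using hV r hr
      rcases abs_choice (∫ t in ρ..R, w t) with h | h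
      · right
        filter_upwards [hev] with r hr
        rw [← h, hVρ]
        exact (abs_le.1 hr).2
      · left
        filter_upwards [hev] with r hr
        have : (∫ t in ρ..R, w t) = -M := by linarith
        rw [this]
        exact (abs_le.1 hr).1
    have := hext.hasDerivAt_eq_zero (hasDerivAt_tail hw hint hρ)
    exact hcon ρ (left_mem_Ico.2 hρR) (by linarith)
  obtain ⟨z₁, hz₁, hz₁0⟩ := hρz
  obtain ⟨b, ⟨hbI, hb0⟩, hbmin⟩ : ∃ b, IsLeast {r | r ∈ Icc ρ z₁ ∧ w r = 0} b := by
    refine IsCompact.exists_isLeast ?_ ⟨z₁, right_mem_Icc.2 hz₁.1, hz₁0⟩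
    have hc : ContinuousOn w (Icc ρ z₁) :=
      hw.mono fun r hr => ⟨hρ.1.trans_le hr.1, hr.2.trans_lt hz₁.2⟩
    have : IsClosed {r | r ∈ Icc ρ z₁ ∧ w r = 0} :=
      hc.preimage_isClosed_of_isClosed isClosed_Icc isClosed_singleton
    exact isCompact_Icc.of_isClosed_subset this fun r hr => hr.1
  have hbR : b < R := hbI.2.trans_lt hz₁.2
  have hright : ∀ r ∈ Ico ρ b, w r ≠ 0 := fun r hr h =>
    absurd (hbmin ⟨⟨hr.1, hr.2.le.trans hbI.2⟩, h⟩) (not_le.2 hr.2)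
  -- Here `a` is the last zero of `w` up to `ρ`, or `p` if there is none.
  have hleft : ∃ a, a ≤ ρ ∧ (a = p ∨ a ∈ Ioo p R ∧ w a = 0) ∧ (∀ r ∈ Ioc a ρ, w r ≠ 0) ∧
      ∀ z ∈ Ioc p ρ, w z = 0 → p < a ∧ z ≤ a := by
    by_cases hz : ∃ z ∈ Ioc p ρ, w z = 0
    · obtain ⟨z₂, hz₂, hz₂0⟩ := hz
      obtain ⟨a, ⟨haI, ha0⟩, hamax⟩ : ∃ a, IsGreatest {r | r ∈ Icc z₂ ρ ∧ w r = 0} a := by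
        refine IsCompact.exists_isGreatest ?_ ⟨z₂, left_mem_Icc.2 hz₂.2, hz₂0⟩
        have hc : ContinuousOn w (Icc z₂ ρ) :=
          hw.mono fun r hr => ⟨hz₂.1.trans_le hr.1, hr.2.trans_lt hρR⟩
        have : IsClosed {r | r ∈ Icc z₂ ρ ∧ w r = 0} :=
          hc.preimage_isClosed_of_isClosed isClosed_Icc isClosed_singleton
        exact isCompact_Icc.of_isClosed_subset this fun r hr => hr.1
      have hpa := hz₂.1.trans_le haI.1
      refine ⟨a, haI.2, Or.inr ⟨⟨hpa, haI.2.trans_lt hρR⟩, ha0⟩, fun r hr h => ?_,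
        fun z hz h => ⟨hpa, ?_⟩⟩
      · exact absurd (hamax ⟨⟨haI.1.trans hr.1.le, hr.2⟩, h⟩) (not_le.2 hr.1)
      · rcases le_total z₂ z with h' | h'
        · exact hamax ⟨⟨h', hz.2⟩, h⟩
        · exact h'.trans haI.1
    · push Not at hz
      exact ⟨p, hρ.1.le, Or.inl rfl, hz, fun z hz' h => absurd h (hz z hz')⟩
  obtain ⟨a, haρ, ha, haz, hamax⟩ := hleft
  refine ⟨a, ρ, b, haρ, hbI.1, hbR, hρ, ha, hb0, hρM, fun r hr => ?_, fun hab => ?_,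
    fun z hz hz0 hzM => hamax z ⟨hz.1, ?_⟩ hz0⟩
  · rcases le_or_gt r ρ with h | h
    · exact haz r ⟨hr.1, h⟩
    · exact hright r ⟨h.le, hr.2⟩
  -- If `w ρ = 0`, the gap degenerates to `a = ρ = b`; otherwise `ρ` lies strictly inside it.
  · by_cases h0 : w ρ = 0
    · have h1 : b = ρ := by
        by_contra hne
        exact hright ρ (left_mem_Ico.2 (lt_of_le_of_ne hbI.1 (Ne.symm hne))) h0
      have h2 := (hamax ρ ⟨hρ.1, le_rfl⟩ h0).2
      rw [h1] at hab
      exact absurd hab (not_lt.2 h2)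
    · refine ⟨lt_of_le_of_ne haρ fun h => ?_, lt_of_le_of_ne hbI.1 fun h => h0 (h ▸ hb0)⟩
      rcases ha with rfl | ⟨-, ha⟩
      · exact absurd hρ.1 (by simp [h])
      · exact h0 (h ▸ ha)
  · rcases le_total z r₁ with h | h
    · exact h.trans hρI.1
    · exact hρmax ⟨⟨h, hz.2.le⟩, hzM⟩

end Tail

/-! ### The monotone rearrangement of a profile. -/

section Rearrangement

variable {w q : ℝ → ℝ} {p R M : ℝ}

/-- The slope with which the gap `(a,b)` is traversed by the rearranged profile. -/
theorem exists_gap_slope (hw : ContinuousOn w (Ioo p R))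
    (hint : ∀ r ∈ Ioo p R, IntervalIntegrable w volume r R)
    (hV : ∀ r ∈ Ioo p R, |∫ t in r..R, w t| ≤ M) {a ρ b : ℝ} (haρ : a ≤ ρ) (hρb : ρ ≤ b)
    (hbR : b < R) (hρ : ρ ∈ Ioo p R) (ha : a = p ∨ a ∈ Ioo p R ∧ w a = 0)
    (hρM : ∫ t in ρ..R, |w t| = M) (hne : ∀ r ∈ Ioo a b, w r ≠ 0)
    (hab : a < b → a < ρ ∧ ρ < b) :
    ∃ c ∈ Icc (0 : ℝ) 1,
      (∀ r ∈ Ioo a b, |∫ t in r..R, w t| ≤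
          (∫ t in b..R, |w t|) + c * ((∫ t in r..R, |w t|) - ∫ t in b..R, |w t|) ∧
        (∫ t in b..R, |w t|) + c * ((∫ t in r..R, |w t|) - ∫ t in b..R, |w t|) ≤ M) ∧
      (p < a → (∫ t in b..R, |w t|) + c * ((∫ t in a..R, |w t|) - ∫ t in b..R, |w t|) = M) := by
  have hpa : p ≤ a := by
    rcases ha with rfl | h
    · exact le_rfl
    · exact h.1.1.le
  rcases eq_or_lt_of_le (haρ.trans hρb) with heq | hlt
  · have h1 : ρ = a := le_antisymm (heq ▸ hρb) haρ
    subst heq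
    -- Degenerate gap: `L b = M` already, so the slope is irrelevant.
    refine ⟨0, by simp, fun r hr => absurd (hr.1.trans hr.2) (lt_irrefl _), fun _ => ?_⟩
    rw [← h1, hρM]
    ring
  obtain ⟨haρ', hρb'⟩ := hab hlt
  have hint' : ∀ r ∈ Ioo p R, IntervalIntegrable (fun t => |w t|) volume r R :=
    fun r hr => (hint r hr).abs
  have hbm : b ∈ Ioo p R := ⟨hρ.1.trans hρb', hbR⟩
  have hsub : Ioo a b ⊆ Ioo p R := fun r hr => ⟨hpa.trans_lt hr.1, hr.2.trans hbR⟩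
  set V : ℝ → ℝ := fun r => ∫ t in r..R, w t with hVdef
  set L : ℝ → ℝ := fun r => ∫ t in r..R, |w t| with hLdef
  have hanti : ∀ {r s}, r ∈ Ioo p R → s ∈ Ioo p R → r ≤ s → L s ≤ L r :=
    fun hr hs h => tail_abs_anti hint hr h hs.2.le
  obtain ⟨ε, hε, -, he⟩ := exists_sign_tail hw hint ordConnected_Ioo hsub hne
  have hcL : ContinuousOn L (Ioo p R) := fun r hr =>
    (hasDerivAt_tail hw.abs hint' hr).continuousAt.continuousWithinAt
  have hcV : ContinuousOn V (Ioo p R) := fun r hr =>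
    (hasDerivAt_tail hw hint hr).continuousAt.continuousWithinAt
  have hL0 : 0 ≤ L b := tail_abs_nonneg hbR.le
  -- the sign relation, extended to the right end of the gap
  have heb : ∀ r ∈ Ioo a b, V r - V b = ε * (L r - L b) := by
    intro r hr
    have hnb : 𝓝[<] b ≤ 𝓝 b := nhdsWithin_le_nhds
    have t1 : Tendsto V (𝓝[<] b) (𝓝 (V b)) :=
      ((hcV b hbm).continuousAt (isOpen_Ioo.mem_nhds hbm)).mono_left hnb
    have t2 : Tendsto L (𝓝[<] b) (𝓝 (L b)) :=
      ((hcL b hbm).continuousAt (isOpen_Ioo.mem_nhds hbm)).mono_left hnb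
    refine tendsto_nhds_unique_of_eventuallyEq (t1.const_sub (V r))
      ((t2.const_sub (L r)).const_mul ε) ?_
    filter_upwards [Ioo_mem_nhdsLT hr.2] with y hy
    exact he r hr y ⟨hr.1.trans hy.1, hy.2⟩ hy.1.le
  have hVb : |V b| ≤ L b := abs_tail_le hbR.le
  have hLbM : L b < M := by
    have h1 : L b ≤ L ρ := hanti hρ hbm hρb'.le
    refine lt_of_le_of_ne (h1.trans_eq hρM) fun h => ?_
    have h2 : ∫ t in ρ..b, |w t| = 0 := by
      have := tail_split hint' hρ hbm
      simp only [hLdef] at h hρM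
      linarith
    have h3 : 0 < ∫ t in ρ..b, |w t| := by
      refine intervalIntegral.intervalIntegral_pos_of_pos_on ?_ (fun t ht => ?_) hρb'
      · exact (hint' ρ hρ).trans (hint' b hbm).symm
      · exact abs_pos.2 (hne t ⟨haρ'.trans ht.1, ht.2⟩)
    linarith
  have hVD : ∀ r ∈ Ioo a b, |V r| ≤ L b + (L r - L b) := fun r hr => by
    have := abs_tail_le (w := w) (hr.2.trans hbR).le
    simp only [hVdef, hLdef] at *
    linarith
  have hDbound : ∀ r ∈ Ioo a b, L r - L b ≤ 2 * M := by
    intro r hr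
    have h1 : |L r - L b| = |V r - V b| := by rw [heb r hr, abs_mul, hε, one_mul]
    have h2 := abs_sub (V r) (V b)
    have h3 := hV r (hsub hr)
    have h4 := hV b hbm
    have h5 := le_abs_self (L r - L b)
    simp only [hVdef, hLdef] at *
    linarith
  -- The full climb of `L` over the gap. It is a supremum because for `a = p` the function `w` need
  -- not be integrable up to `p`. The slope `c = (M - L b)/δ` scales this climb to the one that is
  -- left below `M`.
  set δ := sSup ((fun r => L r - L b) '' Ioo a b) with hδ
  have hbdd : BddAbove ((fun r => L r - L b) '' Ioo a b) := ⟨2 * M, by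
    rintro _ ⟨r, hr, rfl⟩
    exact hDbound r hr⟩
  have hle : ∀ r ∈ Ioo a b, L r - L b ≤ δ := fun r hr => le_csSup hbdd ⟨r, hr, rfl⟩
  have hnon : ((fun r => L r - L b) '' Ioo a b).Nonempty := ⟨_, ρ, ⟨haρ', hρb'⟩, rfl⟩
  have hMδ : M - L b ≤ δ := by
    have := hle ρ ⟨haρ', hρb'⟩
    rwa [show L ρ = M from hρM] at this
  have hδ0 : 0 < δ := by linarith
  have hcδ : (M - L b) / δ * δ = M - L b := div_mul_cancel₀ _ hδ0.ne'
  refine ⟨(M - L b) / δ, ⟨div_nonneg (by linarith) hδ0.le, (div_le_one hδ0).2 hMδ⟩,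
    fun r hr => ⟨?_, ?_⟩, fun hpa' => ?_⟩
  · change |V r| ≤ L b + (M - L b) / δ * (L r - L b)
    have hDr : 0 ≤ L r - L b := sub_nonneg.2 (hanti (hsub hr) hbm hr.2.le)
    rcases le_or_gt (|V r| - L b) 0 with hx | hx
    · have : 0 ≤ (M - L b) / δ * (L r - L b) :=
        mul_nonneg (div_nonneg (by linarith) hδ0.le) hDr
      linarith
    -- The bound for `|V r|` is recast as an upper bound for `δ`, so that it can be tested on each
    -- `s` of the gap separately. Only `s ≤ r` uses that `V` is affine in `L`.
    · have hδle : δ ≤ (L r - L b) * (M - L b) / (|V r| - L b) := by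
        refine csSup_le hnon ?_
        rintro _ ⟨s, hs, rfl⟩
        simp only
        rw [le_div_iff₀ hx]
        have hVr : |V r| ≤ M := hV r (hsub hr)
        rcases le_total r s with hrs | hsr
        · have h1 : L s - L b ≤ L r - L b := by linarith [hanti (hsub hr) (hsub hs) hrs]
          calc (L s - L b) * (|V r| - L b) ≤ (L r - L b) * (|V r| - L b) :=
                mul_le_mul_of_nonneg_right h1 hx.le
            _ ≤ _ := mul_le_mul_of_nonneg_left (by linarith) hDr
        · -- `V r` is the convex combination of `V b` and `V s`
          have hDs : L r - L b ≤ L s - L b := by linarith [hanti (hsub hs) (hsub hr) hsr]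
          have hc : (L s - L b) * V r = (L s - L r) * V b + (L r - L b) * V s := by
            have e1 := heb r hr
            have e2 := heb s hs
            have e3 : V r = V b + ε * (L r - L b) := by linarith
            have e4 : V s = V b + ε * (L s - L b) := by linarith
            rw [e3, e4]
            ring
          have h2 : (L s - L b) * |V r| ≤ (L s - L r) * L b + (L r - L b) * M := by
            calc (L s - L b) * |V r| = |(L s - L b) * V r| := by
                  rw [abs_mul, abs_of_nonneg (hDr.trans hDs)]
              _ = |(L s - L r) * V b + (L r - L b) * V s| := by rw [hc]
              _ ≤ |(L s - L r) * V b| + |(L r - L b) * V s| := abs_add_le _ _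
              _ = (L s - L r) * |V b| + (L r - L b) * |V s| := by
                  rw [abs_mul, abs_mul, abs_of_nonneg (by linarith : 0 ≤ L s - L r),
                    abs_of_nonneg hDr]
              _ ≤ _ := add_le_add (mul_le_mul_of_nonneg_left hVb (by linarith))
                  (mul_le_mul_of_nonneg_left (hV s (hsub hs)) hDr)
          linarith
      rw [le_div_iff₀ hx] at hδle
      have : |V r| - L b ≤ (M - L b) / δ * (L r - L b) := by
        rw [div_mul_eq_mul_div, le_div_iff₀ hδ0]
        linarith
      linarith
  · change L b + (M - L b) / δ * (L r - L b) ≤ M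
    have := mul_le_mul_of_nonneg_left (hle r hr)
      (div_nonneg (by linarith : 0 ≤ M - L b) hδ0.le)
    linarith
  · have ham : a ∈ Ioo p R := ⟨hpa', hlt.trans hbR⟩
    -- If the inner end is a zero inside the interval, the supremum is the limit at `a`, and `Y`
    -- reaches exactly `M` there.
    have hδa : δ = L a - L b := by
      refine le_antisymm (csSup_le hnon ?_) ?_
      · rintro _ ⟨s, hs, rfl⟩
        linarith [hanti ham (hsub hs) hs.1.le]
      · have t2 : Tendsto (fun r => L r - L b) (𝓝[>] a) (𝓝 (L a - L b)) :=
          (((hcL a ham).continuousAt (isOpen_Ioo.mem_nhds ham)).mono_left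
            nhdsWithin_le_nhds).sub_const _
        refine le_of_tendsto t2 ?_
        filter_upwards [Ioo_mem_nhdsGT hlt] with r hr using hle r hr
    change L b + (M - L b) / δ * (L a - L b) = M
    rw [← hδa, hcδ]
    ring

/-- A monotone profile `∫_r^R κ w` between the absolute value of `∫_r^R w` and its bound `M`,
obtained by multiplying `w` by a factor `κ` of modulus at most one that is constant on the
components of `{w ≠ 0}`. -/
theorem exists_monotone_rearrangement (hw : LocAC w q p R)
    (hint : ∀ r ∈ Ioo p R, IntervalIntegrable w volume r R) (hM : 0 < M)
    (hV : ∀ r ∈ Ioo p R, |∫ t in r..R, w t| ≤ M)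
    (hL : ∃ r ∈ Ioo p R, M ≤ ∫ t in r..R, |w t|) :
    ∃ κ : ℝ → ℝ, (∀ r, |κ r| ≤ 1) ∧ (∀ r, 0 ≤ κ r * w r) ∧
      LocAC (fun r => κ r * w r) (fun r => κ r * q r) p R ∧
      (∃ k, ∃ d ∈ Ioo p R, ∀ r ∈ Ioo p d, κ r = k) ∧
      (∀ r ∈ Ioo p R, IntervalIntegrable (fun t => κ t * w t) volume r R ∧
        |∫ t in r..R, w t| ≤ ∫ t in r..R, κ t * w t ∧ ∫ t in r..R, κ t * w t ≤ M) ∧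
      ∀ z ∈ Ioo p R, w z = 0 → M ≤ ∫ t in z..R, |w t| →
        (∀ r ≤ z, κ r = 0) ∧ ∫ t in z..R, κ t * w t = M := by
  have hwc := hw.continuousOn
  obtain ⟨a, ρ, b, haρ, hρb, hbR, hρ, ha, hb0, hρM, hne, hab, hz⟩ :=
    exists_zero_gap hwc hint hM hV hL
  obtain ⟨c, hc, hgap, hca⟩ :=
    exists_gap_slope hwc hint hV haρ hρb hbR hρ ha hρM hne hab
  have hpa : p ≤ a := by
    rcases ha with rfl | h
    · exact le_rfl
    · exact h.1.1.le
  have hbm : b ∈ Ioo p R := ⟨hρ.1.trans_le hρb, hbR⟩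
  have haR : a < R := (haρ.trans hρb).trans_lt hbR
  set E : ℝ → ℝ → ℝ := fun x r => if r ≤ x then 0 else (SignType.sign (w r) : ℝ) with hE
  have hEw : ∀ x r, 0 ≤ E x r * w r := by
    intro x r
    simp only [hE]
    split_ifs
    · simp
    · rw [sign_mul_self]
      exact abs_nonneg _
  have hsgn : ∀ r, |(SignType.sign (w r) : ℝ)| ≤ 1 := fun r => by
    rcases lt_trichotomy (w r) 0 with h | h | h
    · simp [sign_neg h]
    · simp [h]
    · simp [sign_pos h]
  have hE1 : ∀ x r, |E x r| ≤ 1 := by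
    intro x r
    simp only [hE]
    split_ifs
    · simp
    · exact hsgn r
  -- The factor is `0` up to `a`, `c * sign w` in the gap and `sign w` beyond `b`. As a convex
  -- combination of two truncated signs it inherits absolute continuity of the product and the bound
  -- by one.
  set κ : ℝ → ℝ := fun r => (1 - c) * E b r + c * E a r with hκ
  have hκw : ∀ r, κ r * w r = (1 - c) * (E b r * w r) + c * (E a r * w r) := fun r => by
    simp only [hκ]
    ring
  have hκq : ∀ r, κ r * q r = (1 - c) * (E b r * q r) + c * (E a r * q r) := fun r => by
    simp only [hκ]
    ring
  have h1c : 0 ≤ 1 - c := sub_nonneg.2 hc.2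
  have hY : ∀ r ∈ Ioo p R, IntervalIntegrable (fun t => κ t * w t) volume r R ∧
      ∫ t in r..R, κ t * w t =
        (1 - c) * (∫ t in (max r b)..R, |w t|) + c * ∫ t in (max r a)..R, |w t| := by
    intro r hr
    obtain ⟨i1, e1⟩ := integral_trunc_abs (a := b) hint hbR hr
    obtain ⟨i2, e2⟩ := integral_trunc_abs (a := a) hint haR hr
    simp only [hκw]
    refine ⟨(i1.const_mul _).add (i2.const_mul _), ?_⟩
    rw [intervalIntegral.integral_add (i1.const_mul _) (i2.const_mul _),
      intervalIntegral.integral_const_mul, intervalIntegral.integral_const_mul, e1, e2]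
  refine ⟨κ, fun r => ?_, fun r => ?_, ?_, ?_, fun r hr => ?_, fun z hzm hz0 hzM => ?_⟩
  · calc |κ r| ≤ |(1 - c) * E b r| + |c * E a r| := abs_add_le _ _
      _ = (1 - c) * |E b r| + c * |E a r| := by
          rw [abs_mul, abs_mul, abs_of_nonneg h1c, abs_of_nonneg hc.1]
      _ ≤ (1 - c) * 1 + c * 1 := add_le_add (mul_le_mul_of_nonneg_left (hE1 b r) h1c)
          (mul_le_mul_of_nonneg_left (hE1 a r) hc.1)
      _ = 1 := by ring
  · rw [hκw]
    exact add_nonneg (mul_nonneg h1c (hEw b r)) (mul_nonneg hc.1 (hEw a r))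
  · simp only [hκw, hκq]
    exact ((hw.trunc_abs (Or.inr ⟨hbm, hb0⟩)).const_mul _).add ((hw.trunc_abs ha).const_mul _)
  -- Constancy of `κ` near `p`: either the gap extends to `p` and `w` has one sign there, or `κ = 0`
  -- up to `a`.
  · rcases eq_or_lt_of_le hpa with heq | hlt
    · have hsub : Ioo p b ⊆ Ioo p R := Ioo_subset_Ioo_right hbR.le
      obtain ⟨ε, -, hε, -⟩ := exists_sign_tail hwc hint ordConnected_Ioo hsub
        (fun r hr => hne r ⟨heq ▸ hr.1, hr.2⟩)
      refine ⟨c * ε, b, hbm, fun r hr => ?_⟩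
      have h1 : ¬ r ≤ a := by
        rw [← heq]
        exact not_le.2 hr.1
      simp [hκ, hE, hr.2.le, h1, hε r hr]
    · refine ⟨0, a, ⟨hlt, haR⟩, fun r hr => ?_⟩
      simp [hκ, hE, hr.2.le, hr.2.le.trans (haρ.trans hρb)]
  · obtain ⟨i, e⟩ := hY r hr
    refine ⟨i, ?_⟩
    rw [e]
    rcases le_or_gt b r with hbr | hrb
    · rw [max_eq_left hbr, max_eq_left ((haρ.trans hρb).trans hbr)]
      have h1 := abs_tail_le (w := w) hr.2.le
      have h2 : ∫ t in r..R, |w t| ≤ M :=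
        (tail_abs_anti hint hρ (hρb.trans hbr) hr.2.le).trans_eq hρM
      exact ⟨by linarith, by linarith⟩
    · rw [max_eq_right hrb.le]
      rcases lt_or_ge a r with har | hra
      · rw [max_eq_left har.le]
        have := hgap r ⟨har, hrb⟩
        exact ⟨by linarith [this.1], by linarith [this.2]⟩
      · rw [max_eq_right hra]
        have h1 := hca (hr.1.trans_le hra)
        have h2 := hV r hr
        exact ⟨by linarith, by linarith⟩
  · obtain ⟨hpa', hza⟩ := hz z hzm hz0 hzM
    refine ⟨fun r hr => ?_, ?_⟩
    · have h1 : r ≤ a := hr.trans hza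
      simp [hκ, hE, h1, h1.trans (haρ.trans hρb)]
    · rw [(hY z hzm).2, max_eq_right hza, max_eq_right (hza.trans (haρ.trans hρb))]
      linarith [hca hpa']

end Rearrangement

/-! ### Balls and annuli treated together. -/

/-- `Ω` is the annulus with radii `R₀ < R` or, if `R₀ = 0`, the ball of radius `R`. -/
def IsRadialDomain {N : ℕ} (Ω : Set (EuclideanSpace ℝ (Fin N))) (R₀ R : ℝ) : Prop :=
  R₀ < R ∧ (0 < R₀ ∧ Ω = annulus N R₀ R ∨ R₀ = 0 ∧ Ω = Metric.ball 0 R)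

namespace IsRadialDomain

variable {N : ℕ} {Ω : Set (EuclideanSpace ℝ (Fin N))} {R₀ R : ℝ}

theorem nonneg (h : IsRadialDomain Ω R₀ R) : 0 ≤ R₀ := by
  rcases h.2 with ⟨h, -⟩ | ⟨h, -⟩
  · exact h.le
  · exact h.ge

theorem isOpen (h : IsRadialDomain Ω R₀ R) : IsOpen Ω := by
  rcases h.2 with ⟨-, rfl⟩ | ⟨-, rfl⟩
  · exact isOpen_annulus N R₀ R
  · exact Metric.isOpen_ball

theorem annulus_subset (h : IsRadialDomain Ω R₀ R) : annulus N R₀ R ⊆ Ω := by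
  rcases h.2 with ⟨-, rfl⟩ | ⟨-, rfl⟩
  · exact subset_rfl
  · exact annulus_subset_ball N R₀ R

theorem ae_eq_annulus (h : IsRadialDomain Ω R₀ R) (hN : 1 ≤ N) :
    Ω =ᵐ[volume] annulus N R₀ R := by
  rcases h.2 with ⟨-, rfl⟩ | ⟨rfl, rfl⟩
  · exact EventuallyEq.rfl
  · exact ball_ae_eq_annulus hN R

theorem restrict_eq (h : IsRadialDomain Ω R₀ R) (hN : 1 ≤ N) :
    volume.restrict Ω = volume.restrict (annulus N R₀ R) :=
  Measure.restrict_congr_set (h.ae_eq_annulus hN)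

theorem ball_subset (h : IsRadialDomain Ω R₀ R) (h0 : R₀ = 0) : Metric.ball 0 R ⊆ Ω := by
  rcases h.2 with ⟨h1, -⟩ | ⟨-, rfl⟩
  · exact absurd h0 h1.ne'
  · exact subset_rfl

end IsRadialDomain

theorem IsDirichletPrimitive.hasDerivAt {V w : ℝ → ℝ} {R₀ R : ℝ} (h : IsDirichletPrimitive V w R₀ R)
    (hw : ContinuousOn w (Ioo R₀ R)) {r : ℝ} (hr : r ∈ Ioo R₀ R) : HasDerivAt V (w r) r := by
  have h1 := (hasDerivAt_tail hw (fun r hr => (h.1 r hr).1) hr).neg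
  rw [neg_neg] at h1
  refine h1.congr_of_eventuallyEq ?_
  filter_upwards [isOpen_Ioo.mem_nhds hr] with s hs using (h.1 s hs).2

theorem IsDirichletPrimitive.continuousOn {V w : ℝ → ℝ} {R₀ R : ℝ}
    (h : IsDirichletPrimitive V w R₀ R) (hw : ContinuousOn w (Ioo R₀ R)) :
    ContinuousOn V (Ioo R₀ R) :=
  fun _ hr => (h.hasDerivAt hw hr).continuousAt.continuousWithinAt

/-! ### Competitors and comparison of energies. -/

section Competitor

variable {N : ℕ} {Ω : Set (EuclideanSpace ℝ (Fin N))} {R₀ R : ℝ}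
  {u : EuclideanSpace ℝ (Fin N) → ℝ} {V w q Y κ : ℝ → ℝ}

theorem radialHessian_mul (κ w q : ℝ → ℝ) (i j : Fin N) (x : EuclideanSpace ℝ (Fin N)) :
    radialHessian (fun r => κ r * w r) (fun r => κ r * q r) i j x =
      κ ‖x‖ * radialHessian w q i j x := by
  simp only [radialHessian]
  ring

theorem memLp_radial_deriv (hN : 1 ≤ N) (hΩ : IsRadialDomain Ω R₀ R) (hu : MemH1 Ω u)
    (hD : ∀ i, weakPartial Ω i u =ᵐ[volume.restrict Ω] fun x => w ‖x‖ * (x i / ‖x‖)) :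
    MemLp (fun x : EuclideanSpace ℝ (Fin N) => w ‖x‖) 2 (volume.restrict Ω) := by
  have h1 : MemLp (fun x => ∑ i, weakPartial Ω i u x * (x i / ‖x‖)) 2 (volume.restrict Ω) := by
    refine memLp_finsetSum _ fun i _ => (hu.2 i).2.of_le
      ((hu.2 i).2.1.mul (measurable_coord_div_norm i).aestronglyMeasurable)
      (Eventually.of_forall fun x => ?_)
    rw [norm_mul]
    exact mul_le_of_le_one_right (norm_nonneg _) (abs_coord_div_norm_le x i)
  refine (memLp_congr_ae ?_).1 h1
  rw [hΩ.restrict_eq hN] at hD ⊢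
  filter_upwards [ae_all_iff.2 hD, ae_restrict_mem (measurableSet_annulus N R₀ R)] with x hx hxm
  have hx0 : x ≠ 0 := norm_pos_iff.1 (hΩ.nonneg.trans_lt hxm.1)
  have : ∀ i, weakPartial Ω i u x * (x i / ‖x‖) = w ‖x‖ * (x i / ‖x‖) ^ 2 := fun i => by
    rw [hx i]
    ring
  simp only [this]
  rw [← Finset.mul_sum, sum_coord_div_norm_sq hx0, mul_one]

/-- Gradient and Hessian of the competitor are `κ` times those of `u`, so `|κ| ≤ 1` preserves square
integrability. The radial formulas give the weak derivatives away from the origin. In the ball `κ`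
is a constant `k` near the origin, so the competitor is there `k * u` plus a constant, and the two
pieces are glued. -/
theorem memHr_of_multiplier (hN : 1 ≤ N) (hΩ : IsRadialDomain Ω R₀ R) (hu : MemHr Ω u)
    (hDirV : IsDirichletPrimitive V w R₀ R)
    (huV : ∀ᵐ x ∂(volume.restrict Ω), u x = V ‖x‖)
    (hD : ∀ i, weakPartial Ω i u =ᵐ[volume.restrict Ω] fun x => w ‖x‖ * (x i / ‖x‖))
    (hD2 : ∀ i j, weakPartial Ω j (weakPartial Ω i u) =ᵐ[volume.restrict Ω] radialHessian w q i j)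
    (hκ : ∀ r, |κ r| ≤ 1) (hh : LocAC (fun r => κ r * w r) (fun r => κ r * q r) R₀ R)
    (hY : IsDirichletPrimitive Y (fun r => κ r * w r) R₀ R)
    (hκ0 : R₀ = 0 → ∃ k, ∃ d ∈ Ioo R₀ R, ∀ r ∈ Ioo R₀ d, κ r = k) :
    MemHr Ω (fun x => Y ‖x‖) ∧
      (∀ i, weakPartial Ω i (fun x => Y ‖x‖) =ᵐ[volume.restrict Ω]
        fun x => κ ‖x‖ * w ‖x‖ * (x i / ‖x‖)) ∧
      ∀ i j, weakPartial Ω j (weakPartial Ω i fun x => Y ‖x‖) =ᵐ[volume.restrict Ω]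
        radialHessian (fun r => κ r * w r) (fun r => κ r * q r) i j := by
  have hR₀ := hΩ.nonneg
  have hYc := hY.continuousOn hh.continuousOn
  have hYac : LocAC Y (fun r => κ r * w r) R₀ R :=
    LocAC.of_hasDerivAt (fun r hr => hY.hasDerivAt hh.continuousOn hr) hh.continuousOn
  have hwL := memLp_radial_deriv hN hΩ hu.1.1 hD
  have g1 : ∀ i, HasWeakPartial (annulus N R₀ R) i (fun x => Y ‖x‖)
      fun x => κ ‖x‖ * w ‖x‖ * (x i / ‖x‖) := fun i => HasWeakPartial.of_radial hN hR₀ hYac i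
  have g2 := fun i j => hasWeakPartial_radialHessian hN hR₀ hh i j
  have key : (∀ i, HasWeakPartial Ω i (fun x => Y ‖x‖) fun x => κ ‖x‖ * w ‖x‖ * (x i / ‖x‖)) ∧
      ∀ i j, HasWeakPartial Ω j (fun x => κ ‖x‖ * w ‖x‖ * (x i / ‖x‖))
        (radialHessian (fun r => κ r * w r) (fun r => κ r * q r) i j) := by
    rcases hΩ.2 with ⟨-, rfl⟩ | ⟨h0, hb⟩
    · exact ⟨g1, g2⟩
    obtain ⟨k, d, hd, hk⟩ := hκ0 h0
    rw [h0] at hd hk g1 g2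
    have hsub : Metric.ball (0 : EuclideanSpace ℝ (Fin N)) d ⊆ Metric.ball 0 R :=
      Metric.ball_subset_ball hd.2.le
    have hmono : ∀ {p : EuclideanSpace ℝ (Fin N) → Prop}, (∀ᵐ x ∂(volume.restrict Ω), p x) →
        ∀ᵐ x ∂(volume.restrict (annulus N 0 d)), p x := fun hp => by
      rw [hb] at hp
      exact ae_restrict_of_ae_restrict_of_subset ((annulus_subset_ball N 0 d).trans hsub) hp
    have hres : volume.restrict (Metric.ball (0 : EuclideanSpace ℝ (Fin N)) d) =
        volume.restrict (annulus N 0 d) := Measure.restrict_congr_set (ball_ae_eq_annulus hN d)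
    obtain ⟨s, hs⟩ := exists_between hd.1
    have hsm : s ∈ Ioo R₀ R := ⟨h0 ▸ hs.1, hs.2.trans hd.2⟩
    have hYV : ∀ r ∈ Ioo 0 d, Y r = k * V r + (Y s - k * V s) := by
      intro r hr
      have hrm : r ∈ Ioo R₀ R := ⟨h0 ▸ hr.1, hr.2.trans hd.2⟩
      have e1 := tail_split (fun r hr => (hY.1 r hr).1) hsm hrm
      have e2 := tail_split (fun r hr => (hDirV.1 r hr).1) hsm hrm
      have e3 : ∫ t in s..r, κ t * w t = k * ∫ t in s..r, w t := by
        rw [← intervalIntegral.integral_const_mul]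
        refine intervalIntegral.integral_congr fun t ht => ?_
        have ht' := uIcc_subset_Ioo (show s ∈ Ioo 0 d from hs) hr ht
        simp only [hk t ht']
      rw [(hY.1 r hrm).2, (hY.1 s hsm).2, (hDirV.1 r hrm).2, (hDirV.1 s hsm).2, e1, e2, e3]
      ring
    rw [hb]
    refine ⟨fun i => HasWeakPartial.glue_origin hd.1 ?_ (g1 i), fun i j =>
      HasWeakPartial.glue_origin hd.1 ?_ (g2 i j)⟩
    · have h1 := (((hu.1.1.2 i).1.mono (hb ▸ hsub)).affine k (Y s - k * V s))
      refine h1.congr ?_ ?_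
      · rw [EventuallyEq, hres]
        filter_upwards [hmono huV, ae_restrict_mem (measurableSet_annulus N 0 d)] with x h1 h2
        rw [h1, hYV _ h2]
      · rw [EventuallyEq, hres]
        filter_upwards [hmono (hD i), ae_restrict_mem (measurableSet_annulus N 0 d)] with x h1 h2
        rw [h1, hk _ h2, mul_assoc]
    · have h1 := ((((hu.1.2 i).2 j).1.mono (hb ▸ hsub)).affine k 0)
      refine h1.congr ?_ ?_
      · rw [EventuallyEq, hres]
        filter_upwards [hmono (hD i), ae_restrict_mem (measurableSet_annulus N 0 d)] with x h1 h2
        rw [h1, hk _ h2, mul_assoc, add_zero]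
      · rw [EventuallyEq, hres]
        filter_upwards [hmono (hD2 i j), ae_restrict_mem (measurableSet_annulus N 0 d)] with x h1 h2
        rw [h1, radialHessian_mul, hk _ h2]
  refine memHr_of_profile hN hR₀ hΩ.1 hΩ.isOpen hΩ.annulus_subset (hΩ.ae_eq_annulus hN)
    hΩ.ball_subset hYc hh.continuousOn hY key.1 key.2 ?_ fun i j => ?_
  · refine hwL.of_le ?_ (Eventually.of_forall fun x => ?_)
    · rw [hΩ.restrict_eq hN]
      exact aestronglyMeasurable_annulus_radial hN hR₀
        (hh.continuousOn.aestronglyMeasurable measurableSet_Ioo)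
    · rw [norm_mul]
      exact mul_le_of_le_one_left (norm_nonneg _) (hκ _)
  · have h1 := (memLp_congr_ae (hD2 i j)).1 ((hu.1.2 i).2 j).2
    refine h1.of_le ?_ (Eventually.of_forall fun x => ?_)
    · rw [hΩ.restrict_eq hN]
      exact (g2 i j).2.1.aestronglyMeasurable
    · rw [radialHessian_mul, norm_mul]
      exact mul_le_of_le_one_left (norm_nonneg _) (hκ _)

/-- The bound holds almost everywhere, and a nonempty open set on which the continuous profile
violates it would have positive measure. -/
theorem abs_profile_le_one (hN : 1 ≤ N) (hΩ : IsRadialDomain Ω R₀ R)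
    (hV : ContinuousOn V (Ioo R₀ R)) (huV : ∀ᵐ x ∂(volume.restrict Ω), u x = V ‖x‖)
    (hbound : eLpNorm u ⊤ (volume.restrict Ω) ≤ 1) : ∀ r ∈ Ioo R₀ R, |V r| ≤ 1 := by
  have h1 : ∀ᵐ x ∂(volume.restrict Ω), ‖u x‖ₑ ≤ 1 := by
    rw [eLpNorm_exponent_top] at hbound
    filter_upwards [enorm_ae_le_eLpNormEssSup u (volume.restrict Ω)] with x hx using hx.trans hbound
  rw [hΩ.restrict_eq hN] at h1 huV
  have hc : ContinuousOn (fun x : EuclideanSpace ℝ (Fin N) => V ‖x‖) (annulus N R₀ R) :=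
    hV.comp continuous_norm.continuousOn fun x hx => hx
  have ho : IsOpen (annulus N R₀ R ∩ (fun x => V ‖x‖) ⁻¹' {t | 1 < |t|}) :=
    hc.isOpen_inter_preimage (isOpen_annulus N R₀ R) (isOpen_lt continuous_const continuous_abs)
  have h0 : volume (annulus N R₀ R ∩ (fun x => V ‖x‖) ⁻¹' {t | 1 < |t|}) = 0 := by
    have h2 : ∀ᵐ x ∂(volume.restrict (annulus N R₀ R)), ¬ 1 < |V ‖x‖| := by
      filter_upwards [h1, huV] with x hx hxV
      rw [hxV, Real.enorm_eq_ofReal_abs, ENNReal.ofReal_le_one] at hx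
      exact not_lt.2 hx
    rw [ae_restrict_iff' (measurableSet_annulus N R₀ R)] at h2
    refine measure_mono_null (fun x hx => ?_) h2
    simp only [mem_compl_iff, mem_ofPred_eq, Classical.not_imp, not_not]
    exact hx
  have hempty := (ho.measure_eq_zero_iff volume).1 h0
  have := nontrivial_euclideanSpace hN
  intro r hr
  obtain ⟨x, hx⟩ := exists_norm_eq (EuclideanSpace ℝ (Fin N)) (hΩ.nonneg.trans hr.1.le)
  by_contra! hlt
  have : x ∈ annulus N R₀ R ∩ (fun x => V ‖x‖) ⁻¹' {t | 1 < |t|} :=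
    ⟨by rw [← hx] at hr; exact hr, by simpa [hx] using hlt⟩
  rw [hempty] at this
  exact this

/-- A radial minimizer coincides in absolute value with every competitor of this kind. -/
theorem eq_abs_of_minimizer (hN : 1 ≤ N) (hΩ : IsRadialDomain Ω R₀ R) {β : ℝ} (hβ : 0 < β)
    (hu : IsGlobalRadialMinimizer β Ω u)
    (hw : LocAC w q R₀ R) (hDirV : IsDirichletPrimitive V w R₀ R)
    (huV : ∀ᵐ x ∂(volume.restrict Ω), u x = V ‖x‖)
    (hD : ∀ i, weakPartial Ω i u =ᵐ[volume.restrict Ω] fun x => w ‖x‖ * (x i / ‖x‖))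
    (hD2 : ∀ i j, weakPartial Ω j (weakPartial Ω i u) =ᵐ[volume.restrict Ω] radialHessian w q i j)
    (hκ : ∀ r, |κ r| ≤ 1) (hh : LocAC (fun r => κ r * w r) (fun r => κ r * q r) R₀ R)
    (hY : IsDirichletPrimitive Y (fun r => κ r * w r) R₀ R)
    (hκ0 : R₀ = 0 → ∃ k, ∃ d ∈ Ioo R₀ R, ∀ r ∈ Ioo R₀ d, κ r = k)
    (hVY : ∀ r ∈ Ioo R₀ R, |V r| ≤ Y r) (hY1 : ∀ r ∈ Ioo R₀ R, Y r ≤ 1) :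
    ∀ r ∈ Ioo R₀ R, |V r| = Y r := by
  have hR₀ := hΩ.nonneg
  obtain ⟨hv, hvD, hvD2⟩ :=
    memHr_of_multiplier hN hΩ hu.1 hDirV huV hD hD2 hκ hh hY hκ0
  have hVc := hDirV.continuousOn hw.continuousOn
  have hYc := hY.continuousOn hh.continuousOn
  have hmeas : ∀ {f : ℝ → ℝ}, ContinuousOn f (Ioo R₀ R) →
      AEStronglyMeasurable (fun x : EuclideanSpace ℝ (Fin N) => f ‖x‖)
        (volume.restrict (annulus N R₀ R)) := fun hf =>
    aestronglyMeasurable_annulus_radial hN hR₀ (hf.aestronglyMeasurable measurableSet_Ioo)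
  have hbd : ∀ {f : ℝ → ℝ}, ContinuousOn f (Ioo R₀ R) → (∀ r ∈ Ioo R₀ R, |f r| ≤ 1) →
      ∀ p : ℝ≥0∞, MemLp (fun x : EuclideanSpace ℝ (Fin N) => f ‖x‖) p
        (volume.restrict (annulus N R₀ R)) := fun hf h1 p => by
    refine MemLp.of_bound (hmeas hf) 1 ?_
    filter_upwards [ae_restrict_mem (measurableSet_annulus N R₀ R)] with x hx using h1 _ hx
  have hYabs : ∀ r ∈ Ioo R₀ R, |Y r| ≤ 1 := fun r hr => by
    rw [abs_of_nonneg ((abs_nonneg _).trans (hVY r hr))]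
    exact hY1 r hr
  have hVabs : ∀ r ∈ Ioo R₀ R, |V r| ≤ 1 := fun r hr => (hVY r hr).trans (hY1 r hr)
  have hle := hu.2.2 _ hv (by
    rw [hΩ.restrict_eq hN]
    exact hbd hYc hYabs 4)
  have hae := hΩ.ae_eq_annulus hN
  rw [energy_eq_of_profile hR₀ hae huV hD hD2 β,
    energy_eq_of_profile hR₀ hae (Eventually.of_forall fun _ => rfl) hvD hvD2 β] at hle
  have hwL := memLp_radial_deriv hN hΩ hu.1.1.1 hD
  have hhL := memLp_radial_deriv (w := fun r => κ r * w r) hN hΩ hv.1.1 hvD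
  have hlap : ∀ {v : EuclideanSpace ℝ (Fin N) → ℝ} {h p : ℝ → ℝ}, MemHr Ω v →
      (∀ i j, weakPartial Ω j (weakPartial Ω i v) =ᵐ[volume.restrict Ω] radialHessian h p i j) →
      Integrable (fun x : EuclideanSpace ℝ (Fin N) => (p ‖x‖ + (N - 1) * (h ‖x‖ / ‖x‖)) ^ 2)
        (volume.restrict (annulus N R₀ R)) := by
    intro v h p hv hvD2
    have h1 : MemLp (fun x => ∑ i, radialHessian h p i i x) 2 (volume.restrict Ω) :=
      memLp_finsetSum _ fun i _ => (memLp_congr_ae (hvD2 i i)).1 ((hv.1.2 i).2 i).2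
    rw [hΩ.restrict_eq hN] at h1
    refine h1.integrable_sq.congr ?_
    filter_upwards [ae_restrict_mem (measurableSet_annulus N R₀ R)] with x hx
    rw [radialLaplacian (norm_pos_iff.1 (hR₀.trans_lt hx.1))]
  rw [hΩ.restrict_eq hN] at hwL hhL
  have hpot : ∀ {f : ℝ → ℝ}, ContinuousOn f (Ioo R₀ R) → (∀ r ∈ Ioo R₀ R, |f r| ≤ 1) →
      ∀ n : ℕ, Integrable (fun x : EuclideanSpace ℝ (Fin N) => f ‖x‖ ^ n)
        (volume.restrict (annulus N R₀ R)) := by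
    intro f hf h1 n
    refine memLp_one_iff_integrable.1 (hbd (f := fun r => f r ^ n) (hf.pow n) (fun r hr => ?_) 1)
    rw [abs_pow]
    exact pow_le_one₀ (abs_nonneg _) (h1 r hr)
  have hFi : ∀ {v : EuclideanSpace ℝ (Fin N) → ℝ} {A h p : ℝ → ℝ}, MemHr Ω v →
      (∀ i j, weakPartial Ω j (weakPartial Ω i v) =ᵐ[volume.restrict Ω] radialHessian h p i j) →
      ContinuousOn A (Ioo R₀ R) → (∀ r ∈ Ioo R₀ R, |A r| ≤ 1) →
      MemLp (fun x : EuclideanSpace ℝ (Fin N) => h ‖x‖) 2 (volume.restrict (annulus N R₀ R)) →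
      Integrable (fun x : EuclideanSpace ℝ (Fin N) => (p ‖x‖ + (N - 1) * (h ‖x‖ / ‖x‖)) ^ 2 / 2 +
        β * h ‖x‖ ^ 2 / 2 + A ‖x‖ ^ 4 / 4 - A ‖x‖ ^ 2 / 2)
        (volume.restrict (annulus N R₀ R)) := fun hv h2 hA hA1 hh =>
    ((((hlap hv h2).div_const 2).add ((hh.integrable_sq.const_mul β).div_const 2)).add
      ((hpot hA hA1 4).div_const 4)).sub ((hpot hA hA1 2).div_const 2)
  have i1 := hFi hu.1 hD2 hVc hVabs hwL
  have i2 := hFi hv hvD2 hYc hYabs hhL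
  -- The quadratic terms are multiplied by `κ² ≤ 1` and can be discarded. The left side is exactly
  -- the difference of the potential terms, factorized; it is nonnegative because `V² ≤ Y² ≤ 1`.
  have hcmp : ∀ x : EuclideanSpace ℝ (Fin N),
      (Y ‖x‖ ^ 2 - V ‖x‖ ^ 2) * (2 - Y ‖x‖ ^ 2 - V ‖x‖ ^ 2) / 4 ≤
      ((q ‖x‖ + (N - 1) * (w ‖x‖ / ‖x‖)) ^ 2 / 2 + β * w ‖x‖ ^ 2 / 2 + V ‖x‖ ^ 4 / 4 -
        V ‖x‖ ^ 2 / 2) -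
      ((κ ‖x‖ * q ‖x‖ + (N - 1) * (κ ‖x‖ * w ‖x‖ / ‖x‖)) ^ 2 / 2 + β * (κ ‖x‖ * w ‖x‖) ^ 2 / 2 +
        Y ‖x‖ ^ 4 / 4 - Y ‖x‖ ^ 2 / 2) := by
    intro x
    have hk : κ ‖x‖ ^ 2 ≤ 1 := (sq_le_one_iff_abs_le_one _).2 (hκ _)
    have e1 : (κ ‖x‖ * q ‖x‖ + (N - 1) * (κ ‖x‖ * w ‖x‖ / ‖x‖)) ^ 2 =
        κ ‖x‖ ^ 2 * (q ‖x‖ + (N - 1) * (w ‖x‖ / ‖x‖)) ^ 2 := by ring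
    have h1 := mul_le_of_le_one_left (sq_nonneg (q ‖x‖ + (N - 1) * (w ‖x‖ / ‖x‖))) hk
    have h2 := mul_le_of_le_one_left (mul_nonneg hβ.le (sq_nonneg (w ‖x‖))) hk
    rw [e1]
    nlinarith
  set D : ℝ → ℝ := fun r => (Y r ^ 2 - V r ^ 2) * (2 - Y r ^ 2 - V r ^ 2) / 4 with hDdef
  have hDc : ContinuousOn D (Ioo R₀ R) := by fun_prop
  have hsq : ∀ r ∈ Ioo R₀ R, V r ^ 2 ≤ Y r ^ 2 ∧ Y r ^ 2 ≤ 1 ∧ V r ^ 2 ≤ 1 := fun r hr => by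
    refine ⟨?_, (sq_le_one_iff_abs_le_one _).2 (hYabs r hr),
      (sq_le_one_iff_abs_le_one _).2 (hVabs r hr)⟩
    rw [← sq_abs (V r)]
    exact pow_le_pow_left₀ (abs_nonneg _) (hVY r hr) 2
  have hD0 : ∀ r ∈ Ioo R₀ R, 0 ≤ D r := fun r hr => by
    obtain ⟨h1, h2, h3⟩ := hsq r hr
    exact div_nonneg (mul_nonneg (by linarith) (by linarith)) (by norm_num)
  have hDi : IntegrableOn (fun x : EuclideanSpace ℝ (Fin N) => D ‖x‖) (annulus N R₀ R) := by
    refine memLp_one_iff_integrable.1 (hbd hDc (fun r hr => ?_) 1)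
    obtain ⟨h1, h2, h3⟩ := hsq r hr
    rw [abs_of_nonneg (hD0 r hr)]
    simp only [hDdef]
    nlinarith [sq_nonneg (Y r), sq_nonneg (V r)]
  have hint0 : ∫ x in annulus N R₀ R, D ‖x‖ ≤ 0 := by
    refine (integral_mono hDi (i1.sub i2) hcmp).trans ?_
    rw [integral_sub' i1 i2]
    exact sub_nonpos.2 hle
  rw [integral_annulus_radial hN hR₀] at hint0
  have hDi' := (integrableOn_annulus_radial hN hR₀ D).1 hDi
  have hnn : 0 ≤ᵐ[volume.restrict (Ioo R₀ R)] fun r => r ^ (N - 1) * D r := by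
    filter_upwards [ae_restrict_mem measurableSet_Ioo] with r hr
    exact mul_nonneg (pow_nonneg (hR₀.trans hr.1.le) _) (hD0 r hr)
  have hz : ∫ r in Ioo R₀ R, r ^ (N - 1) * D r = 0 :=
    le_antisymm (nonpos_of_mul_nonpos_right hint0 (sphereArea_pos hN)) (integral_nonneg_of_ae hnn)
  have hz' := (setIntegral_eq_zero_iff_of_nonneg_ae hnn hDi').1 hz
  have heq : EqOn (fun r => r ^ (N - 1) * D r) (fun _ => (0 : ℝ)) (Ioo R₀ R) :=
    Measure.eqOn_open_of_ae_eq hz' isOpen_Ioo (by fun_prop) continuousOn_const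
  intro r hr
  have h1 := heq hr
  have hr0 : 0 < r := hR₀.trans_lt hr.1
  have h2 : D r = 0 := by
    rcases mul_eq_zero.1 h1 with h | h
    · exact absurd h (pow_pos hr0 _).ne'
    · exact h
  obtain ⟨h3, h4, h5⟩ := hsq r hr
  have h6 : V r ^ 2 = Y r ^ 2 := by
    have h7 : (Y r ^ 2 - V r ^ 2) * (2 - Y r ^ 2 - V r ^ 2) = 0 := by
      simp only [hDdef] at h2
      linarith
    -- If the second factor vanishes, then `V² = Y² = 1`, since both squares are at most one.
    rcases mul_eq_zero.1 h7 with h | h <;> linarith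
  rw [← abs_of_nonneg ((abs_nonneg _).trans (hVY r hr))]
  exact (sq_eq_sq_iff_abs_eq_abs _ _).1 h6

end Competitor

/-! ### From the modulus to the sign. -/

section Sign

variable {V w : ℝ → ℝ} {R₀ R r₀ : ℝ}

/-- A function whose absolute value increases up to `r₀` and decreases afterwards has one sign. -/
theorem exists_sign_of_unimodal_abs (hV : ∀ r ∈ Ioo R₀ R, HasDerivAt V (w r) r)
    (hmono : MonotoneOn (fun r => |V r|) (Ioc R₀ r₀ ∩ Ioo R₀ R))
    (hanti : AntitoneOn (fun r => |V r|) (Ico r₀ R ∩ Ioo R₀ R)) :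
    ∃ σ : ℝ, (σ = 1 ∨ σ = -1) ∧ (∀ r ∈ Ioo R₀ R, 0 ≤ σ * V r) ∧
      (∀ r ∈ Ioo R₀ R, r < r₀ → 0 ≤ σ * w r) ∧ ∀ r ∈ Ioo R₀ R, r₀ < r → σ * w r ≤ 0 := by
  have hc : ContinuousOn V (Ioo R₀ R) := fun r hr => (hV r hr).continuousAt.continuousWithinAt
  -- Unimodality spreads a zero of `V` away from `r₀`: all values further out on the same side of
  -- `r₀` vanish as well. So no strict sign change can occur.
  have hzero : ∀ x ∈ Ioo R₀ R, ∀ y ∈ Ioo R₀ R, x ≤ y → 0 ∈ uIcc (V x) (V y) → V x = 0 ∨ V y = 0 := by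
    intro x hx y hy hxy h0
    obtain ⟨z, hz, hz0⟩ := intermediate_value_uIcc (hc.mono (uIcc_subset_Ioo hx hy)) h0
    rw [uIcc_of_le hxy] at hz
    have hzm : z ∈ Ioo R₀ R := ⟨hx.1.trans_le hz.1, hz.2.trans_lt hy.2⟩
    rcases le_total z r₀ with h | h
    · left
      have := hmono ⟨⟨hx.1, hz.1.trans h⟩, hx⟩ ⟨⟨hzm.1, h⟩, hzm⟩ hz.1
      simpa [hz0] using this
    · right
      have := hanti ⟨⟨h, hzm.2⟩, hzm⟩ ⟨⟨h.trans hz.2, hy.2⟩, hy⟩ hz.2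
      simpa [hz0] using this
  have hsign : (∀ r ∈ Ioo R₀ R, 0 ≤ V r) ∨ ∀ r ∈ Ioo R₀ R, V r ≤ 0 := by
    by_contra! hcon
    obtain ⟨⟨x, hx, hVx⟩, y, hy, hVy⟩ := hcon
    rcases le_total x y with h | h
    · rcases hzero x hx y hy h (by rw [uIcc_of_le (by linarith)]; exact ⟨hVx.le, hVy.le⟩) with h | h <;>
        linarith
    · rcases hzero y hy x hx h (by rw [uIcc_of_ge (by linarith)]; exact ⟨hVx.le, hVy.le⟩) with h | h <;>
        linarith
  have key : ∀ σ : ℝ, (σ = 1 ∨ σ = -1) → (∀ r ∈ Ioo R₀ R, 0 ≤ σ * V r) →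
      (∀ r ∈ Ioo R₀ R, r < r₀ → 0 ≤ σ * w r) ∧ ∀ r ∈ Ioo R₀ R, r₀ < r → σ * w r ≤ 0 := by
    intro σ hσ hpos
    have habs : ∀ r ∈ Ioo R₀ R, |V r| = σ * V r := fun r hr => by
      rw [← abs_of_nonneg (hpos r hr), abs_mul]
      rcases hσ with rfl | rfl <;> simp
    have hder : ∀ r ∈ Ioo R₀ R, HasDerivAt (fun r => |V r|) (σ * w r) r := fun r hr => by
      refine ((hV r hr).const_mul σ).congr_of_eventuallyEq ?_
      filter_upwards [isOpen_Ioo.mem_nhds hr] with s hs using habs s hs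
    refine ⟨fun r hr hlt => ?_, fun r hr hlt => ?_⟩
    · have hm : Ioo R₀ (min r₀ R) ∈ 𝓝 r := isOpen_Ioo.mem_nhds ⟨hr.1, lt_min hlt hr.2⟩
      have h1 : MonotoneOn (fun r => |V r|) (Ioo R₀ (min r₀ R)) := hmono.mono fun s hs =>
        ⟨⟨hs.1, (hs.2.trans_le (min_le_left _ _)).le⟩, hs.1, hs.2.trans_le (min_le_right _ _)⟩
      have h2 := h1.derivWithin_nonneg (x := r)
      rwa [derivWithin_of_mem_nhds hm, (hder r hr).deriv] at h2
    · have hm : Ioo (max r₀ R₀) R ∈ 𝓝 r := isOpen_Ioo.mem_nhds ⟨max_lt hlt hr.1, hr.2⟩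
      have h1 : AntitoneOn (fun r => |V r|) (Ioo (max r₀ R₀) R) := hanti.mono fun s hs =>
        ⟨⟨((le_max_left _ _).trans_lt hs.1).le, hs.2⟩, (le_max_right _ _).trans_lt hs.1, hs.2⟩
      have h2 := h1.derivWithin_nonpos (x := r)
      rwa [derivWithin_of_mem_nhds hm, (hder r hr).deriv] at h2
  rcases hsign with h | h
  · have h' : ∀ r ∈ Ioo R₀ R, 0 ≤ 1 * V r := fun r hr => by simpa using h r hr
    exact ⟨1, Or.inl rfl, h', key 1 (Or.inl rfl) h'⟩
  · have h' : ∀ r ∈ Ioo R₀ R, 0 ≤ -1 * V r := fun r hr => by simpa using h r hr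
    exact ⟨-1, Or.inr rfl, h', key (-1) (Or.inr rfl) h'⟩

end Sign

/-! ### Monotonicity in the ball, unimodality in the annulus. -/

section Unimodality

variable {N : ℕ} {Ω : Set (EuclideanSpace ℝ (Fin N))} {R₀ R : ℝ}
  {u : EuclideanSpace ℝ (Fin N) → ℝ} {V w q : ℝ → ℝ}

/-- The supremum `M` of `|V|` over the open interval may be approached only at the origin. If the
tail integral `L` of `|w|` reaches `M`, the rearrangement is a competitor. Otherwise `|V| = L`, as a
positive deficit `L - |V|` at some `r` would keep `|V|` away from `M`. -/
theorem antitoneOn_abs_of_minimizer (hN : 1 ≤ N) (hΩ : IsRadialDomain Ω 0 R) {β : ℝ} (hβ : 0 < β)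
    (hu : IsGlobalRadialMinimizer β Ω u)
    (hw : LocAC w q 0 R) (hDirV : IsDirichletPrimitive V w 0 R)
    (huV : ∀ᵐ x ∂(volume.restrict Ω), u x = V ‖x‖)
    (hD : ∀ i, weakPartial Ω i u =ᵐ[volume.restrict Ω] fun x => w ‖x‖ * (x i / ‖x‖))
    (hD2 : ∀ i j, weakPartial Ω j (weakPartial Ω i u) =ᵐ[volume.restrict Ω] radialHessian w q i j)
    (hV1 : ∀ r ∈ Ioo 0 R, |V r| ≤ 1) : AntitoneOn (fun r => |V r|) (Ioo 0 R) := by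
  have hint := fun r hr => (hDirV.1 r hr).1
  have hVabs : ∀ r ∈ Ioo 0 R, |V r| = |∫ t in r..R, w t| := fun r hr => by
    rw [(hDirV.1 r hr).2, abs_neg]
  have hbdd : BddAbove ((fun r => |V r|) '' Ioo 0 R) := ⟨1, by
    rintro _ ⟨r, hr, rfl⟩
    exact hV1 r hr⟩
  have hnon : ((fun r => |V r|) '' Ioo 0 R).Nonempty := (nonempty_Ioo.2 hΩ.1).image _
  set M := sSup ((fun r => |V r|) '' Ioo 0 R) with hMdef
  have hVM : ∀ r ∈ Ioo 0 R, |V r| ≤ M := fun r hr => le_csSup hbdd ⟨r, hr, rfl⟩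
  have hM1 : M ≤ 1 := csSup_le hnon (by
    rintro _ ⟨r, hr, rfl⟩
    exact hV1 r hr)
  have hM0 : 0 ≤ M := by
    obtain ⟨r, hr⟩ := nonempty_Ioo.2 hΩ.1
    exact (abs_nonneg _).trans (hVM r hr)
  rcases hM0.eq_or_lt with h0 | hM
  · intro x hx y hy _
    simp only
    rw [abs_nonpos_iff.1 ((hVM y hy).trans_eq h0.symm), abs_zero]
    exact abs_nonneg _
  by_cases hL : ∃ r ∈ Ioo 0 R, M ≤ ∫ t in r..R, |w t|
  · obtain ⟨κ, hκ1, hκw, hκac, ⟨k, d, hd, hk⟩, hκV, -⟩ := exists_monotone_rearrangement hw hint hM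
      (fun r hr => (hVabs r hr) ▸ hVM r hr) hL
    have hac : LocAC (fun r => -κ r * w r) (fun r => -κ r * q r) 0 R := by
      have := hκac.const_mul (-1)
      simpa only [neg_mul, one_mul] using this
    have hY : IsDirichletPrimitive (fun r => ∫ t in r..R, κ t * w t) (fun r => -κ r * w r) 0 R := by
      refine ⟨fun r hr => ?_, fun h => absurd h (lt_irrefl _)⟩
      simp only [neg_mul, intervalIntegral.integral_neg, neg_neg]
      exact ⟨(hκV r hr).1.neg, trivial⟩
    have heq := eq_abs_of_minimizer (κ := fun r => -κ r) hN hΩ hβ hu hw hDirV huV hD hD2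
      (fun r => by rw [abs_neg]; exact hκ1 r) hac hY
      (fun _ => ⟨-k, d, hd, fun r hr => by rw [hk r hr]⟩)
      (fun r hr => (hVabs r hr).trans_le (hκV r hr).2.1) fun r hr => (hκV r hr).2.2.trans hM1
    have hanti : AntitoneOn (fun r => ∫ t in r..R, κ t * w t) (Ioo 0 R) := by
      refine antitoneOn_of_deriv_nonpos (convex_Ioo 0 R) (hY.continuousOn hac.continuousOn)
        (fun r hr => ?_) fun r hr => ?_
      · rw [interior_Ioo] at hr
        exact (hY.hasDerivAt hac.continuousOn hr).differentiableAt.differentiableWithinAt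
      · rw [interior_Ioo] at hr
        rw [(hY.hasDerivAt hac.continuousOn hr).deriv, neg_mul]
        exact neg_nonpos.2 (hκw r)
    exact hanti.congr fun r hr => (heq r hr).symm
  · push Not at hL
    have heq : ∀ r ∈ Ioo 0 R, |V r| = ∫ t in r..R, |w t| := by
      intro r hr
      refine le_antisymm ((hVabs r hr).trans_le (abs_tail_le hr.2.le)) ?_
      by_contra! hlt
      -- To the left of `r` the modulus of `V` grows at most as much as `L`, so the deficit
      -- persists; to the right `|V| ≤ L r < M`.
      have : M ≤ max (M - ((∫ t in r..R, |w t|) - |V r|)) (∫ t in r..R, |w t|) := by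
        refine csSup_le hnon ?_
        rintro _ ⟨s, hs, rfl⟩
        rcases le_total s r with h | h
        · refine le_max_of_le_left ?_
          have h1 := abs_tail_sub_le hint hs hr h
          have h2 := abs_sub_abs_le_abs_sub (∫ t in s..R, w t) (∫ t in r..R, w t)
          have h3 := hL s hs
          simp only
          rw [hVabs s hs, hVabs r hr]
          linarith
        · refine le_max_of_le_right ?_
          exact (hVabs s hs).trans_le ((abs_tail_le hs.2.le).trans
            (tail_abs_anti hint hr h hs.2.le))
      rcases le_max_iff.1 this with h | h
      · linarith
      · exact absurd (hL r hr) (not_lt.2 h)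
    intro x hx y hy hxy
    simp only
    rw [heq x hx, heq y hy]
    exact tail_abs_anti hint hx hxy hy.2.le

/-- The derivative `w` vanishes at a maximum point `r₀` of `|V|`, and the integrals of `|w|` on
either side of `r₀` are at least `M`. So each one-sided rearrangement has reached `M` at `r₀` and
its factor vanishes beyond `r₀`. The right one is built directly, the left one by reflection, and
they fit together at `r₀`. -/
theorem exists_unimodal_rearrangement (hR : R₀ < R) (h0 : 0 < R₀)
    (hw : LocAC w q R₀ R) (hDirV : IsDirichletPrimitive V w R₀ R)
    (hne : ∃ r ∈ Ioo R₀ R, V r ≠ 0) (hV1 : ∀ r ∈ Ioo R₀ R, |V r| ≤ 1) :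
    ∃ r₀ ∈ Ioo R₀ R, V r₀ ≠ 0 ∧ ∃ κ Y : ℝ → ℝ, (∀ r, |κ r| ≤ 1) ∧
      (∀ r ≤ r₀, 0 ≤ κ r * w r) ∧ (∀ r, r₀ ≤ r → κ r * w r ≤ 0) ∧
      LocAC (fun r => κ r * w r) (fun r => κ r * q r) R₀ R ∧
      IsDirichletPrimitive Y (fun r => κ r * w r) R₀ R ∧
      ∀ r ∈ Ioo R₀ R, |V r| ≤ Y r ∧ Y r ≤ 1 := by
  obtain ⟨hwi, hwz⟩ := hDirV.2 h0
  have hsubI : ∀ {f : ℝ → ℝ}, IntervalIntegrable f volume R₀ R → ∀ {x y : ℝ}, x ∈ Icc R₀ R →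
      y ∈ Icc R₀ R → IntervalIntegrable f volume x y := fun hf x y hx hy =>
    hf.mono_set (by
      rw [uIcc_of_le hR.le]
      exact ordConnected_Icc.uIcc_subset hx hy)
  have hl : R₀ ∈ Icc R₀ R := left_mem_Icc.2 hR.le
  have hr : R ∈ Icc R₀ R := right_mem_Icc.2 hR.le
  have hint := fun r hr => (hDirV.1 r hr).1
  have hwc := hw.continuousOn
  -- the maximum of the absolute value
  have hVe : ContinuousOn (fun r => |∫ t in r..R, w t|) (Icc R₀ R) := by
    have h1 : IntegrableOn w (uIcc R₀ R) := by
      rw [uIcc_of_le hR.le, integrableOn_Icc_iff_integrableOn_Ioc]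
      exact (intervalIntegrable_iff_integrableOn_Ioc_of_le hR.le).1 hwi
    have := intervalIntegral.continuousOn_primitive_interval_left h1
    rw [uIcc_of_le hR.le] at this
    exact this.abs
  have hVabs : ∀ r ∈ Ioo R₀ R, |V r| = |∫ t in r..R, w t| := fun r hr => by
    rw [(hDirV.1 r hr).2, abs_neg]
  obtain ⟨r₀, hr₀I, hmax⟩ := isCompact_Icc.exists_isMaxOn ⟨R, hr⟩ hVe
  set M := |∫ t in r₀..R, w t| with hMdef
  have hM : 0 < M := by
    obtain ⟨s, hs, hs0⟩ := hne
    have h1 : |∫ t in s..R, w t| ≤ M := hmax (Ioo_subset_Icc_self hs)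
    rw [← hVabs s hs] at h1
    exact (abs_pos.2 hs0).trans_le h1
  have hr₀ : r₀ ∈ Ioo R₀ R := by
    refine ⟨lt_of_le_of_ne hr₀I.1 fun h => ?_, lt_of_le_of_ne hr₀I.2 fun h => ?_⟩
    · rw [hMdef, ← h, hwz, abs_zero] at hM
      exact lt_irrefl _ hM
    · rw [hMdef, h, intervalIntegral.integral_same, abs_zero] at hM
      exact lt_irrefl _ hM
  have hVM : ∀ r ∈ Ioo R₀ R, |∫ t in r..R, w t| ≤ M := fun r hr => hmax (Ioo_subset_Icc_self hr)
  have hM1 : M ≤ 1 := (hVabs r₀ hr₀).symm.trans_le (hV1 r₀ hr₀)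
  have hwr₀ : w r₀ = 0 := by
    have hev : ∀ᶠ r in 𝓝 r₀, |∫ t in r..R, w t| ≤ M := by
      filter_upwards [isOpen_Ioo.mem_nhds hr₀] with r hr using hVM r hr
    have hext : IsLocalExtr (fun r => ∫ t in r..R, w t) r₀ := by
      rcases abs_choice (∫ t in r₀..R, w t) with h | h
      · right
        filter_upwards [hev] with r hr
        rw [← h]
        exact (abs_le.1 hr).2
      · left
        filter_upwards [hev] with r hr
        have : (∫ t in r₀..R, w t) = -M := by linarith
        rw [this]
        exact (abs_le.1 hr).1
    have := hext.hasDerivAt_eq_zero (hasDerivAt_tail hwc hint hr₀)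
    linarith
  -- the right half
  obtain ⟨κR, hR1, hRw, hRac, -, hRV, hRz⟩ := exists_monotone_rearrangement hw hint hM hVM
    ⟨r₀, hr₀, abs_tail_le hr₀.2.le⟩
  obtain ⟨hR0, hRM⟩ := hRz r₀ hr₀ hwr₀ (abs_tail_le hr₀.2.le)
  -- the left half
  have hrefl : ∀ f : ℝ → ℝ, ∀ r, ∫ t in r..R, f (R₀ + R - t) = ∫ t in R₀..(R₀ + R - r), f t := by
    intro f r
    rw [intervalIntegral.integral_comp_sub_left, add_sub_cancel_right]
  have hmem : ∀ {r}, r ∈ Ioo R₀ R → R₀ + R - r ∈ Ioo R₀ R := fun hr =>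
    ⟨by linarith [hr.2], by linarith [hr.1]⟩
  have hhead : ∀ r ∈ Icc R₀ R, ∫ t in R₀..r, w t = -∫ t in r..R, w t := fun r hr' => by
    have := intervalIntegral.integral_add_adjacent_intervals (hsubI hwi hl hr') (hsubI hwi hr' hr)
    linarith
  have hw' : LocAC (fun r => w (R₀ + R - r)) (fun r => -q (R₀ + R - r)) R₀ R := by
    have := hw.reflect (R₀ + R)
    rwa [add_sub_cancel_right, add_sub_cancel_left] at this
  have hint' : ∀ r ∈ Ioo R₀ R, IntervalIntegrable (fun t => w (R₀ + R - t)) volume r R := by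
    intro r hr'
    have := (hsubI hwi (Ioo_subset_Icc_self (hmem hr')) hl).comp_sub_left (R₀ + R)
    simpa using this
  have hVM' : ∀ r ∈ Ioo R₀ R, |∫ t in r..R, w (R₀ + R - t)| ≤ M := fun r hr => by
    rw [hrefl w, hhead _ (Ioo_subset_Icc_self (hmem hr)), abs_neg]
    exact hVM _ (hmem hr)
  have hz' : M ≤ ∫ t in (R₀ + R - r₀)..R, |w (R₀ + R - t)| := by
    rw [hrefl fun t => |w t|, sub_sub_cancel, hMdef, ← abs_neg, ← hhead r₀ hr₀I]
    exact intervalIntegral.abs_integral_le_integral_abs hr₀.1.le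
  obtain ⟨κL, hL1, hLw, hLac, -, hLV, hLz⟩ := exists_monotone_rearrangement hw' hint' hM hVM'
    ⟨_, hmem hr₀, hz'⟩
  obtain ⟨hL0, hLM⟩ := hLz _ (hmem hr₀) (by rw [sub_sub_cancel]; exact hwr₀) hz'
  set κ' : ℝ → ℝ := fun r => κL (R₀ + R - r) with hκ'
  have hκ'0 : ∀ r, r₀ ≤ r → κ' r = 0 := fun r hr => hL0 _ (by linarith)
  have hκ'w : ∀ r, 0 ≤ κ' r * w r := fun r => by
    have := hLw (R₀ + R - r)
    rwa [sub_sub_cancel] at this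
  have hκ'ac : LocAC (fun r => κ' r * w r) (fun r => κ' r * q r) R₀ R := by
    have := hLac.reflect (R₀ + R)
    rw [add_sub_cancel_right, add_sub_cancel_left] at this
    simpa only [sub_sub_cancel, mul_neg, neg_neg] using this
  have hbound : ∀ {κ p : ℝ → ℝ}, (∀ r, |κ r| ≤ 1) → LocAC (fun r => κ r * w r) p R₀ R →
      IntervalIntegrable (fun r => κ r * w r) volume R₀ R := by
    intro κ p hκ hac
    rw [intervalIntegrable_iff_integrableOn_Ioo_of_le hR.le] at hwi ⊢
    refine Integrable.mono hwi (hac.continuousOn.aestronglyMeasurable measurableSet_Ioo)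
      (Eventually.of_forall fun r => ?_)
    rw [norm_mul]
    exact mul_le_of_le_one_left (norm_nonneg _) (hκ r)
  have hiL := hbound (fun r => hL1 (R₀ + R - r)) hκ'ac
  have hiR := hbound hR1 hRac
  have hLhead : ∀ r, ∫ t in R₀..r, κ' t * w t =
      ∫ t in (R₀ + R - r)..R, κL t * w (R₀ + R - t) := fun r => by
    have := hrefl (fun t => κ' t * w t) (R₀ + R - r)
    rw [sub_sub_cancel] at this
    rw [← this]
    simp only [hκ', sub_sub_cancel]
  have hLr₀ : ∫ t in R₀..r₀, κ' t * w t = M := by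
    rw [hLhead]
    exact hLM
  have hLtail : ∀ r, r₀ ≤ r → r ≤ R → ∫ t in r..R, κ' t * w t = 0 := fun r h1 h2 => by
    refine intervalIntegral.integral_zero_ae (Eventually.of_forall fun t ht => ?_)
    rw [uIoc_of_le h2] at ht
    rw [hκ'0 t (h1.trans ht.1.le), zero_mul]
  have hLtot : ∫ t in R₀..R, κ' t * w t = M := by
    rw [← intervalIntegral.integral_add_adjacent_intervals (hsubI hiL hl hr₀I) (hsubI hiL hr₀I hr),
      hLr₀, hLtail r₀ le_rfl hr₀.2.le, add_zero]
  have hRhead : ∀ r ≤ r₀, ∫ t in r..r₀, κR t * w t = 0 := fun r h => by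
    refine intervalIntegral.integral_zero_ae (Eventually.of_forall fun t ht => ?_)
    rw [uIoc_of_le h] at ht
    rw [hR0 t ht.2, zero_mul]
  have hRtail : ∀ r ∈ Icc R₀ r₀, ∫ t in r..R, κR t * w t = M := fun r h => by
    rw [← intervalIntegral.integral_add_adjacent_intervals
      (hsubI hiR ⟨h.1, h.2.trans hr₀.2.le⟩ hr₀I) (hsubI hiR hr₀I hr), hRhead r h.2, hRM, zero_add]
  -- The climb on the left and the descent on the right both amount to `M`, so `(κ' - κR) w` has
  -- integral zero and the Dirichlet condition at `R₀` holds.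
  have hκw : ∀ r, (κ' r - κR r) * w r = κ' r * w r - κR r * w r := fun r => sub_mul _ _ _
  refine ⟨r₀, hr₀, fun h => ?_, fun r => κ' r - κR r, fun r => -∫ t in r..R, (κ' t - κR t) * w t,
    fun r => ?_, fun r hr => ?_, fun r hr => ?_, ?_, ⟨fun r hr' => ?_, fun _ => ?_⟩,
    fun r hr' => ?_⟩
  · rw [hMdef, ← hVabs r₀ hr₀, h, abs_zero] at hM
    exact lt_irrefl _ hM
  · simp only
    rcases le_total r r₀ with h | h
    · rw [hR0 r h, sub_zero]
      exact hL1 _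
    · rw [hκ'0 r h, zero_sub, abs_neg]
      exact hR1 _
  · simp only
    rw [hR0 r hr, sub_zero]
    exact hκ'w r
  · simp only
    rw [hκ'0 r hr, zero_sub, neg_mul]
    exact neg_nonpos.2 (hRw r)
  · have := hκ'ac.add (hRac.const_mul (-1))
    refine (this.congr_fun fun r _ => ?_).congr_deriv (Eventually.of_forall fun r _ => ?_)
    · simp only
      ring
    · ring
  · refine ⟨?_, rfl⟩
    simp only [hκw]
    have hrI := Ioo_subset_Icc_self hr'
    exact (hsubI hiL hrI hr).sub (hsubI hiR hrI hr)
  · simp only [hκw]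
    refine ⟨hiL.sub hiR, ?_⟩
    rw [intervalIntegral.integral_sub hiL hiR, hLtot, hRtail R₀ (left_mem_Icc.2 hr₀.1.le), sub_self]
  · have hrI := Ioo_subset_Icc_self hr'
    simp only [hκw]
    rw [intervalIntegral.integral_sub (hsubI hiL hrI hr) (hsubI hiR hrI hr), hVabs r hr']
    rcases le_total r r₀ with h | h
    · have h1 := intervalIntegral.integral_add_adjacent_intervals (hsubI hiL hl hrI)
        (hsubI hiL hrI hr)
      have h2 : -((∫ t in r..R, κ' t * w t) - ∫ t in r..R, κR t * w t) =
          ∫ t in R₀..r, κ' t * w t := by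
        rw [hRtail r ⟨hr'.1.le, h⟩]
        linarith
      have h3 := (hLV _ (hmem hr')).2
      rw [hrefl w, sub_sub_cancel, hhead r hrI, abs_neg] at h3
      rw [h2, hLhead]
      exact ⟨h3.1, h3.2.trans hM1⟩
    · rw [hLtail r h hr'.2.le, zero_sub, neg_neg]
      exact ⟨(hRV r hr').2.1, (hRV r hr').2.2.trans hM1⟩

theorem unimodal_abs_of_minimizer (hN : 1 ≤ N) (h0 : 0 < R₀) (hΩ : IsRadialDomain Ω R₀ R) {β : ℝ}
    (hβ : 0 < β) (hu : IsGlobalRadialMinimizer β Ω u)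
    (hw : LocAC w q R₀ R) (hDirV : IsDirichletPrimitive V w R₀ R)
    (huV : ∀ᵐ x ∂(volume.restrict Ω), u x = V ‖x‖)
    (hD : ∀ i, weakPartial Ω i u =ᵐ[volume.restrict Ω] fun x => w ‖x‖ * (x i / ‖x‖))
    (hD2 : ∀ i j, weakPartial Ω j (weakPartial Ω i u) =ᵐ[volume.restrict Ω] radialHessian w q i j)
    (hne : ∃ r ∈ Ioo R₀ R, V r ≠ 0) (hV1 : ∀ r ∈ Ioo R₀ R, |V r| ≤ 1) :
    ∃ r₀ ∈ Ioo R₀ R, V r₀ ≠ 0 ∧ MonotoneOn (fun r => |V r|) (Ioc R₀ r₀) ∧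
      AntitoneOn (fun r => |V r|) (Ico r₀ R) := by
  obtain ⟨r₀, hr₀, hVr₀, κ, Y, hκ1, hκL, hκR, hac, hY, hVY⟩ :=
    exists_unimodal_rearrangement hΩ.1 h0 hw hDirV hne hV1
  have heq := eq_abs_of_minimizer hN hΩ hβ hu hw hDirV huV hD hD2 hκ1 hac hY
    (fun h => absurd h h0.ne') (fun r hr => (hVY r hr).1) fun r hr => (hVY r hr).2
  have hder := fun r hr => hY.hasDerivAt (r := r) hac.continuousOn hr
  have hYc := hY.continuousOn hac.continuousOn
  have hs1 : Ioc R₀ r₀ ⊆ Ioo R₀ R := fun r hr => ⟨hr.1, hr.2.trans_lt hr₀.2⟩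
  have hs2 : Ico r₀ R ⊆ Ioo R₀ R := fun r hr => ⟨hr₀.1.trans_le hr.1, hr.2⟩
  refine ⟨r₀, hr₀, hVr₀, ?_, ?_⟩
  · refine (monotoneOn_of_deriv_nonneg (convex_Ioc R₀ r₀) (hYc.mono hs1) (fun r hr => ?_)
      fun r hr => ?_).congr fun r hr => (heq r (hs1 hr)).symm
    · exact (hder r (hs1 (interior_subset hr))).differentiableAt.differentiableWithinAt
    · rw [(hder r (hs1 (interior_subset hr))).deriv]
      exact hκL r (interior_subset hr).2
  · refine (antitoneOn_of_deriv_nonpos (convex_Ico r₀ R) (hYc.mono hs2) (fun r hr => ?_)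
      fun r hr => ?_).congr fun r hr => (heq r (hs2 hr)).symm
    · exact (hder r (hs2 (interior_subset hr))).differentiableAt.differentiableWithinAt
    · rw [(hder r (hs2 (interior_subset hr))).deriv]
      exact hκR r (interior_subset hr).1

end Unimodality

/-! ### The radial solution operator of the annulus. -/

/-- The radial harmonic function `∫_{R₀}^r s^{1-N} ds` on `r ≥ R₀`. -/
noncomputable def radialHarmonic (N : ℕ) (R₀ r : ℝ) : ℝ := ∫ s in R₀..r, ((max s R₀) ^ (N - 1))⁻¹

/-- The solution of `-Δv = f` in the annulus with Dirichlet conditions, for radial data. -/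
noncomputable def radialGreen (N : ℕ) (R₀ R : ℝ) (f : ℝ → ℝ) (r : ℝ) : ℝ :=
  ((radialHarmonic N R₀ R - radialHarmonic N R₀ r) *
      (∫ s in R₀..r, radialHarmonic N R₀ s * (s ^ (N - 1) * f s)) +
    radialHarmonic N R₀ r *
      ∫ s in r..R, (radialHarmonic N R₀ R - radialHarmonic N R₀ s) * (s ^ (N - 1) * f s)) /
    radialHarmonic N R₀ R

/-- The radial derivative of `radialGreen`. -/
noncomputable def radialGreenDeriv (N : ℕ) (R₀ R : ℝ) (f : ℝ → ℝ) (r : ℝ) : ℝ :=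
  ((max r R₀) ^ (N - 1))⁻¹ *
    ((∫ s in r..R, (radialHarmonic N R₀ R - radialHarmonic N R₀ s) * (s ^ (N - 1) * f s)) -
      ∫ s in R₀..r, radialHarmonic N R₀ s * (s ^ (N - 1) * f s)) / radialHarmonic N R₀ R

section Green

variable {N : ℕ} {R₀ R : ℝ} {f g : ℝ → ℝ}

/-- The truncation `max s R₀` keeps the integrand continuous and positive on the whole line, which
removes side conditions on the radii. -/
theorem continuous_radialHarmonic_deriv (h0 : 0 < R₀) :
    Continuous fun s : ℝ => ((max s R₀) ^ (N - 1))⁻¹ :=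
  Continuous.inv₀ (by fun_prop) fun s => (pow_pos (h0.trans_le (le_max_right _ _)) _).ne'

theorem hasDerivAt_radialHarmonic (h0 : 0 < R₀) (r : ℝ) :
    HasDerivAt (radialHarmonic N R₀) ((max r R₀) ^ (N - 1))⁻¹ r :=
  hasDerivAt_primitive (continuous_radialHarmonic_deriv h0) R₀ r

theorem continuous_radialHarmonic (h0 : 0 < R₀) : Continuous (radialHarmonic N R₀) :=
  continuous_iff_continuousAt.2 fun r => (hasDerivAt_radialHarmonic h0 r).continuousAt

theorem radialHarmonic_strictMono (h0 : 0 < R₀) : StrictMono (radialHarmonic N R₀) :=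
  strictMono_of_deriv_pos fun r => by
    rw [(hasDerivAt_radialHarmonic h0 r).deriv]
    exact inv_pos.2 (pow_pos (h0.trans_le (le_max_right _ _)) _)

theorem radialHarmonic_self : radialHarmonic N R₀ R₀ = 0 := intervalIntegral.integral_same

theorem radialHarmonic_pos (h0 : 0 < R₀) {r : ℝ} (hr : R₀ < r) : 0 < radialHarmonic N R₀ r := by
  have := radialHarmonic_strictMono (N := N) h0 hr
  rwa [radialHarmonic_self] at this

theorem radialHarmonic_nonneg (h0 : 0 < R₀) {r : ℝ} (hr : R₀ ≤ r) : 0 ≤ radialHarmonic N R₀ r := by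
  have := (radialHarmonic_strictMono (N := N) h0).monotone hr
  rwa [radialHarmonic_self] at this

theorem continuous_green_left (h0 : 0 < R₀) (hf : Continuous f) :
    Continuous fun s => radialHarmonic N R₀ s * (s ^ (N - 1) * f s) :=
  (continuous_radialHarmonic h0).mul ((continuous_pow _).mul hf)

theorem continuous_green_right (h0 : 0 < R₀) (hf : Continuous f) :
    Continuous fun s => (radialHarmonic N R₀ R - radialHarmonic N R₀ s) * (s ^ (N - 1) * f s) :=
  (continuous_const.sub (continuous_radialHarmonic h0)).mul ((continuous_pow _).mul hf)

theorem hasDerivAt_green_right (h0 : 0 < R₀) (hf : Continuous f) (r : ℝ) :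
    HasDerivAt (fun r => ∫ s in r..R, (radialHarmonic N R₀ R - radialHarmonic N R₀ s) *
      (s ^ (N - 1) * f s))
      (-((radialHarmonic N R₀ R - radialHarmonic N R₀ r) * (r ^ (N - 1) * f r))) r := by
  have hc := continuous_green_right (N := N) (R := R) h0 hf
  exact intervalIntegral.integral_hasDerivAt_left (hc.intervalIntegrable _ _)
    hc.aestronglyMeasurable.stronglyMeasurableAtFilter hc.continuousAt

/-- The terms that come from the limits of the two integrals cancel. -/
theorem hasDerivAt_radialGreen (h0 : 0 < R₀) (hf : Continuous f) (r : ℝ) :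
    HasDerivAt (radialGreen N R₀ R f) (radialGreenDeriv N R₀ R f r) r := by
  have h1 := hasDerivAt_radialHarmonic (N := N) h0 r
  have h2 := hasDerivAt_primitive (continuous_green_left (N := N) h0 hf) R₀ r
  have h3 := hasDerivAt_green_right (N := N) (R := R) h0 hf r
  refine ((((h1.const_sub _).mul h2).add (h1.mul h3)).div_const _).congr_deriv ?_
  rw [radialGreenDeriv]
  ring

theorem continuous_radialGreen (h0 : 0 < R₀) (hf : Continuous f) :
    Continuous (radialGreen N R₀ R f) :=
  continuous_iff_continuousAt.2 fun r => (hasDerivAt_radialGreen h0 hf r).continuousAt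

theorem continuous_radialGreenDeriv (h0 : 0 < R₀) (hf : Continuous f) :
    Continuous (radialGreenDeriv N R₀ R f) := by
  have h2 : Continuous fun r => ∫ s in R₀..r, radialHarmonic N R₀ s * (s ^ (N - 1) * f s) :=
    continuous_iff_continuousAt.2 fun r =>
      (hasDerivAt_primitive (continuous_green_left (N := N) h0 hf) R₀ r).continuousAt
  have h3 := continuous_iff_continuousAt.2 fun r =>
    (hasDerivAt_green_right (N := N) (R := R) h0 hf r).continuousAt
  exact ((continuous_radialHarmonic_deriv h0).mul (h3.sub h2)).div_const _

/-- This is the radial form of `-Δv = f`. -/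
theorem hasDerivAt_radialGreenDeriv (h0 : 0 < R₀) (hR : R₀ < R) (hf : Continuous f) {r : ℝ}
    (hr : R₀ < r) : HasDerivAt (radialGreenDeriv N R₀ R f)
      (-f r - (N - 1 : ℕ) * (radialGreenDeriv N R₀ R f r / r)) r := by
  have hr0 : 0 < r := h0.trans hr
  have hK := (radialHarmonic_pos (N := N) h0 hR).ne'
  have h2 := hasDerivAt_primitive (continuous_green_left (N := N) h0 hf) R₀ r
  have h3 := hasDerivAt_green_right (N := N) (R := R) h0 hf r
  have h4 : HasDerivAt (fun r : ℝ => (r ^ (N - 1))⁻¹)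
      (-((N - 1 : ℕ) * r ^ (N - 1 - 1)) / (r ^ (N - 1)) ^ 2) r :=
    (hasDerivAt_pow (N - 1) r).fun_inv (pow_pos hr0 _).ne'
  have h5 := ((h4.mul (h3.sub h2)).div_const (radialHarmonic N R₀ R))
  refine (h5.congr_deriv ?_).congr_of_eventuallyEq ?_
  -- For `N = 1` the exponent `N - 1 - 1` is truncated to zero, so this case is separate.
  · have hp : ((N - 1 : ℕ) : ℝ) * r ^ (N - 1 - 1) = (N - 1 : ℕ) * r ^ (N - 1) / r := by
      rcases Nat.eq_zero_or_pos (N - 1) with h | h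
      · simp [h]
      · rw [mul_div_assoc]
        congr 1
        rw [eq_div_iff hr0.ne', ← pow_succ, Nat.sub_add_cancel h]
    rw [hp, radialGreenDeriv, max_eq_left hr.le]
    have := (pow_pos hr0 (N - 1)).ne'
    simp only [Pi.sub_apply]
    field_simp
    ring
  · filter_upwards [lt_mem_nhds hr] with s hs
    simp only [radialGreenDeriv, max_eq_left hs.le, Pi.mul_apply, Pi.sub_apply]

theorem radialGreen_left : radialGreen N R₀ R f R₀ = 0 := by
  simp [radialGreen, radialHarmonic_self]

theorem radialGreen_right : radialGreen N R₀ R f R = 0 := by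
  simp [radialGreen]

theorem radialGreen_sub (h0 : 0 < R₀) (hf : Continuous f) (hg : Continuous g) (r : ℝ) :
    radialGreen N R₀ R (fun s => f s - g s) r = radialGreen N R₀ R f r - radialGreen N R₀ R g r := by
  simp only [radialGreen, mul_sub]
  rw [intervalIntegral.integral_sub, intervalIntegral.integral_sub]
  · ring
  all_goals
    first
      | exact (continuous_green_left h0 hf).intervalIntegrable _ _
      | exact (continuous_green_left h0 hg).intervalIntegrable _ _
      | exact (continuous_green_right h0 hf).intervalIntegrable _ _
      | exact (continuous_green_right h0 hg).intervalIntegrable _ _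

theorem radialGreen_const_mul (c r : ℝ) :
    radialGreen N R₀ R (fun s => c * f s) r = c * radialGreen N R₀ R f r := by
  have e1 : ∀ s, radialHarmonic N R₀ s * (s ^ (N - 1) * (c * f s)) =
      c * (radialHarmonic N R₀ s * (s ^ (N - 1) * f s)) := fun s => by ring
  have e2 : ∀ s, (radialHarmonic N R₀ R - radialHarmonic N R₀ s) * (s ^ (N - 1) * (c * f s)) =
      c * ((radialHarmonic N R₀ R - radialHarmonic N R₀ s) * (s ^ (N - 1) * f s)) := fun s => by ring
  simp only [radialGreen, e1, e2, intervalIntegral.integral_const_mul]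
  ring

theorem radialGreen_nonneg (h0 : 0 < R₀) (hf : ∀ r ∈ Icc R₀ R, 0 ≤ f r)
    {r : ℝ} (hr : r ∈ Icc R₀ R) : 0 ≤ radialGreen N R₀ R f r := by
  have hm := (radialHarmonic_strictMono (N := N) h0).monotone
  refine div_nonneg (add_nonneg (mul_nonneg (sub_nonneg.2 (hm hr.2)) ?_)
    (mul_nonneg (radialHarmonic_nonneg h0 hr.1) ?_)) (radialHarmonic_nonneg h0 (hr.1.trans hr.2))
  · refine intervalIntegral.integral_nonneg hr.1 fun s hs => ?_
    exact mul_nonneg (radialHarmonic_nonneg h0 hs.1)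
      (mul_nonneg (pow_nonneg (h0.le.trans hs.1) _) (hf s ⟨hs.1, hs.2.trans hr.2⟩))
  · refine intervalIntegral.integral_nonneg hr.2 fun s hs => ?_
    exact mul_nonneg (sub_nonneg.2 (hm hs.2))
      (mul_nonneg (pow_nonneg (h0.le.trans (hr.1.trans hs.1)) _) (hf s ⟨hr.1.trans hs.1, hs.2⟩))

theorem radialGreen_pos (h0 : 0 < R₀) (hc : Continuous f) (hf : ∀ r ∈ Icc R₀ R, 0 < f r)
    {r : ℝ} (hr : r ∈ Ioo R₀ R) : 0 < radialGreen N R₀ R f r := by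
  have hm := radialHarmonic_strictMono (N := N) h0
  refine div_pos (add_pos (mul_pos (sub_pos.2 (hm hr.2)) ?_)
    (mul_pos (radialHarmonic_pos h0 hr.1) ?_)) (radialHarmonic_pos h0 (hr.1.trans hr.2))
  · refine intervalIntegral.intervalIntegral_pos_of_pos_on
      ((continuous_green_left h0 hc).intervalIntegrable _ _) (fun s hs => ?_) hr.1
    exact mul_pos (radialHarmonic_pos h0 hs.1)
      (mul_pos (pow_pos (h0.trans hs.1) _) (hf s ⟨hs.1.le, hs.2.le.trans hr.2.le⟩))
  · refine intervalIntegral.intervalIntegral_pos_of_pos_on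
      ((continuous_green_right h0 hc).intervalIntegrable _ _) (fun s hs => ?_) hr.2
    exact mul_pos (sub_pos.2 (hm hs.2))
      (mul_pos (pow_pos (h0.trans (hr.1.trans hs.1)) _) (hf s ⟨hr.1.le.trans hs.1.le, hs.2.le⟩))

/-- Integration by parts for the solution operator. -/
theorem integral_radialGreenDeriv_sq (h0 : 0 < R₀) (hR : R₀ < R) (hf : Continuous f) :
    ∫ r in R₀..R, r ^ (N - 1) * radialGreenDeriv N R₀ R f r ^ 2 =
      ∫ r in R₀..R, r ^ (N - 1) * (f r * radialGreen N R₀ R f r) := by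
  have hT := continuous_radialGreen (N := N) (R := R) h0 hf
  have hD := continuous_radialGreenDeriv (N := N) (R := R) h0 hf
  have c1 : Continuous fun r => r ^ (N - 1) * radialGreenDeriv N R₀ R f r ^ 2 := by fun_prop
  have c2 : Continuous fun r => r ^ (N - 1) * (f r * radialGreen N R₀ R f r) := by fun_prop
  have key := intervalIntegral.integral_eq_sub_of_hasDerivAt_of_le hR.le
    (f := fun r => radialGreen N R₀ R f r * (r ^ (N - 1) * radialGreenDeriv N R₀ R f r))
    (f' := fun r => r ^ (N - 1) * radialGreenDeriv N R₀ R f r ^ 2 -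
      r ^ (N - 1) * (f r * radialGreen N R₀ R f r))
    (by fun_prop) (fun r hr => ?_) ((c1.sub c2).intervalIntegrable _ _)
  · rw [intervalIntegral.integral_sub (c1.intervalIntegrable _ _) (c2.intervalIntegrable _ _),
      radialGreen_left, radialGreen_right] at key
    linarith
  · have hr0 : 0 < r := h0.trans hr.1
    have h1 := hasDerivAt_radialGreen (N := N) (R := R) h0 hf r
    have h2 := hasDerivAt_radialGreenDeriv (N := N) h0 hR hf hr.1
    refine (h1.mul ((hasDerivAt_pow (N - 1) r).mul h2)).congr_deriv ?_
    have hp : ((N - 1 : ℕ) : ℝ) * r ^ (N - 1 - 1) = (N - 1 : ℕ) * r ^ (N - 1) / r := by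
      rcases Nat.eq_zero_or_pos (N - 1) with h | h
      · simp [h]
      · rw [mul_div_assoc]
        congr 1
        rw [eq_div_iff hr0.ne', ← pow_succ, Nat.sub_add_cancel h]
    simp only [Pi.mul_apply]
    rw [hp]
    field_simp
    ring

/-- The kernel is bounded, and the weight is at least `R₀^(N-1) > 0`, so Cauchy-Schwarz applies.
This bound from `L²` to the uniform norm turns geometric decay in `L²` into uniform smallness. -/
theorem exists_radialGreen_bound (N : ℕ) (h0 : 0 < R₀) (hR : R₀ < R) :
    ∃ C : ℝ, 0 ≤ C ∧ ∀ f : ℝ → ℝ, Continuous f → ∀ r ∈ Icc R₀ R,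
      |radialGreen N R₀ R f r| ≤ C * √(∫ s in R₀..R, s ^ (N - 1) * f s ^ 2) := by
  have hm := (radialHarmonic_strictMono (N := N) h0).monotone
  have hK := radialHarmonic_pos (N := N) h0 hR
  refine ⟨radialHarmonic N R₀ R * R ^ (N - 1) * √(R - R₀) * (√(R₀ ^ (N - 1)))⁻¹, by
    have := h0.trans hR
    positivity, fun f hf r hr => ?_⟩
  have hpow : ∀ s ∈ Icc R₀ R, s ^ (N - 1) ≤ R ^ (N - 1) := fun s hs =>
    pow_le_pow_left₀ (h0.le.trans hs.1) hs.2 _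
  have hI : ∀ {x y}, IntervalIntegrable (fun s => |f s|) volume x y :=
    hf.abs.intervalIntegrable _ _
  have h1 : |∫ s in R₀..r, radialHarmonic N R₀ s * (s ^ (N - 1) * f s)| ≤
      radialHarmonic N R₀ R * R ^ (N - 1) * ∫ s in R₀..r, |f s| := by
    rw [← intervalIntegral.integral_const_mul]
    refine (intervalIntegral.abs_integral_le_integral_abs hr.1).trans
      (intervalIntegral.integral_mono_on hr.1
        ((continuous_green_left h0 hf).abs.intervalIntegrable _ _) (hI.const_mul _) fun s hs => ?_)
    have hs' : s ∈ Icc R₀ R := ⟨hs.1, hs.2.trans hr.2⟩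
    have hs0 := h0.le.trans hs.1
    rw [abs_mul, abs_mul, abs_of_nonneg (radialHarmonic_nonneg h0 hs.1), abs_pow, abs_of_nonneg hs0,
      ← mul_assoc]
    exact mul_le_mul_of_nonneg_right (mul_le_mul (hm hs'.2) (hpow s hs') (pow_nonneg hs0 _) hK.le)
      (abs_nonneg _)
  have h2 : |∫ s in r..R, (radialHarmonic N R₀ R - radialHarmonic N R₀ s) * (s ^ (N - 1) * f s)| ≤
      radialHarmonic N R₀ R * R ^ (N - 1) * ∫ s in r..R, |f s| := by
    rw [← intervalIntegral.integral_const_mul]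
    refine (intervalIntegral.abs_integral_le_integral_abs hr.2).trans
      (intervalIntegral.integral_mono_on hr.2
        ((continuous_green_right h0 hf).abs.intervalIntegrable _ _) (hI.const_mul _) fun s hs => ?_)
    have hs' : s ∈ Icc R₀ R := ⟨hr.1.trans hs.1, hs.2⟩
    have hs0 := h0.le.trans hs'.1
    rw [abs_mul, abs_mul, abs_of_nonneg (sub_nonneg.2 (hm hs.2)), abs_pow, abs_of_nonneg hs0,
      ← mul_assoc]
    exact mul_le_mul_of_nonneg_right (mul_le_mul
      (sub_le_self _ (radialHarmonic_nonneg h0 hs'.1)) (hpow s hs') (pow_nonneg hs0 _) hK.le)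
      (abs_nonneg _)
  have hsum : (∫ s in R₀..r, |f s|) + ∫ s in r..R, |f s| = ∫ s in R₀..R, |f s| :=
    intervalIntegral.integral_add_adjacent_intervals hI hI
  have h3 : |radialGreen N R₀ R f r| ≤ radialHarmonic N R₀ R * R ^ (N - 1) * ∫ s in R₀..R, |f s| := by
    rw [radialGreen, abs_div, abs_of_pos hK, div_le_iff₀ hK, ← hsum]
    refine (abs_add_le _ _).trans ?_
    rw [abs_mul, abs_mul, abs_of_nonneg (sub_nonneg.2 (hm hr.2)),
      abs_of_nonneg (radialHarmonic_nonneg h0 hr.1)]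
    have h4 := mul_le_mul (sub_le_self (radialHarmonic N R₀ R) (radialHarmonic_nonneg (N := N) h0 hr.1)) h1
      (abs_nonneg _) hK.le
    have h5 := mul_le_mul (hm hr.2) h2 (abs_nonneg _) hK.le
    nlinarith
  have h6 : ∫ s in R₀..R, |f s| ≤ √(R - R₀) * (√(R₀ ^ (N - 1)))⁻¹ *
      √(∫ s in R₀..R, s ^ (N - 1) * f s ^ 2) := by
    have h7 := sq_intervalIntegral_le hR hI ((hf.abs.pow 2).intervalIntegrable _ _)
    have h8 : R₀ ^ (N - 1) * ∫ s in R₀..R, |f s| ^ 2 ≤ ∫ s in R₀..R, s ^ (N - 1) * f s ^ 2 := by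
      rw [← intervalIntegral.integral_const_mul]
      refine intervalIntegral.integral_mono_on hR.le
        (((hf.abs.pow 2).const_mul _).intervalIntegrable _ _)
        (((continuous_pow _).mul (hf.pow 2)).intervalIntegrable _ _) fun s hs => ?_
      rw [sq_abs]
      exact mul_le_mul_of_nonneg_right (pow_le_pow_left₀ h0.le hs.1 _) (sq_nonneg _)
    rw [← Real.sqrt_inv, ← Real.sqrt_mul (by linarith), ← Real.sqrt_mul (by
      have : 0 < R₀ ^ (N - 1) := by positivity
      have : 0 < R - R₀ := by linarith
      positivity)]
    refine Real.le_sqrt_of_sq_le (h7.trans ?_)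
    rw [mul_assoc]
    refine mul_le_mul_of_nonneg_left ?_ (by linarith)
    rw [← div_eq_inv_mul, le_div_iff₀ (by positivity)]
    linarith
  calc |radialGreen N R₀ R f r| ≤ _ := h3
    _ ≤ radialHarmonic N R₀ R * R ^ (N - 1) * _ := mul_le_mul_of_nonneg_left h6 (by
      have := h0.trans hR
      positivity)
    _ = _ := by ring

end Green

/-! ### Second variation at zero and a positive supersolution. -/

section GreenEnergy

variable {N : ℕ} {R₀ R : ℝ} {f : ℝ → ℝ}

theorem abs_radialHessian_le {w q : ℝ → ℝ} {C : ℝ} (h0 : 0 < R₀)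
    (hw : ∀ r ∈ Ioo R₀ R, |w r| ≤ C) (hq : ∀ r ∈ Ioo R₀ R, |q r| ≤ C) (i j : Fin N)
    {x : EuclideanSpace ℝ (Fin N)} (hx : x ∈ annulus N R₀ R) :
    |radialHessian w q i j x| ≤ C + 2 * (C / R₀) := by
  have hx0 : 0 < ‖x‖ := h0.trans hx.1
  have e : radialHessian w q i j x = (q ‖x‖ - w ‖x‖ / ‖x‖) * (x j / ‖x‖) * (x i / ‖x‖) +
      w ‖x‖ / ‖x‖ * (if i = j then 1 else 0) := by
    simp only [radialHessian]
    field_simp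
  have h1 : |w ‖x‖ / ‖x‖| ≤ C / R₀ := by
    rw [abs_div, abs_norm]
    exact div_le_div₀ ((abs_nonneg _).trans (hw _ hx)) (hw _ hx) h0 hx.1.le
  have h2 : |q ‖x‖ - w ‖x‖ / ‖x‖| ≤ C + C / R₀ := (abs_sub _ _).trans (add_le_add (hq _ hx) h1)
  have h3 : |(q ‖x‖ - w ‖x‖ / ‖x‖) * (x j / ‖x‖) * (x i / ‖x‖)| ≤ C + C / R₀ := by
    rw [abs_mul, abs_mul]
    exact (mul_le_of_le_one_right (by positivity) (abs_coord_div_norm_le x i)).trans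
      ((mul_le_of_le_one_right (abs_nonneg _) (abs_coord_div_norm_le x j)).trans h2)
  have h4 : |w ‖x‖ / ‖x‖ * (if i = j then 1 else 0)| ≤ C / R₀ := by
    rw [abs_mul]
    refine (mul_le_of_le_one_right (abs_nonneg _) ?_).trans h1
    split_ifs <;> simp
  rw [e]
  exact (abs_add_le _ _).trans (by linarith)

theorem energy_radialGreen (hN : 1 ≤ N) (h0 : 0 < R₀) (hR : R₀ < R) (hf : Continuous f) (β : ℝ) :
    MemHr (annulus N R₀ R) (fun x => radialGreen N R₀ R f ‖x‖) ∧
    MemLp (fun x : EuclideanSpace ℝ (Fin N) => radialGreen N R₀ R f ‖x‖) 4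
      (volume.restrict (annulus N R₀ R)) ∧
    energy β (annulus N R₀ R) (fun x => radialGreen N R₀ R f ‖x‖) = sphereArea N *
      ∫ r in R₀..R, r ^ (N - 1) * (f r ^ 2 / 2 + β * radialGreenDeriv N R₀ R f r ^ 2 / 2 +
        radialGreen N R₀ R f r ^ 4 / 4 - radialGreen N R₀ R f r ^ 2 / 2) := by
  have hT := continuous_radialGreen (N := N) (R := R) h0 hf
  have hD := continuous_radialGreenDeriv (N := N) (R := R) h0 hf
  set T := radialGreen N R₀ R f with hTdef
  set D := radialGreenDeriv N R₀ R f with hDdef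
  set p : ℝ → ℝ := fun r => -f r - (N - 1 : ℕ) * (D r / r) with hp
  have hpc : ContinuousOn p (Icc R₀ R) := by
    refine hf.continuousOn.neg.sub (continuousOn_const.mul (hD.continuousOn.div continuousOn_id ?_))
    exact fun r hr => (h0.trans_le hr.1).ne'
  have hTac : LocAC T D R₀ R := LocAC.of_hasDerivAt
    (fun r _ => hasDerivAt_radialGreen h0 hf r) hD.continuousOn
  have hDac : LocAC D p R₀ R := LocAC.of_hasDerivAt
    (fun r hr => hasDerivAt_radialGreenDeriv h0 hR hf hr.1) (hpc.mono Ioo_subset_Icc_self)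
  have hbdd : ∀ {g : ℝ → ℝ}, ContinuousOn g (Icc R₀ R) → ∃ C, ∀ r ∈ Ioo R₀ R, |g r| ≤ C :=
    fun hg => by
      obtain ⟨C, hC⟩ := isCompact_Icc.exists_bound_of_continuousOn hg
      exact ⟨C, fun r hr => hC r (Ioo_subset_Icc_self hr)⟩
  obtain ⟨C₁, hC₁⟩ := hbdd hD.continuousOn
  obtain ⟨C₂, hC₂⟩ := hbdd hpc
  have hmL : ∀ {g : ℝ → ℝ}, Continuous g → ∀ s : ℝ≥0∞,
      MemLp (fun x : EuclideanSpace ℝ (Fin N) => g ‖x‖) s (volume.restrict (annulus N R₀ R)) := by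
    intro g hg s
    obtain ⟨C, hC⟩ := hbdd hg.continuousOn
    refine MemLp.of_bound (hg.comp continuous_norm).aestronglyMeasurable C ?_
    filter_upwards [ae_restrict_mem (measurableSet_annulus N R₀ R)] with x hx using hC _ hx
  have hhess := fun i j => hasWeakPartial_radialHessian hN h0.le hDac i j
  have hDir : IsDirichletPrimitive T D R₀ R := by
    have hint : ∀ r, ∫ t in r..R, D t = T R - T r := fun r =>
      intervalIntegral.integral_eq_sub_of_hasDerivAt
        (fun s _ => hasDerivAt_radialGreen h0 hf s) (hD.intervalIntegrable _ _)
    refine ⟨fun r _ => ⟨hD.intervalIntegrable _ _, ?_⟩, fun _ => ⟨hD.intervalIntegrable _ _, ?_⟩⟩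
    · rw [hint, hTdef, radialGreen_right]
      ring
    · rw [hint, hTdef, radialGreen_right, radialGreen_left, sub_self]
  obtain ⟨hH, hv, hv2⟩ := memHr_of_profile hN h0.le hR (isOpen_annulus N R₀ R) subset_rfl
    EventuallyEq.rfl (fun h => absurd h h0.ne') hT.continuousOn hD.continuousOn hDir
    (fun i => HasWeakPartial.of_radial hN h0.le hTac i) hhess (hmL hD 2) (fun i j => by
      refine MemLp.of_bound (hhess i j).2.1.aestronglyMeasurable
        (max C₁ C₂ + 2 * (max C₁ C₂ / R₀)) ?_
      filter_upwards [ae_restrict_mem (measurableSet_annulus N R₀ R)] with x hx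
      exact abs_radialHessian_le h0 (fun r hr => (hC₁ r hr).trans (le_max_left _ _))
        (fun r hr => (hC₂ r hr).trans (le_max_right _ _)) i j hx)
  refine ⟨hH, hmL hT 4, ?_⟩
  rw [energy_eq_of_profile h0.le EventuallyEq.rfl (Eventually.of_forall fun _ => rfl) hv hv2 β,
    integral_annulus_radial hN h0.le (fun r => (p r + (N - 1) * (D r / r)) ^ 2 / 2 +
      β * D r ^ 2 / 2 + T r ^ 4 / 4 - T r ^ 2 / 2), intervalIntegral.integral_of_le hR.le,
    integral_Ioc_eq_integral_Ioo]
  have hc : ((N - 1 : ℕ) : ℝ) = N - 1 := by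
    rw [Nat.cast_sub hN, Nat.cast_one]
  congr 2
  ext r
  simp only [hp, hc]
  ring

/-- If no radial function has negative energy, then the solution operator has small norm. -/
theorem integral_radialGreen_sq_le (hN : 1 ≤ N) (h0 : 0 < R₀) (hR : R₀ < R) {β m : ℝ} (hβ : 0 < β)
    (hm : 0 < m) (hm1 : m ^ 2 + β * m = 1)
    (hE : ∀ v, MemHr (annulus N R₀ R) v → MemLp v 4 (volume.restrict (annulus N R₀ R)) →
      0 ≤ energy β (annulus N R₀ R) v) (hf : Continuous f) :
    m ^ 2 * ∫ r in R₀..R, r ^ (N - 1) * radialGreen N R₀ R f r ^ 2 ≤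
      ∫ r in R₀..R, r ^ (N - 1) * f r ^ 2 := by
  have hT := continuous_radialGreen (N := N) (R := R) h0 hf
  have hD := continuous_radialGreenDeriv (N := N) (R := R) h0 hf
  have hbp := integral_radialGreenDeriv_sq (N := N) h0 hR hf
  set T := radialGreen N R₀ R f with hTdef
  set D := radialGreenDeriv N R₀ R f with hDdef
  have hii : ∀ {g : ℝ → ℝ}, Continuous g → IntervalIntegrable g volume R₀ R :=
    fun hg => hg.intervalIntegrable _ _
  have cA : Continuous fun r => r ^ (N - 1) * f r ^ 2 := by fun_prop
  have cB : Continuous fun r => r ^ (N - 1) * D r ^ 2 := by fun_prop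
  have cC : Continuous fun r => r ^ (N - 1) * T r ^ 2 := by fun_prop
  have cP : Continuous fun r => r ^ (N - 1) * T r ^ 4 := by fun_prop
  have cM : Continuous fun r => r ^ (N - 1) * (f r * T r) := by fun_prop
  have hpow : ∀ r ∈ Icc R₀ R, 0 ≤ r ^ (N - 1) := fun r hr => pow_nonneg (h0.le.trans hr.1) _
  set A := ∫ r in R₀..R, r ^ (N - 1) * f r ^ 2 with hA
  set B := ∫ r in R₀..R, r ^ (N - 1) * D r ^ 2 with hB
  set C := ∫ r in R₀..R, r ^ (N - 1) * T r ^ 2 with hC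
  set P := ∫ r in R₀..R, r ^ (N - 1) * T r ^ 4 with hP
  have hP0 : 0 ≤ P := intervalIntegral.integral_nonneg hR.le fun r hr =>
    mul_nonneg (hpow r hr) (by positivity)
  have hS := sphereArea_pos hN
  -- The energy of the solution with data `εf`, up to a positive factor of order `ε²`. As `ε → 0`
  -- the quartic term disappears and the second variation is left.
  have hQε : ∀ ε : ℝ, 0 < ε → 0 ≤ (A + β * B - C) + ε ^ 2 * P / 2 := by
    intro ε hε
    have hεf : Continuous fun r => ε * f r := continuous_const.mul hf
    obtain ⟨h1, h2, h3⟩ := energy_radialGreen hN h0 hR hεf β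
    have h4 := hE _ h1 h2
    have eT : radialGreen N R₀ R (fun r => ε * f r) = fun r => ε * T r :=
      funext fun r => radialGreen_const_mul ε r
    have eD : radialGreenDeriv N R₀ R (fun r => ε * f r) = fun r => ε * D r := by
      ext r
      have h5 := hasDerivAt_radialGreen (N := N) (R := R) h0 hεf r
      rw [eT] at h5
      exact h5.unique ((hasDerivAt_radialGreen h0 hf r).const_mul ε)
    rw [h3, eT, eD] at h4
    have h5 := nonneg_of_mul_nonneg_right h4 hS
    have h6 : ∫ r in R₀..R, r ^ (N - 1) * ((ε * f r) ^ 2 / 2 + β * (ε * D r) ^ 2 / 2 +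
        (ε * T r) ^ 4 / 4 - (ε * T r) ^ 2 / 2) =
        ε ^ 2 / 2 * A + β * ε ^ 2 / 2 * B + ε ^ 4 / 4 * P - ε ^ 2 / 2 * C := by
      have h8 : ∀ r, r ^ (N - 1) * ((ε * f r) ^ 2 / 2 + β * (ε * D r) ^ 2 / 2 +
          (ε * T r) ^ 4 / 4 - (ε * T r) ^ 2 / 2) =
          ε ^ 2 / 2 * (r ^ (N - 1) * f r ^ 2) + β * ε ^ 2 / 2 * (r ^ (N - 1) * D r ^ 2) +
            ε ^ 4 / 4 * (r ^ (N - 1) * T r ^ 4) - ε ^ 2 / 2 * (r ^ (N - 1) * T r ^ 2) :=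
        fun r => by ring
      simp only [h8]
      rw [intervalIntegral.integral_sub, intervalIntegral.integral_add,
        intervalIntegral.integral_add]
      · simp only [intervalIntegral.integral_const_mul, ← hA, ← hB, ← hC, ← hP]
      all_goals exact hii (by fun_prop)
    rw [h6] at h5
    have h7 : ε ^ 2 / 2 * A + β * ε ^ 2 / 2 * B + ε ^ 4 / 4 * P - ε ^ 2 / 2 * C =
        ε ^ 2 / 2 * ((A + β * B - C) + ε ^ 2 * P / 2) := by ring
    rw [h7] at h5
    exact nonneg_of_mul_nonneg_right h5 (by positivity)
  have hQ : 0 ≤ A + β * B - C := by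
    have ht : Tendsto (fun ε : ℝ => (A + β * B - C) + ε ^ 2 * P / 2) (𝓝[>] 0)
        (𝓝 ((A + β * B - C) + 0 ^ 2 * P / 2)) :=
      (Continuous.tendsto (by fun_prop) 0).mono_left nhdsWithin_le_nhds
    have := ge_of_tendsto ht (by
      filter_upwards [self_mem_nhdsWithin] with ε hε using hQε ε hε)
    simpa using this
  -- By parts `B` is the pairing of `f` with its solution. In Young's inequality the weight `m` is
  -- the one for which `m² + βm = 1` turns the form into a positive multiple of `A - m² C`.
  have hBle : B ≤ (A / m + m * C) / 2 := by
    rw [hbp]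
    have h1 : (A / m + m * C) / 2 =
        ∫ r in R₀..R, (1 / (2 * m) * (r ^ (N - 1) * f r ^ 2) + m / 2 * (r ^ (N - 1) * T r ^ 2)) := by
      rw [intervalIntegral.integral_add (hii (cA.const_mul _)) (hii (cC.const_mul _)),
        intervalIntegral.integral_const_mul, intervalIntegral.integral_const_mul, ← hA, ← hC]
      field_simp
    rw [h1]
    refine intervalIntegral.integral_mono_on hR.le (hii cM)
      (hii ((cA.const_mul _).add (cC.const_mul _))) fun r hr => ?_
    have h2 : f r * T r ≤ 1 / (2 * m) * f r ^ 2 + m / 2 * T r ^ 2 := by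
      have h3 : 1 / (2 * m) * f r ^ 2 + m / 2 * T r ^ 2 - f r * T r =
          1 / (2 * m) * (f r - m * T r) ^ 2 := by
        field_simp
        ring
      have h4 : 0 ≤ 1 / (2 * m) * (f r - m * T r) ^ 2 := by positivity
      linarith
    calc r ^ (N - 1) * (f r * T r) ≤ r ^ (N - 1) * (1 / (2 * m) * f r ^ 2 + m / 2 * T r ^ 2) :=
          mul_le_mul_of_nonneg_left h2 (hpow r hr)
      _ = _ := by ring
  have h5 : β * B ≤ β * ((A / m + m * C) / 2) := mul_le_mul_of_nonneg_left hBle hβ.le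
  have hβm : β = (1 - m ^ 2) / m := by
    field_simp
    linarith
  have h6 : β * ((A / m + m * C) / 2) = (1 - m ^ 2) * A / (2 * m ^ 2) + (1 - m ^ 2) * C / 2 := by
    rw [hβm]
    field_simp
  have h7 : 0 ≤ A + ((1 - m ^ 2) * A / (2 * m ^ 2) + (1 - m ^ 2) * C / 2) - C := by
    rw [← h6]
    linarith
  have h8 : A + ((1 - m ^ 2) * A / (2 * m ^ 2) + (1 - m ^ 2) * C / 2) - C =
      (1 + m ^ 2) / (2 * m ^ 2) * (A - m ^ 2 * C) := by
    field_simp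
    ring
  rw [h8] at h7
  have := nonneg_of_mul_nonneg_right h7 (by positivity)
  linarith

/-- A positive radial supersolution, as a partial sum of the Neumann series. -/
theorem exists_radial_supersolution (N : ℕ) (h0 : 0 < R₀) (hR : R₀ < R) {μ m : ℝ} (hμ : 0 < μ)
    (hμm : μ < m)
    (hT : ∀ f : ℝ → ℝ, Continuous f →
      m ^ 2 * ∫ r in R₀..R, r ^ (N - 1) * radialGreen N R₀ R f r ^ 2 ≤
        ∫ r in R₀..R, r ^ (N - 1) * f r ^ 2) :
    ∃ F : ℝ → ℝ, Continuous F ∧ (∀ r ∈ Icc R₀ R, 0 < F r) ∧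
      ∀ r ∈ Icc R₀ R, μ * radialGreen N R₀ R F r ≤ F r := by
  set Φ : (ℝ → ℝ) → ℝ → ℝ := fun g r => 1 + μ * radialGreen N R₀ R g r with hΦ
  -- With `T` the solution operator, these are the partial sums of the Neumann series of `μT`
  -- applied to the constant one.
  set F : ℕ → ℝ → ℝ := fun n => Φ^[n] fun _ => 1 with hF
  have hFs : ∀ n r, F (n + 1) r = 1 + μ * radialGreen N R₀ R (F n) r := fun n r => by
    simp only [hF, Function.iterate_succ_apply']
    rfl
  have hFc : ∀ n, Continuous (F n) := by
    intro n
    induction n with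
    | zero => exact continuous_const
    | succ n ih =>
      rw [show F (n + 1) = fun r => 1 + μ * radialGreen N R₀ R (F n) r from funext (hFs n)]
      exact continuous_const.add (continuous_const.mul (continuous_radialGreen h0 ih))
  have hF1 : ∀ n, ∀ r ∈ Icc R₀ R, 1 ≤ F n r := by
    intro n
    induction n with
    | zero => exact fun r _ => le_rfl
    | succ n ih =>
      intro r hr
      rw [hFs]
      have := radialGreen_nonneg (N := N) h0 (fun s hs => zero_le_one.trans (ih s hs)) hr
      nlinarith
  set E : ℕ → ℝ → ℝ := fun n r => F (n + 1) r - F n r with hE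
  have hEc : ∀ n, Continuous (E n) := fun n => (hFc _).sub (hFc _)
  have hEs : ∀ n r, E (n + 1) r = μ * radialGreen N R₀ R (E n) r := fun n r => by
    simp only [hE]
    rw [radialGreen_sub h0 (hFc _) (hFc _), hFs (n + 1), hFs n]
    ring
  have hm0 : 0 < m := hμ.trans hμm
  set I : ℕ → ℝ := fun n => ∫ r in R₀..R, r ^ (N - 1) * E n r ^ 2 with hI
  have hIs : ∀ n, I (n + 1) ≤ (μ / m) ^ 2 * I n := fun n => by
    have h1 : I (n + 1) = μ ^ 2 * ∫ r in R₀..R, r ^ (N - 1) * radialGreen N R₀ R (E n) r ^ 2 := by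
      simp only [hI, hEs]
      rw [← intervalIntegral.integral_const_mul]
      refine intervalIntegral.integral_congr fun r _ => ?_
      ring
    have h2 := hT (E n) (hEc n)
    rw [h1, div_pow, div_mul_eq_mul_div, le_div_iff₀ (by positivity)]
    nlinarith [sq_nonneg μ]
  have hIn : ∀ n, I n ≤ ((μ / m) ^ n) ^ 2 * I 0 := by
    intro n
    induction n with
    | zero => simp
    | succ n ih =>
      calc I (n + 1) ≤ (μ / m) ^ 2 * I n := hIs n
        _ ≤ (μ / m) ^ 2 * (((μ / m) ^ n) ^ 2 * I 0) := mul_le_mul_of_nonneg_left ih (sq_nonneg _)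
        _ = _ := by ring
  obtain ⟨C, hC0, hC⟩ := exists_radialGreen_bound N h0 hR
  -- The increments `E n` contract by `μ/m < 1` in `L²`, and one further application of the operator
  -- makes them uniformly small.
  have hθ : Tendsto (fun n => μ * (C * ((μ / m) ^ n * √(I 0)))) atTop (𝓝 0) := by
    have := tendsto_pow_atTop_nhds_zero_of_lt_one (r := μ / m) (by positivity)
      ((div_lt_one hm0).2 hμm)
    simpa using ((this.mul_const (√(I 0))).const_mul C).const_mul μ
  obtain ⟨n, hn⟩ := (hθ.eventually (gt_mem_nhds one_pos)).exists
  refine ⟨F (n + 1), hFc _, fun r hr => one_pos.trans_le (hF1 _ r hr), fun r hr => ?_⟩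
  -- An increment of at most one is absorbed by the constant term one in the recursion, which leaves
  -- `μTF ≤ F`.
  have h1 : E (n + 1) r ≤ 1 := by
    rw [hEs]
    refine le_trans ?_ hn.le
    refine mul_le_mul_of_nonneg_left ((le_abs_self _).trans ((hC _ (hEc n) r hr).trans ?_)) hμ.le
    refine mul_le_mul_of_nonneg_left ?_ hC0
    rw [← Real.sqrt_sq (by positivity : 0 ≤ (μ / m) ^ n), ← Real.sqrt_mul (sq_nonneg _)]
    exact Real.sqrt_le_sqrt (hIn n)
  simp only [hE] at h1
  rw [hFs (n + 1)] at h1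
  linarith

end GreenEnergy

/-! ### Barta's inequality and a competitor of negative energy. -/

section Barta

variable {N : ℕ} {R₀ R : ℝ} {F : ℝ → ℝ} {μ : ℝ}

theorem tendsto_integral_sq_of_tendsto_eLpNorm {α : Type*} [MeasurableSpace α] {μ : Measure α}
    {f : α → ℝ} {F : ℕ → α → ℝ} (hf : MemLp f 2 μ) (hF : ∀ n, MemLp (F n) 2 μ)
    (h : Tendsto (fun n => eLpNorm (fun x => F n x - f x) 2 μ) atTop (𝓝 0)) :
    Tendsto (fun n => ∫ x, F n x ^ 2 ∂μ) atTop (𝓝 (∫ x, f x ^ 2 ∂μ)) := by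
  have h1 := tendsto_integral_mul_of_tendsto_eLpNorm hf hF hf h
  have h2 : Tendsto (fun n => ∫ x, (F n x - f x) ^ 2 ∂μ) atTop (𝓝 0) := by
    have h3 := (ENNReal.tendsto_toReal ENNReal.zero_ne_top).comp h
    have h4 := h3.pow 2
    simp only [ENNReal.toReal_zero, ne_eq, OfNat.ofNat_ne_zero, not_false_eq_true, zero_pow] at h4
    refine h4.congr fun n => ?_
    simp only [Function.comp]
    have h5 : MemLp (fun x => F n x - f x) 2 μ := (hF n).sub hf
    rw [h5.eLpNorm_two_eq, ENNReal.toReal_ofReal (Real.sqrt_nonneg _),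
      Real.sq_sqrt (integral_nonneg fun x => sq_nonneg _)]
  have h6 := (h2.add (h1.const_mul 2)).sub_const (∫ x, f x * f x ∂μ)
  have e : 0 + 2 * (∫ x, f x * f x ∂μ) - ∫ x, f x * f x ∂μ = ∫ x, f x ^ 2 ∂μ := by
    simp only [pow_two]
    ring
  rw [e] at h6
  refine h6.congr fun n => ?_
  have i1 : Integrable (fun x => (F n x - f x) ^ 2) μ := ((hF n).sub hf).integrable_sq
  have i2 : Integrable (fun x => F n x * f x) μ := (hF n).integrable_mul hf
  have i3 : Integrable (fun x => f x * f x) μ := hf.integrable_mul hf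
  have e2 : ∀ x, F n x ^ 2 = (F n x - f x) ^ 2 + 2 * (F n x * f x) - f x * f x := fun x => by ring
  have i4 : Integrable (fun x => (F n x - f x) ^ 2 + 2 * (F n x * f x)) μ := i1.add (i2.const_mul 2)
  simp only [e2]
  rw [integral_sub i4 i3, integral_add i1 (i2.const_mul 2), integral_const_mul]

/-- Barta's inequality on test functions, from a positive radial supersolution. -/
theorem IsTestFunction.barta (hN : 1 ≤ N) (h0 : 0 < R₀) (hR : R₀ < R) (hF : Continuous F)
    (hpos : ∀ r ∈ Icc R₀ R, 0 < F r)
    (hsup : ∀ r ∈ Icc R₀ R, μ * radialGreen N R₀ R F r ≤ F r)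
    {φ : EuclideanSpace ℝ (Fin N) → ℝ} (hφ : IsTestFunction (annulus N R₀ R) φ) :
    μ * ∫ x in annulus N R₀ R, φ x ^ 2 ≤
      ∑ i, ∫ x in annulus N R₀ R, _root_.classicalPartial i φ x ^ 2 := by
  set T := radialGreen N R₀ R F with hT
  set D := radialGreenDeriv N R₀ R F with hD
  have hTpos : ∀ r ∈ Ioo R₀ R, 0 < T r := fun r hr => radialGreen_pos h0 hF hpos hr
  have hTc : Continuous T := continuous_radialGreen h0 hF
  have hDc : Continuous D := continuous_radialGreenDeriv h0 hF
  -- With `v = T(|x|)` the field `W(|x|) x/|x|` is the gradient of `log v`.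
  set W : ℝ → ℝ := fun r => D r / T r with hW
  set W' : ℝ → ℝ := fun r => ((-F r - (N - 1 : ℕ) * (D r / r)) * T r - D r * D r) / T r ^ 2 with hW'
  have hWac : LocAC W W' R₀ R := by
    refine LocAC.of_hasDerivAt (fun r hr => ?_) ?_
    · exact (hasDerivAt_radialGreenDeriv h0 hR hF hr.1).div (hasDerivAt_radialGreen h0 hF r)
        (hTpos r hr).ne'
    · refine ContinuousOn.div (ContinuousOn.sub (ContinuousOn.mul (hF.continuousOn.neg.sub
        (continuousOn_const.mul (hDc.continuousOn.div continuousOn_id fun r hr => ?_)))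
        hTc.continuousOn) (hDc.mul hDc).continuousOn) (hTc.pow 2).continuousOn fun r hr => ?_
      · exact (h0.trans hr.1).ne'
      · exact (pow_pos (hTpos r hr) 2).ne'
  have hφ2 : IsTestFunction (annulus N R₀ R) fun x => φ x * φ x :=
    ⟨hφ.1.mul hφ.1, hφ.2.1.mul_left, (tsupport_mul_subset_left).trans hφ.2.2⟩
  have hwp := fun i => hasWeakPartial_radialHessian hN h0.le hWac i i
  have i1 := fun i => (IsTestFunction.integrable_mul (hwp i).1 (hφ2.classicalPartial i)).integrableOn
    (s := annulus N R₀ R)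
  have i2 := fun i => (IsTestFunction.integrable_mul (hwp i).2.1 hφ2).integrableOn
    (s := annulus N R₀ R)
  have i3 := fun i => ((hφ.classicalPartial i).memLp (Ω' := annulus N R₀ R) 2).integrable_sq
  have i4 := (hφ.memLp (Ω' := annulus N R₀ R) 2).integrable_sq
  -- This is `|∇φ|² - div(φ² ∇ log v) - μφ²`. Its divergence term integrates to zero, and by `-Δv =
  -- F` it equals `|∇φ - φ ∇ log v|² + (F/v - μ)φ²`, which is nonnegative.
  set G : EuclideanSpace ℝ (Fin N) → ℝ := fun x =>
    ∑ i, (_root_.classicalPartial i φ x ^ 2 -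
      (W ‖x‖ * (x i / ‖x‖) * _root_.classicalPartial i (fun x => φ x * φ x) x +
        radialHessian W W' i i x * (φ x * φ x))) - μ * φ x ^ 2 with hG
  have hGint : ∫ x in annulus N R₀ R, G x =
      (∑ i, ∫ x in annulus N R₀ R, _root_.classicalPartial i φ x ^ 2) -
        μ * ∫ x in annulus N R₀ R, φ x ^ 2 := by
    have hi : ∀ i ∈ (Finset.univ : Finset (Fin N)), Integrable (fun x =>
        _root_.classicalPartial i φ x ^ 2 -
        (W ‖x‖ * (x i / ‖x‖) * _root_.classicalPartial i (fun x => φ x * φ x) x +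
          radialHessian W W' i i x * (φ x * φ x))) (volume.restrict (annulus N R₀ R)) :=
      fun i _ => (i3 i).sub ((i1 i).add (i2 i))
    rw [hG, integral_sub (integrable_finsetSum _ hi) (i4.const_mul μ), integral_const_mul,
      integral_finsetSum _ hi]
    congr 1
    refine Finset.sum_congr rfl fun i _ => ?_
    have i5 : IntegrableOn (fun x => W ‖x‖ * (x i / ‖x‖) *
        _root_.classicalPartial i (fun x => φ x * φ x) x +
        radialHessian W W' i i x * (φ x * φ x)) (annulus N R₀ R) := (i1 i).add (i2 i)
    rw [integral_sub (i3 i) i5, integral_add (i1 i) (i2 i), (hwp i).2.2 _ hφ2]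
    ring
  have hG0 : 0 ≤ ∫ x in annulus N R₀ R, G x := by
    refine setIntegral_nonneg (measurableSet_annulus N R₀ R) fun x hx => ?_
    have hx0 : 0 < ‖x‖ := h0.trans hx.1
    have hxne : x ≠ 0 := norm_pos_iff.1 hx0
    have hdiff : DifferentiableAt ℝ φ x := (hφ.1.differentiable (by simp)) x
    have e1 : ∀ i, _root_.classicalPartial i φ x ^ 2 -
        (W ‖x‖ * (x i / ‖x‖) * _root_.classicalPartial i (fun x => φ x * φ x) x +
          radialHessian W W' i i x * (φ x * φ x)) =
        (_root_.classicalPartial i φ x - W ‖x‖ * φ x * (x i / ‖x‖)) ^ 2 -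
          (W ‖x‖ * φ x) ^ 2 * (x i / ‖x‖) ^ 2 - radialHessian W W' i i x * φ x ^ 2 := by
      intro i
      rw [_root_.classicalPartial_mul hdiff hdiff]
      ring
    have hc : ((N - 1 : ℕ) : ℝ) = N - 1 := by rw [Nat.cast_sub hN, Nat.cast_one]
    have hTx := hTpos _ hx
    have e2 : W' ‖x‖ + (N - 1) * (W ‖x‖ / ‖x‖) = -(F ‖x‖ / T ‖x‖) - W ‖x‖ ^ 2 := by
      simp only [hW', hW, hc]
      field_simp
      ring
    have e3 : G x = ∑ i, (_root_.classicalPartial i φ x - W ‖x‖ * φ x * (x i / ‖x‖)) ^ 2 +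
        (F ‖x‖ / T ‖x‖ - μ) * φ x ^ 2 := by
      simp only [hG, e1]
      rw [Finset.sum_sub_distrib, Finset.sum_sub_distrib, ← Finset.mul_sum, ← Finset.sum_mul,
        sum_coord_div_norm_sq hxne, radialLaplacian hxne, e2]
      ring
    rw [e3]
    have h2 : μ ≤ F ‖x‖ / T ‖x‖ := (le_div_iff₀ hTx).2 (hsup _ ⟨hx.1.le, hx.2.le⟩)
    exact add_nonneg (Finset.sum_nonneg fun i _ => sq_nonneg _)
      (mul_nonneg (sub_nonneg.2 h2) (sq_nonneg _))
  linarith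

/-- Barta's lower bound for the Dirichlet eigenvalues of the annulus. -/
theorem le_of_isDirichletEigenvalue (hN : 1 ≤ N) (h0 : 0 < R₀) (hR : R₀ < R) (hF : Continuous F)
    (hpos : ∀ r ∈ Icc R₀ R, 0 < F r)
    (hsup : ∀ r ∈ Icc R₀ R, μ * radialGreen N R₀ R F r ≤ F r) {lam : ℝ}
    (hlam : IsDirichletEigenvalue (annulus N R₀ R) lam) : μ ≤ lam := by
  obtain ⟨φ, hφ, hne, heig⟩ := hlam
  have hφ' := hφ
  obtain ⟨hH1, ψ, hψ, hL, hD⟩ := hφ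
  have t1 := tendsto_integral_sq_of_tendsto_eLpNorm hH1.1 (fun n => (hψ n).memLp 2) hL
  have t2 := fun i => tendsto_integral_sq_of_tendsto_eLpNorm (hH1.2 i).2
    (fun n => ((hψ n).classicalPartial i).memLp 2) (hD i)
  have hle : μ * ∫ x in annulus N R₀ R, φ x ^ 2 ≤
      ∑ i, ∫ x in annulus N R₀ R, weakPartial (annulus N R₀ R) i φ x ^ 2 :=
    le_of_tendsto_of_tendsto' (t1.const_mul μ) (tendsto_finsetSum _ fun i _ => t2 i)
      fun n => (hψ n).barta hN h0 hR hF hpos hsup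
  have he := heig φ hφ'
  simp only [← pow_two] at he
  rw [integral_finsetSum _ fun i _ => (hH1.2 i).2.integrable_sq] at he
  rw [he] at hle
  refine le_of_mul_le_mul_right hle ?_
  refine lt_of_le_of_ne (integral_nonneg fun x => sq_nonneg _) fun h => hne ?_
  have h1 := (integral_eq_zero_iff_of_nonneg (fun x => sq_nonneg (φ x)) hH1.1.integrable_sq).1 h.symm
  filter_upwards [h1] with x hx
  simpa using hx

/-- If `λ₁² + βλ₁ < 1` then some radial function has negative energy. -/
theorem exists_energy_neg (hN : 1 ≤ N) (h0 : 0 < R₀) (hR : R₀ < R) {β lam : ℝ} (hβ : 0 < β)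
    (hlam : IsDirichletEigenvalue (annulus N R₀ R) lam) (hmas : lam ^ 2 + β * lam < 1) :
    ∃ v, MemHr (annulus N R₀ R) v ∧ MemLp v 4 (volume.restrict (annulus N R₀ R)) ∧
      energy β (annulus N R₀ R) v < 0 := by
  by_contra! hE
  set s := √(β ^ 2 + 4) with hs
  have hs2 : s ^ 2 = β ^ 2 + 4 := Real.sq_sqrt (by positivity)
  have hsβ : β < s := Real.lt_sqrt_of_sq_lt (by linarith)
  set m := (s - β) / 2 with hm
  have hm0 : 0 < m := by
    rw [hm]
    linarith
  have hm1 : m ^ 2 + β * m = 1 := by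
    rw [hm]
    linarith
  have hlm : lam < m := by
    by_contra! h
    nlinarith
  -- The supersolution needs `μ > 0`; the maximum with zero avoids a separate proof that `lam` is
  -- positive.
  obtain ⟨μ, h1, h2⟩ := exists_between (max_lt hlm hm0)
  obtain ⟨F, hF, hpos, hsup⟩ := exists_radial_supersolution N h0 hR ((le_max_right _ _).trans_lt h1)
    h2 fun f hf => integral_radialGreen_sq_le hN h0 hR hβ hm0 hm1 hE hf
  have := le_of_isDirichletEigenvalue hN h0 hR hF hpos hsup hlam
  exact absurd ((le_max_left _ _).trans_lt h1) (not_lt.2 this)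

end Barta

/-! ### Conclusion for the ball and the annulus. -/

section Conclusion

variable {N : ℕ} {Ω : Set (EuclideanSpace ℝ (Fin N))} {R₀ R : ℝ}
  {u : EuclideanSpace ℝ (Fin N) → ℝ} {V w : ℝ → ℝ}

theorem isC1Profile_of_hasDerivAt (hV : ∀ r ∈ Ioo R₀ R, HasDerivAt V (w r) r)
    (hw : ContinuousOn w (Ioo R₀ R)) (huV : ∀ᵐ x ∂(volume.restrict Ω), u x = V ‖x‖) :
    IsC1Profile Ω R₀ R u V := by
  refine ⟨?_, huV⟩
  have : ContDiffOn ℝ (0 + 1) V (Ioo R₀ R) := by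
    rw [contDiffOn_succ_iff_deriv_of_isOpen isOpen_Ioo]
    refine ⟨fun r hr => (hV r hr).differentiableAt.differentiableWithinAt, by simp, ?_⟩
    exact contDiffOn_zero.2 (hw.congr fun r hr => (hV r hr).deriv)
  simpa using this

theorem hasOneSignAE_of_profile (hN : 1 ≤ N) (hΩ : IsRadialDomain Ω R₀ R)
    (huV : ∀ᵐ x ∂(volume.restrict Ω), u x = V ‖x‖) {σ : ℝ} (hσ : σ = 1 ∨ σ = -1)
    (hpos : ∀ r ∈ Ioo R₀ R, 0 ≤ σ * V r) : HasOneSignAE Ω u := by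
  unfold HasOneSignAE
  rw [hΩ.restrict_eq hN] at huV ⊢
  rcases hσ with rfl | rfl
  · left
    filter_upwards [huV, ae_restrict_mem (measurableSet_annulus N R₀ R)] with x hx hxm
    have := hpos _ hxm
    rw [hx]
    linarith
  · right
    filter_upwards [huV, ae_restrict_mem (measurableSet_annulus N R₀ R)] with x hx hxm
    have := hpos _ hxm
    rw [hx]
    linarith

theorem exists_monotone_profile_of_ball (hN : 1 ≤ N) (hΩ : IsRadialDomain Ω 0 R) {β : ℝ}
    (hβ : 0 < β) (hu : IsGlobalRadialMinimizer β Ω u)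
    (hbound : eLpNorm u ⊤ (volume.restrict Ω) ≤ 1) :
    (∃ U : ℝ → ℝ, IsC1Profile Ω 0 R u U ∧ HasOneSignOn (deriv U) 0 R) ∧ HasOneSignAE Ω u := by
  obtain ⟨V, w, q, hV, hw, hDir, huV, hD, hD2⟩ := exists_profile_of_memHr hN hΩ.nonneg hΩ.1
    hΩ.annulus_subset (hΩ.ae_eq_annulus hN) hu.1
  have hVc : ContinuousOn V (Ioo 0 R) := fun r hr => (hV r hr).continuousAt.continuousWithinAt
  have hanti := antitoneOn_abs_of_minimizer hN hΩ hβ hu hw hDir huV hD hD2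
    (abs_profile_le_one hN hΩ hVc huV hbound)
  -- With `r₀ = 0` the increasing part is empty.
  obtain ⟨σ, hσ, hpos, -, hneg⟩ := exists_sign_of_unimodal_abs (r₀ := 0) hV
    (fun x hx => absurd hx.2.1 (not_lt.2 hx.1.2)) (hanti.mono inter_subset_right)
  refine ⟨⟨V, isC1Profile_of_hasDerivAt hV hw.continuousOn huV, ?_⟩,
    hasOneSignAE_of_profile hN hΩ huV hσ hpos⟩
  rcases hσ with rfl | rfl
  · right
    intro r hr
    rw [(hV r hr).deriv]
    linarith [hneg r hr hr.1]
  · left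
    intro r hr
    rw [(hV r hr).deriv]
    linarith [hneg r hr hr.1]

/-- If `w` vanished identically on one side of `r₀`, integration from that boundary radius, where
the profile is zero, would give `V r₀ = 0`. -/
theorem changesFromPosToNeg_of_signs (h0 : 0 < R₀) (hR : R₀ < R) {σ r₀ : ℝ} (hr₀ : r₀ ∈ Ioo R₀ R)
    (hDir : IsDirichletPrimitive V w R₀ R)
    (hσV : 0 < σ * V r₀) (hpos : ∀ r ∈ Ioo R₀ R, r < r₀ → 0 ≤ σ * w r)
    (hneg : ∀ r ∈ Ioo R₀ R, r₀ < r → σ * w r ≤ 0) :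
    ChangesFromPosToNeg (fun r => σ * w r) R₀ R := by
  obtain ⟨hwi, hwz⟩ := hDir.2 h0
  obtain ⟨hwr, hVr⟩ := hDir.1 r₀ hr₀
  have hI : IntervalIntegrable w volume R₀ r₀ := hwi.mono_set (by
    rw [uIcc_of_le hR.le, uIcc_of_le hr₀.1.le]
    exact Icc_subset_Icc_right hr₀.2.le)
  have hsum := intervalIntegral.integral_add_adjacent_intervals hI hwr
  have h1 : V r₀ = ∫ t in R₀..r₀, w t := by linarith
  have hsub1 : Ioo R₀ r₀ ⊆ Ioo R₀ R := Ioo_subset_Ioo_right hr₀.2.le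
  have hsub2 : Ioo r₀ R ⊆ Ioo R₀ R := Ioo_subset_Ioo_left hr₀.1.le
  have hnull : ∀ {a b : ℝ}, a < b → (∀ r ∈ Ioo a b, σ * w r = 0) →
      σ * ∫ t in a..b, w t = 0 := fun {a b} hab h => by
    rw [← intervalIntegral.integral_const_mul, intervalIntegral.integral_of_le hab.le,
      integral_Ioc_eq_integral_Ioo]
    exact setIntegral_eq_zero_of_forall_eq_zero h
  refine ⟨r₀, hr₀, fun r hr => hpos r (hsub1 hr) hr.2, fun r hr => hneg r (hsub2 hr) hr.1, ?_, ?_⟩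
  · by_contra! hcon
    have := hnull hr₀.1 fun r hr => le_antisymm (hcon r hr) (hpos r (hsub1 hr) hr.2)
    rw [← h1] at this
    exact hσV.ne' this
  · by_contra! hcon
    have := hnull hr₀.2 fun r hr => le_antisymm (hneg r (hsub2 hr) hr.1) (hcon r hr)
    rw [hVr, mul_neg, this, neg_zero] at hσV
    exact lt_irrefl _ hσV

theorem exists_unimodal_profile_of_annulus (hN : 1 ≤ N) (h0 : 0 < R₀)
    (hΩ : IsRadialDomain Ω R₀ R) {β lam : ℝ} (hβ : 0 < β) (hlam : IsDirichletEigenvalue Ω lam)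
    (hmas : lam ^ 2 + β * lam < 1) (hu : IsGlobalRadialMinimizer β Ω u)
    (hbound : eLpNorm u ⊤ (volume.restrict Ω) ≤ 1) :
    (∃ U : ℝ → ℝ, IsC1Profile Ω R₀ R u U ∧ ChangesSignExactlyOnce (deriv U) R₀ R) ∧
      HasOneSignAE Ω u := by
  obtain ⟨V, w, q, hV, hw, hDir, huV, hD, hD2⟩ := exists_profile_of_memHr hN hΩ.nonneg hΩ.1
    hΩ.annulus_subset (hΩ.ae_eq_annulus hN) hu.1
  have hVc : ContinuousOn V (Ioo R₀ R) := fun r hr => (hV r hr).continuousAt.continuousWithinAt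
  have hΩeq : Ω = annulus N R₀ R := by
    rcases hΩ.2 with ⟨-, h⟩ | ⟨h, -⟩
    · exact h
    · exact absurd h h0.ne'
  -- A vanishing profile would give nonnegative energy, against the competitor of negative energy
  -- provided by `lam ^ 2 + β * lam < 1`.
  have hne : ∃ r ∈ Ioo R₀ R, V r ≠ 0 := by
    by_contra! hcon
    rw [hΩeq] at hlam
    obtain ⟨v, hv, hv4, hlt⟩ := exists_energy_neg hN h0 hΩ.1 hβ hlam hmas
    rw [← hΩeq] at hv hv4 hlt
    have h1 : 0 ≤ energy β Ω u := by
      refine integral_nonneg_of_ae ?_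
      rw [hΩ.restrict_eq hN] at huV ⊢
      filter_upwards [huV, ae_restrict_mem (measurableSet_annulus N R₀ R)] with x hx hxm
      have hux : u x = 0 := hx.trans (hcon _ hxm)
      have h2 : 0 ≤ ∑ i, weakPartial Ω i u x ^ 2 := Finset.sum_nonneg fun i _ => sq_nonneg _
      simp only [Pi.zero_apply, hux]
      have h3 : 0 ≤ weakLaplacian Ω u x ^ 2 / 2 + β * (∑ i, weakPartial Ω i u x ^ 2) / 2 := by
        positivity
      simpa using h3
    exact absurd (h1.trans (hu.2.2 v hv hv4)) (not_le.2 hlt)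
  obtain ⟨r₀, hr₀, hVr₀, hmono, hanti⟩ := unimodal_abs_of_minimizer hN h0 hΩ hβ hu hw hDir huV hD
    hD2 hne (abs_profile_le_one hN hΩ hVc huV hbound)
  obtain ⟨σ, hσ, hpos, hwpos, hwneg⟩ := exists_sign_of_unimodal_abs hV
    (hmono.mono inter_subset_left) (hanti.mono inter_subset_left)
  have hσ0 : σ ≠ 0 := by rcases hσ with rfl | rfl <;> norm_num
  have hσV : 0 < σ * V r₀ := lt_of_le_of_ne (hpos r₀ hr₀) (mul_ne_zero hσ0 hVr₀).symm
  refine ⟨⟨V, isC1Profile_of_hasDerivAt hV hw.continuousOn huV, ?_⟩,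
    hasOneSignAE_of_profile hN hΩ huV hσ hpos⟩
  obtain ⟨ρ, hρ, c1, c2, ⟨r₁, hr₁, d1⟩, r₂, hr₂, d2⟩ :=
    changesFromPosToNeg_of_signs h0 hΩ.1 hr₀ hDir hσV hwpos hwneg
  have hs1 : ∀ r ∈ Ioo R₀ ρ, deriv V r = w r := fun r hr => (hV r ⟨hr.1, hr.2.trans hρ.2⟩).deriv
  have hs2 : ∀ r ∈ Ioo ρ R, deriv V r = w r := fun r hr => (hV r ⟨hρ.1.trans hr.1, hr.2⟩).deriv
  rcases hσ with rfl | rfl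
  · left
    simp only [one_mul] at c1 c2 d1 d2
    exact ⟨ρ, hρ, fun r hr => (hs1 r hr) ▸ c1 r hr, fun r hr => (hs2 r hr) ▸ c2 r hr,
      ⟨r₁, hr₁, (hs1 r₁ hr₁) ▸ d1⟩, r₂, hr₂, (hs2 r₂ hr₂) ▸ d2⟩
  · right
    simp only [neg_mul, one_mul] at c1 c2 d1 d2
    refine ⟨ρ, hρ, fun r hr => ?_, fun r hr => ?_, ⟨r₁, hr₁, ?_⟩, r₂, hr₂, ?_⟩
    · simp only [hs1 r hr]
      exact c1 r hr
    · simp only [hs2 r hr]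
      exact c2 r hr
    · simp only [hs1 r₁ hr₁]
      exact d1
    · simp only [hs2 r₂ hr₂]
      exact d2

end Conclusion

theorem theorem1p5 (N : ℕ) (hN : 1 ≤ N) (Ω : Set (EuclideanSpace ℝ (Fin N)))
    (β lam : ℝ) (hβ : 0 < β) (hlam : IsFirstDirichletEigenvalue Ω lam)
    (hmas : lam ^ 2 + β * lam < 1)
    (u : EuclideanSpace ℝ (Fin N) → ℝ) (hu : IsGlobalRadialMinimizer β Ω u)
    (hbound : eLpNorm u ⊤ (volume.restrict Ω) ≤ 1) :
    (∀ R : ℝ, 0 < R → Ω = Metric.ball 0 R →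
      (∃ U : ℝ → ℝ, IsC1Profile Ω 0 R u U ∧ HasOneSignOn (deriv U) 0 R) ∧
      HasOneSignAE Ω u) ∧
    (∀ R₀ R : ℝ, 0 < R₀ → R₀ < R → Ω = annulus N R₀ R →
      (∃ U : ℝ → ℝ, IsC1Profile Ω R₀ R u U ∧ ChangesSignExactlyOnce (deriv U) R₀ R) ∧
      HasOneSignAE Ω u) :=
  ⟨fun _ hR h => exists_monotone_profile_of_ball hN ⟨hR, Or.inr ⟨rfl, h⟩⟩ hβ hu hbound,
    fun _ _ h0 hR h => exists_unimodal_profile_of_annulus hN h0 ⟨hR, Or.inl ⟨h0, h⟩⟩ hβ hlam.1 hmas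
      hu hbound⟩
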